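/- Let $F$ be a field of characteristic zero with algebraic closure $\overline{F}$, and let $G$ be a (not necessarily connected) reductive group over $F$, i.e. a smooth affine algebraic group over $F$ such that $G_{\overline F}$ has no nontrivial closed connected normal unipotent subgroup. Let $\theta : G \to G$ be an automorphism of $G$ over $F$ with $\theta^2 = 1$, and denote also by $\theta$ the induced automorphism of the Lie algebra $\mathfrak{g}$ of $G$. Let $G(1) \subseteq G$ be the subgroup fixed by $\theta$ and let $\mathfrak{g}(\pm 1)$ be the $\pm 1$-eigenspaces of $\theta$ on $\mathfrak{g}$; the group $G(1)$ acts on $\mathfrak{g}(-1)$ by the adjoint action. An element $X \in \mathfrak{g}(-1)(\overline{F})$ is called relatively regular if its $G(1)(\overline{F})$-orbit has maximal dimension among all $G(1)(\overline{F})$-orbits in $\mathfrak{g}(-1)(\overline{F})$, and $\mathfrak{g}(-1)^{rr}(F)$ denotes the set of elements of $\mathfrak{g}(-1)(F)$ that are relatively regular in $\mathfrak{g}(-1)(\overline{F})$. An element of $\mathfrak{g}(F)$ is called nilpotent if it acts nilpotently on every finite-dimensional algebraic representation of $G$ (equivalently, if it acts on $F[G]$, as a left invariant derivation, by a locally nilpotent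 endomorphism). Let $e \in \mathfrak{g}(-1)^{rr}(F)$ be a nonzero, relatively regular, nilpotent element. Then there exist $f \in \mathfrak{g}(-1)^{rr}(F)$ and $h \in \mathfrak{g}(1)(F)$ such that $(e,f,h)$ is an $\mathfrak{sl}_2$-triple, i.e. $e,f,h$ are nonzero and $$[h,e]=2e,\qquad [h,f]=-2f,\qquad [e,f]=h .$$ -/

import Mathlib

open scoped TensorProduct Topology

/-! An affine algebraic group `G` over a field `k` is given by its coordinate ring: a commutative
Hopf algebra `B = k[G]`, of finite type over `k`. The base change of `G` to an extension `K` of `k`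
has coordinate ring `K ⊗[k] B`. -/

namespace AlgebraicGroup

noncomputable section

section General

variable (k B : Type*) [Field k] [CommRing B] [HopfAlgebra k B]

/-- The group `G(k)` of `k`-points: algebra homomorphisms `k[G] → k` under convolution. -/
abbrev Points : Type _ := WithConv (B →ₐ[k] k)

/-- The Zariski topology on `G(k)`: the sets where a regular function does not vanish are a
basis of open sets. -/
abbrev zariskiTopology : TopologicalSpace (Points k B) :=
  TopologicalSpace.generateFrom {U | ∃ b : B, U = {g : Points k B | g.ofConv b ≠ 0}}

variable {k B}

/-- Right translation of regular functions by `g ∈ G(k)`: `(ρ_g b)(x) = b (x g)`, that is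
`ρ_g b = ∑ b₍₁₎ g(b₍₂₎)`. -/
def rightTranslation (g : Points k B) : B →ₐ[k] B :=
  (Algebra.TensorProduct.rid k k B).toAlgHom.comp
    ((Algebra.TensorProduct.map (AlgHom.id k B) g.ofConv).comp (Bialgebra.comulAlgHom k B))

/-- `g ∈ G(k)` is unipotent: the endomorphism `ρ_g - 1` of `k[G]` is locally nilpotent. -/
def IsUnipotent (g : Points k B) : Prop :=
  ∀ b : B, ∃ n : ℕ, (((rightTranslation g).toLinearMap - LinearMap.id : Module.End k B) ^ n) b = 0

variable (k B) in
/-- For `k` algebraically closed: `G` is a (not necessarily connected) reductive group, that is, it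
is smooth (over an algebraically closed field this means that `k[G]` is reduced) and its unipotent
radical is trivial: the only closed connected normal subgroup of `G(k)` consisting of unipotent
elements is the trivial one. -/
structure IsReductive : Prop where
  isReduced : IsReduced B
  unipotentRadical_trivial : ∀ N : Subgroup (Points k B), N.Normal →
    IsClosed[zariskiTopology k B] (N : Set (Points k B)) →
    @IsConnected _ (zariskiTopology k B) (N : Set (Points k B)) →
    (∀ g ∈ N, IsUnipotent g) → N = ⊥

variable (k B) in
/-- The Lie algebra of `G`: the left invariant derivations of `k[G]`, with the commutator
bracket. -/
def lieAlgebra : LieSubalgebra k (Derivation k B B) where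
  carrier := {D | ∀ b : B, Coalgebra.comul (R := k) (D b) =
    (D : B →ₗ[k] B).lTensor B (Coalgebra.comul b)}
  add_mem' {D E} hD hE b := by
    simp only [Set.mem_ofPred_eq] at hD hE
    simp [hD b, hE b, LinearMap.lTensor_add]
  zero_mem' b := by simp
  smul_mem' c D hD b := by
    simp only [Set.mem_ofPred_eq] at hD
    simp [hD b, LinearMap.lTensor_smul]
  lie_mem' {D E} hD hE b := by
    simp only [Set.mem_ofPred_eq] at hD hE
    have key : ∀ t : B ⊗[k] B, ((⁅D, E⁆ : Derivation k B B) : B →ₗ[k] B).lTensor B t =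
        (D : B →ₗ[k] B).lTensor B ((E : B →ₗ[k] B).lTensor B t) -
        (E : B →ₗ[k] B).lTensor B ((D : B →ₗ[k] B).lTensor B t) := by
      intro t
      induction t with
      | zero => simp
      | tmul x y =>
        simp only [LinearMap.lTensor_tmul, Derivation.coeFn_coe, Derivation.commutator_apply,
          TensorProduct.tmul_sub]
      | add x y hx hy => rw [map_add, hx, hy]; simp only [map_add]; abel
    rw [key, Derivation.commutator_apply, map_sub, hD, hE, hE, hD]

theorem comul_rightTranslation (g : Points k B) (b : B) :
    Coalgebra.comul (R := k) (rightTranslation g b) =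
      (rightTranslation g).toLinearMap.lTensor B (Coalgebra.comul b) := by
  have h1 : ∀ (s : B ⊗[k] B) (y : B), g.ofConv y • s =
      ((TensorProduct.rid k B).toLinearMap ∘ₗ g.ofConv.toLinearMap.lTensor B).lTensor B
        (TensorProduct.assoc k B B B (s ⊗ₜ y)) := by
    intro s y
    induction s with
    | zero => simp
    | tmul a b => simp
    | add a b ha hb => rw [smul_add, ha, hb, TensorProduct.add_tmul, map_add, map_add]
  have h2 : ∀ t : B ⊗[k] B,
      Coalgebra.comul (R := k) (TensorProduct.rid k B (g.ofConv.toLinearMap.lTensor B t)) =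
      ((TensorProduct.rid k B).toLinearMap ∘ₗ g.ofConv.toLinearMap.lTensor B).lTensor B
        (TensorProduct.assoc k B B B ((Coalgebra.comul (R := k)).rTensor B t)) := by
    intro t
    induction t with
    | zero => simp
    | tmul a b => simp [← h1]
    | add a b ha hb => simp only [map_add, ha, hb]
  have h3 : (rightTranslation g).toLinearMap = ((TensorProduct.rid k B).toLinearMap ∘ₗ
      g.ofConv.toLinearMap.lTensor B) ∘ₗ Coalgebra.comul := rfl
  refine (h2 (Coalgebra.comul b)).trans ?_
  rw [Coalgebra.coassoc_apply, h3, LinearMap.lTensor_comp _ _ Coalgebra.comul]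
  rfl

theorem rightTranslation_mul (g h : Points k B) (b : B) :
    rightTranslation (g * h) b = rightTranslation g (rightTranslation h b) := by
  let Φ : B ⊗[k] (B ⊗[k] B) →ₗ[k] B := (TensorProduct.rid k B).toLinearMap ∘ₗ
    (LinearMap.mul' k k ∘ₗ TensorProduct.map g.ofConv.toLinearMap h.ofConv.toLinearMap).lTensor B
  have h1 : ∀ (s : B ⊗[k] B) (y : B),
      h.ofConv y • TensorProduct.rid k B (g.ofConv.toLinearMap.lTensor B s) =
        Φ (TensorProduct.assoc k B B B (s ⊗ₜ y)) := by
    intro s y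
    induction s with
    | zero => simp
    | tmul a b => simp [Φ, smul_smul, mul_comm]
    | add a b ha hb =>
      rw [map_add, map_add, smul_add, ha, hb, TensorProduct.add_tmul, map_add, map_add]
  have h2 : ∀ t : B ⊗[k] B,
      rightTranslation g (TensorProduct.rid k B (h.ofConv.toLinearMap.lTensor B t)) =
        Φ (TensorProduct.assoc k B B B ((Coalgebra.comul (R := k)).rTensor B t)) := by
    intro t
    induction t with
    | zero => simp
    | tmul a b =>
      simp only [LinearMap.rTensor_tmul, ← h1, LinearMap.lTensor_tmul, TensorProduct.rid_tmul,
        map_smul]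
      rfl
    | add a b ha hb => simp only [map_add, ha, hb]
  refine Eq.trans ?_ (h2 (Coalgebra.comul b)).symm
  rw [Coalgebra.coassoc_apply]
  change TensorProduct.rid k B (((LinearMap.mul' k k ∘ₗ TensorProduct.map g.ofConv.toLinearMap
    h.ofConv.toLinearMap) ∘ₗ Coalgebra.comul).lTensor B (Coalgebra.comul b)) = _
  rw [LinearMap.lTensor_comp]
  rfl

theorem rightTranslation_one (b : B) : rightTranslation (1 : Points k B) b = b := by
  change TensorProduct.rid k B ((Coalgebra.counit (R := k)).lTensor B (Coalgebra.comul b)) = b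
  simp

/-- The adjoint action of `G(k)` on the Lie algebra: `Ad(g) X = ρ_g ∘ X ∘ ρ_g⁻¹`. -/
def Ad (g : Points k B) (X : lieAlgebra k B) : lieAlgebra k B where
  val := Derivation.mk' ((rightTranslation g).toLinearMap ∘ₗ (X.1 : B →ₗ[k] B) ∘ₗ
      (rightTranslation g⁻¹).toLinearMap) (fun a b => by
    have hg : ∀ c : B, rightTranslation g (rightTranslation g⁻¹ c) = c := fun c => by
      rw [← rightTranslation_mul, mul_inv_cancel, rightTranslation_one]
    simp [hg])
  property b := by
    have hX : ∀ c : B, Coalgebra.comul (R := k) (X.1 c) =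
      (X.1 : B →ₗ[k] B).lTensor B (Coalgebra.comul c) := X.2
    change Coalgebra.comul (R := k) (rightTranslation g (X.1 (rightTranslation g⁻¹ b))) =
      ((rightTranslation g).toLinearMap ∘ₗ (X.1 : B →ₗ[k] B) ∘ₗ
        (rightTranslation g⁻¹).toLinearMap).lTensor B (Coalgebra.comul b)
    rw [comul_rightTranslation, hX, comul_rightTranslation, LinearMap.lTensor_comp,
      LinearMap.lTensor_comp]
    rfl

/-- The differential `dθ` of an automorphism `θ` of `G` (given by its comorphism, an automorphism
of the Hopf algebra `k[G]`): `dθ(X) = (θ^*)⁻¹ ∘ X ∘ θ^*`. -/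
def differential (θ : B ≃ₐc[k] B) : lieAlgebra k B →ₗ[k] lieAlgebra k B where
  toFun X :=
    { val := Derivation.mk' ((θ.symm : B →ₗ[k] B) ∘ₗ (X.1 : B →ₗ[k] B) ∘ₗ
          (θ : B →ₗ[k] B)) (fun a b => by simp)
      property := fun b => by
        have hX : ∀ c : B, Coalgebra.comul (R := k) (X.1 c) =
          (X.1 : B →ₗ[k] B).lTensor B (Coalgebra.comul c) := X.2
        change Coalgebra.comul (R := k) (θ.symm (X.1 (θ b))) =
          ((θ.symm : B →ₗ[k] B) ∘ₗ (X.1 : B →ₗ[k] B) ∘ₗ (θ : B →ₗ[k] B)).lTensor B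
            (Coalgebra.comul b)
        have h1 : ∀ t : B ⊗[k] B, TensorProduct.map (θ.symm : B →ₗ[k] B) (θ.symm : B →ₗ[k] B)
            ((X.1 : B →ₗ[k] B).lTensor B
              (TensorProduct.map (θ : B →ₗ[k] B) (θ : B →ₗ[k] B) t)) =
            ((θ.symm : B →ₗ[k] B) ∘ₗ (X.1 : B →ₗ[k] B) ∘ₗ (θ : B →ₗ[k] B)).lTensor B t := by
          intro t
          induction t with
          | zero => simp
          | tmul x y => simp
          | add x y hx hy => simp only [map_add, hx, hy]
        rw [← CoalgHomClass.map_comp_comul_apply, hX, ← CoalgHomClass.map_comp_comul_apply]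
        exact h1 _ }
  map_add' X Y := by
    ext b
    change θ.symm (X.1 (θ b) + Y.1 (θ b)) = θ.symm (X.1 (θ b)) + θ.symm (Y.1 (θ b))
    exact map_add _ _ _
  map_smul' c X := by
    ext b
    change θ.symm (c • X.1 (θ b)) = c • θ.symm (X.1 (θ b))
    exact map_smul _ _ _

/-- `g(1)`, the `1`-eigenspace of `dθ` on the Lie algebra. -/
def eigenPlus (θ : B ≃ₐc[k] B) : Submodule k (lieAlgebra k B) :=
  Module.End.eigenspace (differential θ) 1

/-- `g(-1)`, the `(-1)`-eigenspace of `dθ` on the Lie algebra. -/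
def eigenMinus (θ : B ≃ₐc[k] B) : Submodule k (lieAlgebra k B) :=
  Module.End.eigenspace (differential θ) (-1)

/-- `G(1)(k)`: the subgroup of `G(k)` of points fixed by `θ`. -/
def fixedPoints (θ : B ≃ₐc[k] B) : Subgroup (Points k B) where
  carrier := {g | ∀ b : B, g.ofConv (θ b) = g.ofConv b}
  mul_mem' {g h} hg hh b := by
    have h1 := AlgHom.convMul_comp_bialgHom_distrib g h (θ : B →ₐc[k] B)
    have hg' : g.ofConv.comp ((θ : B →ₐc[k] B) : B →ₐ[k] B) = g.ofConv := AlgHom.ext hg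
    have hh' : h.ofConv.comp ((θ : B →ₐc[k] B) : B →ₐ[k] B) = h.ofConv := AlgHom.ext hh
    rw [hg', hh'] at h1
    exact DFunLike.congr_fun h1 b
  one_mem' b := by
    change algebraMap k k (Coalgebra.counit (θ b)) = algebraMap k k (Coalgebra.counit b)
    simp
  inv_mem' {g} hg b := by
    have h1 := AlgHom.convMul_comp_bialgHom_distrib g⁻¹ g (θ : B →ₐc[k] B)
    have hg' : g.ofConv.comp ((θ : B →ₐc[k] B) : B →ₐ[k] B) = g.ofConv := AlgHom.ext hg
    have h2 : (1 : Points k B).ofConv.comp ((θ : B →ₐc[k] B) : B →ₐ[k] B) =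
        (1 : Points k B).ofConv := by
      ext c
      change algebraMap k k (Coalgebra.counit (θ c)) = algebraMap k k (Coalgebra.counit c)
      simp
    rw [hg', inv_mul_cancel, h2] at h1
    have h3 := eq_inv_of_mul_eq_one_left (WithConv.ofConv_injective h1.symm)
    exact DFunLike.congr_fun (congrArg WithConv.ofConv h3) b

/-- The orbit of `X` under the adjoint action of `G(1)(k)`. -/
def orbit (θ : B ≃ₐc[k] B) (X : lieAlgebra k B) : Set (lieAlgebra k B) :=
  {Y | ∃ g ∈ fixedPoints θ, Y = Ad g X}

/-- The dimension of a subset `S` of a finite dimensional vector space `V` over an algebraically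
closed field `k`, that is, of its Zariski closure: the Krull dimension of the ring of polynomial
functions on `V`, restricted to `S` (the coordinate ring of the Zariski closure of `S`). -/
def zariskiDim {V : Type*} [AddCommGroup V] [Module k V] (S : Set V) : WithBot ℕ∞ :=
  ringKrullDim (Algebra.adjoin k
    (Set.range fun (φ : Module.Dual k V) (s : S) => φ (s : V)) : Subalgebra k (S → k))

/-- For `k` algebraically closed: the relatively regular elements of `g(-1)`, those whose
`G(1)(k)`-orbit has maximal dimension among all `G(1)(k)`-orbits in `g(-1)`. -/
def relativelyRegular (θ : B ≃ₐc[k] B) : Set (lieAlgebra k B) :=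
  {X | X ∈ eigenMinus θ ∧ ∀ Y ∈ eigenMinus θ, zariskiDim (k := k) (orbit θ Y) ≤
    zariskiDim (k := k) (orbit θ X)}

/-- An element of the Lie algebra of `G` is nilpotent: as an endomorphism of `k[G]` it is locally
nilpotent (equivalently, it acts nilpotently on every finite dimensional representation
of `G`). -/
def IsNilpotentElement (X : lieAlgebra k B) : Prop :=
  ∀ b : B, ∃ n : ℕ, (((X : Derivation k B B) : Module.End k B) ^ n) b = 0

end General

section BaseChange

variable {F A : Type*} [Field F] [CommRing A] [HopfAlgebra F A] (K : Type*) [Field K] [Algebra F K]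

/-- The base change to `K` of an automorphism of `G`. -/
def autBaseChange (θ : A ≃ₐc[F] A) : K ⊗[F] A ≃ₐc[K] K ⊗[F] A :=
  BialgEquiv.ofBialgHom
    (Bialgebra.TensorProduct.map (BialgHom.id K K) (θ : A →ₐc[F] A))
    (Bialgebra.TensorProduct.map (BialgHom.id K K) (θ.symm : A →ₐc[F] A))
    (by
      ext x
      induction x with
      | zero => simp
      | add x y hx hy => rw [map_add, hx, hy, map_add]
      | tmul r x => simp)
    (by
      ext x
      induction x with
      | zero => simp
      | add x y hx hy => rw [map_add, hx, hy, map_add]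
      | tmul r x => simp)

/-- The inclusion of the Lie algebra of `G` into the Lie algebra of `G_K`:
`X ↦ id ⊗ X`. -/
def lieBaseChange (X : lieAlgebra F A) : lieAlgebra K (K ⊗[F] A) where
  val := Derivation.mk' ((X.1 : A →ₗ[F] A).baseChange K) (fun a b => by
    induction a with
    | zero => simp
    | add x y hx hy => simp only [add_mul, map_add, hx, hy, add_smul, smul_add]; abel
    | tmul r x =>
      induction b with
      | zero => simp
      | add x y hx hy => simp only [mul_add, map_add, hx, hy, add_smul, smul_add]; abel
      | tmul s y => simp [TensorProduct.tmul_add, mul_comm])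
  property b := by
    have hX : ∀ c : A, Coalgebra.comul (R := F) (X.1 c) =
      (X.1 : A →ₗ[F] A).lTensor A (Coalgebra.comul c) := X.2
    change Coalgebra.comul (R := K) ((X.1 : A →ₗ[F] A).baseChange K b) =
      ((X.1 : A →ₗ[F] A).baseChange K).lTensor (K ⊗[F] A) (Coalgebra.comul b)
    induction b with
    | zero => simp
    | add x y hx hy => simp only [map_add, hx, hy]
    | tmul r a =>
      have h1 : ∀ t : A ⊗[F] A,
          TensorProduct.AlgebraTensorModule.tensorTensorTensorComm F K F K K K A A
            (Coalgebra.comul (R := K) r ⊗ₜ[F] (X.1 : A →ₗ[F] A).lTensor A t) =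
          ((X.1 : A →ₗ[F] A).baseChange K).lTensor (K ⊗[F] A)
            (TensorProduct.AlgebraTensorModule.tensorTensorTensorComm F K F K K K A A
              (Coalgebra.comul (R := K) r ⊗ₜ[F] t)) := by
        intro t
        induction t with
        | zero => simp
        | add x y hx hy => simp only [map_add, TensorProduct.tmul_add, hx, hy]
        | tmul x y => simp [CommSemiring.comul_apply]
      rw [LinearMap.baseChange_tmul, TensorProduct.comul_tmul, TensorProduct.comul_tmul]
      change TensorProduct.AlgebraTensorModule.tensorTensorTensorComm F K F K K K A A
        (Coalgebra.comul (R := K) r ⊗ₜ[F] Coalgebra.comul (R := F) (X.1 a)) = _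
      rw [hX, h1]

/-- The `F`-points of the relatively regular locus of `g(-1)`: elements of `g(-1)(F)` that
are relatively regular over the algebraic closure `K` of `F`. -/
def relativelyRegularPoints (θ : A ≃ₐc[F] A) : Set (lieAlgebra F A) :=
  {X | X ∈ eigenMinus θ ∧ lieBaseChange K X ∈ relativelyRegular (autBaseChange K θ)}

end BaseChange

end

end AlgebraicGroup

namespace AlgebraicGroup

/-! ### Derivations in characteristic zero and Krull dimension -/

section CommutativeAlgebra

/-! The proof produces a graded Jacobson–Morozov triple over `F`, with `f` in g(-1) and `h` in g(1),
and then shows over the algebraic closure that the G(1)-orbits of `e` and `f` have the same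
dimension, so that `f` inherits maximality from `e`.

Both halves rest on a nondegenerate invariant symmetric form on the Lie algebra over the closure
(`IsReductive.exists_bilinForm`): the trace form of a θ-stable finite dimensional subcomodule
generating the coordinate ring. Its radical is stable under Ad. A radical element is orthogonal to
its own replicas, which lie in the Lie algebra, and so is nilpotent by the argument of Cartan's
criterion. By Engel's theorem, an Ad-stable Lie algebra n of nilpotent elements defines a filtration
of the coordinate ring. The elements of the group acting trivially on the graded pieces form a
closed connected normal unipotent subgroup. Reductivity makes it trivial, and in characteristic zero
this forces n = 0.

Triple: if T is nilpotent and [T,[T,S]] = 0, then tr(TS) = 0. Hence `e` is orthogonal to the kernel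
of (ad e)^2, and by duality e = [e,[e,z]] for some z over the closure. The equation is linear in z,
so a retraction of the closure onto `F` gives a solution over `F`. Projecting z to g(-1), rescaling,
and correcting by an element of g(-1) centralising `e` gives the triple (`exists_isSl2Triple`).

Orbits: the orbit of X has dimension dim [g(1), X] (`zariskiDim_orbit`), computed by derivations at
a generic point of each component of the fixed group. For X in g(-1), ad X exchanges g(1) and g(-1),
and the θ-invariant form makes the two restrictions negative adjoints, so this dimension is half the
rank of ad X (`two_mul_finrank_map_ad`). A product of exponentials carries `e` to `-f`, so ad e and
ad f have equal rank. -/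

theorem exists_mul_pow_mem_of_mem_minimalPrimes {A : Type*} [CommRing A] {J P : Ideal A}
    (hP : P ∈ J.minimalPrimes) {a : A} (ha : a ∈ P) :
    ∃ s ∉ P, ∃ n : ℕ, s * a ^ n ∈ J := by
  have hPp : P.IsPrime := hP.1.1
  by_contra! h
  -- Locally at `P` the only prime over `J` is `P` itself, so `a` is nilpotent there modulo `J`.
  -- Concretely, a prime over `J` avoiding this monoid would lie inside `P` without containing `a`,
  -- against minimality.
  let M : Submonoid A := P.primeCompl ⊔ Submonoid.powers a
  have hd : Disjoint (J : Set A) (M : Set A) := by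
    rw [Set.disjoint_left]
    intro x hx hxM
    obtain ⟨s, hs, t, ⟨n, rfl⟩, rfl⟩ := Submonoid.mem_sup.mp hxM
    exact h s hs n hx
  obtain ⟨Q, hQ, hJQ, hQM⟩ := Ideal.exists_le_prime_disjoint J M hd
  have hQP : Q ≤ P := by
    intro x hx
    by_contra hxP
    exact Set.disjoint_left.mp hQM hx (Submonoid.mem_sup_left hxP)
  exact Set.disjoint_left.mp hQM (hP.2 ⟨hQ, hJQ⟩ hQP ha)
    (Submonoid.mem_sup_right (Submonoid.mem_powers a))

/-- In characteristic zero, a derivation preserving an ideal preserves its minimal primes. -/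
theorem derivation_mem_of_mem_minimalPrimes {k A : Type*} [Field k] [CharZero k] [CommRing A]
    [Algebra k A] (D : Derivation k A A) {J P : Ideal A} (hJ : ∀ a ∈ J, D a ∈ J)
    (hP : P ∈ J.minimalPrimes) {a : A} (ha : a ∈ P) : D a ∈ P := by
  have hPp : P.IsPrime := hP.1.1
  have key : ∀ (m : ℕ) (s : A) (l : ℕ), s ∉ P → s * a ^ m * (D a) ^ l ∈ J → D a ∈ P := by
    intro m
    induction m with
    | zero =>
      intro s l hs h
      have h1 : s * (D a) ^ l ∈ P := hP.1.2 (by simpa using h)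
      exact hPp.mem_of_pow_mem _ ((hPp.mem_or_mem h1).resolve_left hs)
    | succ m ih =>
      intro s l hs h
      refine ih (s * s) (l + 2) (fun h' => hs ((hPp.mem_or_mem h').elim id id)) ?_
      have h1 := hJ _ h
      -- Differentiating the relation and multiplying by `s * D a` trades one factor `a` for two
      -- factors `D a`; the other terms are multiples of the original relation. Dividing by `m + 1`
      -- uses characteristic zero.
      have h2 : ((m + 1 : ℕ) : k) • (s * s * a ^ m * (D a) ^ (l + 2)) =
          s * D a * D (s * a ^ (m + 1) * (D a) ^ l)
            - (D a * D s + (l : A) * s * D (D a)) * (s * a ^ (m + 1) * (D a) ^ l) := by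
        rw [Algebra.smul_def, map_natCast]
        rcases l with _ | l
        · simp only [Derivation.leibniz, Derivation.leibniz_pow, smul_eq_mul, nsmul_eq_mul,
            Nat.add_sub_cancel, pow_zero, Derivation.map_one_eq_zero]
          push_cast
          ring
        · simp only [Derivation.leibniz, Derivation.leibniz_pow, smul_eq_mul, nsmul_eq_mul,
            Nat.add_sub_cancel]
          push_cast
          ring
      have h3 : ((m + 1 : ℕ) : k) • (s * s * a ^ m * (D a) ^ (l + 2)) ∈ J := by
        rw [h2]
        exact J.sub_mem (J.mul_mem_left _ h1) (J.mul_mem_left _ h)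
      have h4 := (J.restrictScalars k).smul_mem (((m + 1 : ℕ) : k)⁻¹) h3
      rwa [smul_smul, inv_mul_cancel₀ (by exact_mod_cast m.succ_ne_zero), one_smul] at h4
  obtain ⟨s, hs, n, h⟩ := exists_mul_pow_mem_of_mem_minimalPrimes hP ha
  exact key n s 0 hs (by simpa using h)

/-- In characteristic zero, a derivation preserving an ideal preserves its radical. -/
theorem derivation_mem_radical {k A : Type*} [Field k] [CharZero k] [CommRing A]
    [Algebra k A] (D : Derivation k A A) {J : Ideal A} (hJ : ∀ a ∈ J, D a ∈ J)
    {a : A} (ha : a ∈ J.radical) : D a ∈ J.radical := by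
  rw [← Ideal.sInf_minimalPrimes, Ideal.mem_sInf] at ha ⊢
  exact fun {P} hP => derivation_mem_of_mem_minimalPrimes D hJ hP (ha hP)

/-- Derivations extend along formally étale algebras. -/
theorem exists_derivation_extending (R S T : Type*) [CommRing R] [CommRing S] [CommRing T]
    [Algebra R S] [Algebra R T] [Algebra S T] [IsScalarTower R S T] [Algebra.FormallyEtale S T]
    (d : Derivation R S T) : ∃ D : Derivation R T T, ∀ s, D (algebraMap S T s) = d s := by
  refine ⟨(LinearMap.liftBaseChange T d.liftKaehlerDifferential ∘ₗ
    (KaehlerDifferential.tensorKaehlerEquivOfFormallyEtale R S T).symm.toLinearMap).compDer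
      (KaehlerDifferential.D R T), fun s => ?_⟩
  simp [KaehlerDifferential.tensorKaehlerEquivOfFormallyEtale_symm_D_algebraMap]

/-- Incomparability keeps chains of `S` strict after contraction; lying over and going up lift
chains of `R`. -/
theorem ringKrullDim_eq_of_isIntegral {R S : Type*} [CommRing R] [CommRing S] [Algebra R S]
    [Algebra.IsIntegral R S] (h : Function.Injective (algebraMap R S)) :
    ringKrullDim S = ringKrullDim R := by
  refine le_antisymm ?_ ?_
  · exact Order.krullDim_le_of_strictMono (PrimeSpectrum.comap (algebraMap R S))
      fun P Q hPQ => Ideal.IsIntegral.comap_lt_comap hPQ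
  · refine iSup_le fun l => ?_
    obtain ⟨Q, hQ, hQ'⟩ := Ideal.exists_ideal_over_prime_of_isIntegral l.head.asIdeal (⊥ : Ideal S) (by
      rw [← RingHom.ker_eq_comap_bot, (RingHom.injective_iff_ker_eq_bot _).mp h]; exact bot_le)
    have : Q.LiesOver l.head.asIdeal := ⟨hQ'.2.symm⟩
    have := hQ'.1
    obtain ⟨L, hL, -⟩ := Ideal.exists_ltSeries_of_hasGoingUp l Q
    rw [← hL]
    exact Order.LTSeries.length_le_krullDim L

open scoped IntermediateField.algebraAdjoinAdjoin in
/-- In characteristic zero, derivations take arbitrary values on algebraically independent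
elements. -/
theorem exists_derivation_of_algebraicIndependent {K L ι : Type*} [Field K] [Field L] [CharZero K]
    [Algebra K L] {x : ι → L} (hx : AlgebraicIndependent K x) (l : ι → L) :
    ∃ D : Derivation K L L, ∀ i, D (x i) = l i := by
  -- Enlarge `x` to a transcendence basis `s`. Then `L` is formally étale over the polynomial ring
  -- on `s`: a localisation followed by a separable algebraic extension. Derivations of that ring,
  -- which are free on the variables, therefore extend to `L`.
  obtain ⟨s, hxs, hs⟩ := exists_isTranscendenceBasis_superset hx.coe_range
  have hsv : AlgebraicIndependent K ((↑) : s → L) := hs.1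
  have : CharZero L := charZero_of_injective_algebraMap (algebraMap K L).injective
  have halg : Algebra.IsAlgebraic (IntermediateField.adjoin K (Set.range ((↑) : s → L))) L :=
    hs.isAlgebraic_field
  have e1 : Algebra.FormallyEtale (IntermediateField.adjoin K (Set.range ((↑) : s → L))) L :=
    Algebra.FormallyEtale.of_isSeparable _ L
  have e2 : Algebra.FormallyEtale (Algebra.adjoin K (Set.range ((↑) : s → L)))
      (IntermediateField.adjoin K (Set.range ((↑) : s → L))) :=
    .of_isLocalization (nonZeroDivisors _)
  have e3 : Algebra.FormallyEtale (Algebra.adjoin K (Set.range ((↑) : s → L))) L :=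
    .comp _ (IntermediateField.adjoin K (Set.range ((↑) : s → L))) _
  classical
  have hinj : Function.Injective x := hx.injective
  let c : s → L := fun t => if h : ∃ i, x i = t then l h.choose else 0
  let φ : Algebra.adjoin K (Set.range ((↑) : s → L)) ≃ₐ[K] MvPolynomial s K := hsv.aevalEquiv.symm
  let _ : Algebra (MvPolynomial s K) L := (MvPolynomial.aeval ((↑) : s → L)).toAlgebra
  have : IsScalarTower K (MvPolynomial s K) L := .of_algebraMap_eq fun r => by
    simp [RingHom.algebraMap_toAlgebra]
  have hφ : ∀ a : Algebra.adjoin K (Set.range ((↑) : s → L)),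
      algebraMap (MvPolynomial s K) L (φ a) = a := fun a => by
    have h := hsv.algebraMap_aevalEquiv (φ a)
    rw [AlgEquiv.apply_symm_apply] at h
    exact h.symm
  let δ : Derivation K (MvPolynomial s K) L := MvPolynomial.mkDerivation K c
  let d : Derivation K (Algebra.adjoin K (Set.range ((↑) : s → L))) L :=
    Derivation.mk' ((δ : MvPolynomial s K →ₗ[K] L) ∘ₗ φ.toLinearMap) fun a b => by
      simp only [LinearMap.comp_apply, AlgEquiv.toLinearMap_apply, map_mul, Derivation.coeFn_coe,
        Derivation.leibniz, Algebra.smul_def, hφ]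
      rfl
  obtain ⟨D, hD⟩ := exists_derivation_extending K _ L d
  refine ⟨D, fun i => ?_⟩
  have h0 : φ ⟨x i, Algebra.subset_adjoin ⟨⟨x i, hxs ⟨i, rfl⟩⟩, rfl⟩⟩ =
      MvPolynomial.X ⟨x i, hxs ⟨i, rfl⟩⟩ := by
    rw [AlgEquiv.symm_apply_eq]
    ext
    simp
  have h1 : D (x i) = δ (φ ⟨x i, Algebra.subset_adjoin ⟨⟨x i, hxs ⟨i, rfl⟩⟩, rfl⟩⟩) :=
    hD ⟨x i, Algebra.subset_adjoin ⟨⟨x i, hxs ⟨i, rfl⟩⟩, rfl⟩⟩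
  rw [h0, MvPolynomial.mkDerivation_X] at h1
  have h2 : ∃ j, x j = x i := ⟨i, rfl⟩
  have h3 : h2.choose = i := hinj h2.choose_spec
  simpa [c, h3] using h1

/-- Applying `D` to p(a) = 0 gives p'(a) D(a) = 0. If p'(a) = 0, pass to p', which is nonzero of
smaller degree because the characteristic is zero and p is not constant. -/
theorem derivation_eq_zero_of_isAlgebraic {K L R : Type*} [Field K] [Field L] [CharZero L]
    [Algebra K L] [CommRing R] [IsDomain R] [Algebra R L] [FaithfulSMul R L]
    (D : Derivation K L L) (hD : ∀ r : R, D (algebraMap R L r) = 0) {a : L}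
    (ha : IsAlgebraic R a) : D a = 0 := by
  have key : ∀ p : Polynomial R, D (Polynomial.aeval a p) =
      Polynomial.aeval a (Polynomial.derivative p) * D a := by
    intro p
    induction p using Polynomial.induction_on' with
    | add p q hp hq => simp only [map_add, hp, hq, add_mul]
    | monomial n r =>
      simp only [Polynomial.aeval_monomial, Derivation.leibniz, hD, Derivation.leibniz_pow,
        Polynomial.derivative_monomial, map_mul, map_natCast, smul_eq_mul,
        nsmul_eq_mul]
      ring
  have : CharZero R := by
    refine ⟨fun m n h => ?_⟩
    have := congrArg (algebraMap R L) h
    simpa using this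
  obtain ⟨p, hp0, hp⟩ := ha
  induction hn : p.natDegree using Nat.strong_induction_on generalizing p with
  | _ n ih =>
    subst hn
    by_cases hd : Polynomial.aeval a (Polynomial.derivative p) = 0
    · have hpos : p.natDegree ≠ 0 := by
        intro h0
        rw [Polynomial.eq_C_of_natDegree_eq_zero h0] at hp hp0
        rw [Polynomial.aeval_C, FaithfulSMul.algebraMap_eq_zero_iff] at hp
        exact hp0 (by rw [hp, Polynomial.C_0])
      refine ih _ (Polynomial.natDegree_derivative_lt hpos) (Polynomial.derivative p) ?_ hd rfl
      intro h0
      exact hpos (Polynomial.derivative_eq_zero.mp h0)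
    · have := key p
      rw [hp, map_zero] at this
      exact (mul_eq_zero.mp this.symm).resolve_left hd

/-- The values of derivations on generators determine the Krull dimension of a finitely generated
subalgebra of a field of characteristic zero. -/
theorem ringKrullDim_adjoin_range {K L ι : Type*} [Field K] [Field L] [CharZero K]
    [Algebra K L] (y : ι → L) (hy : (Algebra.adjoin K (Set.range y)).FG)
    (M : Submodule L (ι → L))
    (hM : ∀ m, m ∈ M ↔ ∃ D : Derivation K L L, ∀ i, D (y i) = m i) :
    ringKrullDim (Algebra.adjoin K (Set.range y)) = Module.finrank L M := by
  have : Algebra.FiniteType K (Algebra.adjoin K (Set.range y)) :=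
    (Subalgebra.fg_iff_finiteType _).mp hy
  -- By Noether normalisation the dimension is `t`, and the images `x` of the variables are
  -- algebraically independent in `L`.
  obtain ⟨t, g, hg, hint⟩ := exists_integral_inj_algHom_of_fg K (Algebra.adjoin K (Set.range y))
  let _ : Algebra (MvPolynomial (Fin t) K) (Algebra.adjoin K (Set.range y)) := g.toAlgebra
  have : Algebra.IsIntegral (MvPolynomial (Fin t) K) (Algebra.adjoin K (Set.range y)) := ⟨hint⟩
  rw [ringKrullDim_eq_of_isIntegral (R := MvPolynomial (Fin t) K) hg,
    MvPolynomial.ringKrullDim_of_isNoetherianRing, ringKrullDim_eq_zero_of_field]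
  let x : Fin t → L := fun i => (g (MvPolynomial.X i) : L)
  have hgx : ∀ p, ((g p : Algebra.adjoin K (Set.range y)) : L) = MvPolynomial.aeval x p := by
    have : (Subalgebra.val _).comp g = MvPolynomial.aeval x := by
      ext i
      simp [x]
    exact fun p => DFunLike.congr_fun this p
  have hx : AlgebraicIndependent K x := fun p q hpq => by
    rw [← hgx, ← hgx] at hpq
    exact hg (Subtype.ext hpq)
  -- Each `x j` is a polynomial in the `y i`, and each `y i` is algebraic over the `x j`; so a
  -- derivation kills one family exactly when it kills the other.
  have hker : ∀ D : Derivation K L L, (∀ i, D (y i) = 0) ↔ ∀ j, D (x j) = 0 := by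
    intro D
    constructor
    · intro h j
      have : ∀ a ∈ Algebra.adjoin K (Set.range y), D a = 0 := by
        intro a ha
        induction ha using Algebra.adjoin_induction with
        | mem a ha => obtain ⟨i, rfl⟩ := ha; exact h i
        | algebraMap r => exact D.map_algebraMap r
        | add a b _ _ ha hb => rw [map_add, ha, hb, add_zero]
        | mul a b _ _ ha hb => simp [ha, hb]
      exact this _ (g (MvPolynomial.X j)).2
    · intro h i
      have hp : ∀ p : MvPolynomial (Fin t) K, D (MvPolynomial.aeval x p) = 0 := by
        intro p
        induction p using MvPolynomial.induction_on with
        | C a => simp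
        | add p q hp hq => rw [map_add, map_add, hp, hq, add_zero]
        | mul_X p j hp => simp [hp, h j]
      let _ : Algebra (MvPolynomial (Fin t) K) L := (MvPolynomial.aeval x).toAlgebra
      have : FaithfulSMul (MvPolynomial (Fin t) K) L :=
        (faithfulSMul_iff_algebraMap_injective _ _).mpr hx
      have : IsScalarTower (MvPolynomial (Fin t) K) (Algebra.adjoin K (Set.range y)) L :=
        .of_algebraMap_eq fun p => (hgx p).symm
      have : CharZero L := charZero_of_injective_algebraMap (algebraMap K L).injective
      refine derivation_eq_zero_of_isAlgebraic (R := MvPolynomial (Fin t) K) D hp ?_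
      have h1 : IsIntegral (MvPolynomial (Fin t) K)
        (⟨y i, Algebra.subset_adjoin ⟨i, rfl⟩⟩ : Algebra.adjoin K (Set.range y)) := hint _
      exact (h1.algebraMap (B := L)).isAlgebraic
  let Φ : Derivation K L L →ₗ[L] (ι → L) :=
    { toFun := fun D i => D (y i), map_add' := fun _ _ => rfl, map_smul' := fun _ _ => rfl }
  let Ψ : Derivation K L L →ₗ[L] (Fin t → L) :=
    { toFun := fun D i => D (x i), map_add' := fun _ _ => rfl, map_smul' := fun _ _ => rfl }
  have hΨ : LinearMap.range Ψ = ⊤ := by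
    rw [LinearMap.range_eq_top]
    intro l
    obtain ⟨D, hD⟩ := exists_derivation_of_algebraicIndependent hx l
    exact ⟨D, funext hD⟩
  have hΦ : LinearMap.range Φ = M := by
    ext m
    rw [hM]
    simp [Φ, funext_iff]
  have hk : LinearMap.ker Φ = LinearMap.ker Ψ := by
    ext D
    simpa [Φ, Ψ, funext_iff] using hker D
  -- The space of derivations may be infinite dimensional, so its two images are compared as
  -- quotients by the same kernel.
  let E : M ≃ₗ[L] (Fin t → L) := (LinearEquiv.ofEq _ _ hΦ.symm).trans <|
    Φ.quotKerEquivRange.symm.trans <| (Submodule.quotEquivOfEq _ _ hk).trans <|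
    Ψ.quotKerEquivRange.trans <| (LinearEquiv.ofEq _ _ hΨ).trans Submodule.topEquiv
  rw [E.finrank_eq]
  simp

theorem ringKrullDim_le_of_forall_minimalPrimes {R : Type*} [CommRing R] {r : WithBot ℕ∞}
    (h : ∀ p ∈ minimalPrimes R, ringKrullDim (R ⧸ p) ≤ r) : ringKrullDim R ≤ r := by
  refine iSup_le fun l => ?_
  obtain ⟨p, hp, hpl⟩ := Ideal.exists_minimalPrimes_le (I := (⊥ : Ideal R))
    (J := l.head.asIdeal) bot_le
  refine le_trans ?_ (h p hp)
  rw [ringKrullDim_quotient]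
  let l' : LTSeries (PrimeSpectrum.zeroLocus (R := R) p) :=
    { length := l.length
      toFun := fun i => ⟨l i, fun x hx => (l.head_le i : l.head.asIdeal ≤ _) (hpl hx)⟩
      step := fun i => l.step i }
  exact Order.LTSeries.length_le_krullDim l'

/-- A subalgebra whose images modulo all minimal primes have dimension `r` has dimension `r`. -/
theorem ringKrullDim_subalgebra_eq {k Q : Type*} [Field k] [CommRing Q] [Nontrivial Q]
    [Algebra k Q] (S : Subalgebra k Q) {r : WithBot ℕ∞}
    (h : ∀ P ∈ minimalPrimes Q, ringKrullDim (S.map (Ideal.Quotient.mkₐ k P)) = r) :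
    ringKrullDim S = r := by
  let f (P : Ideal Q) : S →+* S.map (Ideal.Quotient.mkₐ k P) :=
    (((Ideal.Quotient.mkₐ k P).comp S.val).codRestrict (S.map (Ideal.Quotient.mkₐ k P))
      fun x => ⟨x, x.2, rfl⟩ : S →ₐ[k] S.map (Ideal.Quotient.mkₐ k P))
  have hf (P : Ideal Q) : Function.Surjective (f P) := by
    rintro ⟨_, x, hx, rfl⟩
    exact ⟨⟨x, hx⟩, rfl⟩
  have hk (P : Ideal Q) : RingHom.ker (f P) = P.comap S.val := by
    ext x
    rw [RingHom.mem_ker, Ideal.mem_comap, ← Ideal.Quotient.eq_zero_iff_mem]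
    exact Subtype.ext_iff
  refine le_antisymm (ringKrullDim_le_of_forall_minimalPrimes fun p hp => ?_) ?_
  -- Since `S` embeds in `Q`, each of its minimal primes is the contraction of a minimal prime of
  -- `Q`.
  · obtain ⟨P, hP, rfl⟩ := Ideal.exists_minimalPrimes_comap_eq (I := ⊥) (S.val : S →+* Q) p (by
      rwa [Ideal.comap_bot_of_injective _ Subtype.val_injective])
    rw [← h P hP]
    refine (ringKrullDim_eq_of_ringEquiv
      ((Ideal.quotEquivOfEq (hk P).symm).trans (RingHom.quotientKerEquivOfSurjective (hf P)))).le
  · obtain ⟨P, hP⟩ := Ideal.nonempty_minimalPrimes (bot_ne_top (α := Ideal Q))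
    rw [← h P hP]
    exact ringKrullDim_le_of_surjective _ (hf P)

end CommutativeAlgebra

end AlgebraicGroup

namespace AlgebraicGroup

noncomputable section

/-! ### Left invariant operators and the convolution algebra -/

section Convolution

open WithConv Coalgebra

variable {k B R : Type*} [Field k] [CommRing B] [HopfAlgebra k B] [CommRing R] [Algebra k R]

/-- A derivation satisfies the Leibniz rule for convolution products. -/
theorem derivation_comp_convMul (D : Derivation k R R) (p q : WithConv (B →ₗ[k] R)) :
    toConv ((D : R →ₗ[k] R) ∘ₗ (p * q).ofConv) =
      toConv ((D : R →ₗ[k] R) ∘ₗ p.ofConv) * q + p * toConv ((D : R →ₗ[k] R) ∘ₗ q.ofConv) := by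
  have key : ∀ t : B ⊗[k] B, D (LinearMap.mul' k R (TensorProduct.map p.ofConv q.ofConv t)) =
      LinearMap.mul' k R (TensorProduct.map ((D : R →ₗ[k] R) ∘ₗ p.ofConv) q.ofConv t) +
      LinearMap.mul' k R (TensorProduct.map p.ofConv ((D : R →ₗ[k] R) ∘ₗ q.ofConv) t) := by
    intro t
    induction t with
    | zero => simp
    | add x y hx hy => simp only [map_add, hx, hy]; abel
    | tmul x y => simp; ring
  ext b
  exact key (comul b)

/-- A functional on `k[G]`, viewed as an `R`-valued linear map. -/
def extend (R : Type*) [CommRing R] [Algebra k R] (ψ : B →ₗ[k] k) : WithConv (B →ₗ[k] R) :=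
  toConv (Algebra.linearMap k R ∘ₗ ψ)

@[simp]
theorem extend_apply (ψ : B →ₗ[k] k) (b : B) : extend R ψ b = algebraMap k R (ψ b) := rfl

theorem extend_mul (ψ φ : WithConv (B →ₗ[k] k)) :
    extend R (ψ * φ).ofConv = extend R ψ.ofConv * extend R φ.ofConv := by
  apply ofConv_injective
  exact LinearMap.algHom_comp_convMul_distrib (Algebra.ofId k R) ψ φ

theorem algHom_comp_mul {R' : Type*} [CommRing R'] [Algebra k R'] (u : R →ₐ[k] R')
    (p q : WithConv (B →ₗ[k] R)) : toConv (u.toLinearMap ∘ₗ (p * q).ofConv) =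
      toConv (u.toLinearMap ∘ₗ p.ofConv) * toConv (u.toLinearMap ∘ₗ q.ofConv) := by
  apply ofConv_injective
  exact LinearMap.algHom_comp_convMul_distrib u p q

theorem algHom_comp_extend {R' : Type*} [CommRing R'] [Algebra k R'] (u : R →ₐ[k] R')
    (ψ : B →ₗ[k] k) : toConv (u.toLinearMap ∘ₗ (extend R ψ).ofConv) = extend R' ψ := by
  ext b
  simp

theorem derivation_comp_extend (D : Derivation k R R) (ψ : B →ₗ[k] k) :
    toConv ((D : R →ₗ[k] R) ∘ₗ (extend R ψ).ofConv) = 0 := by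
  ext b
  simp

variable (k B) in
/-- The identity of `k[G]` as an element of the convolution ring. -/
abbrev convId : WithConv (B →ₗ[k] B) := toConv LinearMap.id

variable (k B) in
/-- The antipode of `k[G]` as an element of the convolution ring. -/
abbrev convAntipode : WithConv (B →ₗ[k] B) := toConv (HopfAlgebra.antipode k)

theorem convId_mul_convAntipode : convId k B * convAntipode k B = 1 := LinearMap.id_mul_antipode

theorem convAntipode_mul_convId : convAntipode k B * convId k B = 1 := LinearMap.antipode_mul_id

/-- An endomorphism of `k[G]` is left invariant if it commutes with left translations. -/
def LeftInvariant (T : B →ₗ[k] B) : Prop := ∀ b, comul (R := k) (T b) = T.lTensor B (comul b)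

theorem leftInvariant_lie (X : lieAlgebra k B) : LeftInvariant (X.1 : B →ₗ[k] B) := X.2

theorem leftInvariant_rightTranslation (g : Points k B) :
    LeftInvariant (rightTranslation g).toLinearMap := comul_rightTranslation g

/-- Left invariance moves `T` onto the second tensor factor of the comultiplication. Taking the
counit for `q` identifies `T` with right convolution by a functional. -/
theorem LeftInvariant.convMul_comp {T : B →ₗ[k] B} (hT : LeftInvariant T)
    (p q : WithConv (B →ₗ[k] R)) :
    toConv ((p * q).ofConv ∘ₗ T) = p * toConv (q.ofConv ∘ₗ T) := by
  ext b
  change LinearMap.mul' k R (TensorProduct.map p.ofConv q.ofConv (comul (T b))) =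
    LinearMap.mul' k R (TensorProduct.map p.ofConv (q.ofConv ∘ₗ T) (comul b))
  rw [hT b, ← LinearMap.comp_apply (TensorProduct.map _ _), LinearMap.map_comp_lTensor]

/-- A left invariant endomorphism is convolution with a functional. -/
theorem LeftInvariant.eq_convId_mul {T : B →ₗ[k] B} (hT : LeftInvariant T) :
    toConv T = convId k B * extend B (counit ∘ₗ T) := by
  have h := hT.convMul_comp (convId k B) 1
  rw [mul_one] at h
  exact h

/-- Convolution with a functional on the right: `b ↦ ∑ b₍₁₎ ψ(b₍₂₎)`. -/
def rho (ψ : B →ₗ[k] k) : B →ₗ[k] B := (convId k B * extend B ψ).ofConv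

/-- Convolution with a functional on the left: `b ↦ ∑ ψ(b₍₁₎) b₍₂₎`. -/
def lam (ψ : B →ₗ[k] k) : B →ₗ[k] B := (extend B ψ * convId k B).ofConv

theorem LeftInvariant.eq_rho {T : B →ₗ[k] B} (hT : LeftInvariant T) :
    T = rho (counit ∘ₗ T) := congrArg ofConv hT.eq_convId_mul

theorem lie_eq_rho (X : lieAlgebra k B) (b : B) : X.1 b = rho (counit ∘ₗ (X.1 : B →ₗ[k] B)) b :=
  DFunLike.congr_fun (leftInvariant_lie X).eq_rho b

theorem rightTranslation_eq_rho (g : Points k B) (b : B) :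
    rightTranslation g b = rho g.ofConv.toLinearMap b := by
  have key : ∀ t : B ⊗[k] B, TensorProduct.rid k B (g.ofConv.toLinearMap.lTensor B t) =
      LinearMap.mul' k B (TensorProduct.map LinearMap.id
        (Algebra.linearMap k B ∘ₗ g.ofConv.toLinearMap) t) := by
    intro t
    induction t with
    | zero => simp
    | add x y hx hy => simp only [map_add, hx, hy]
    | tmul x y => simp [Algebra.smul_def, mul_comm]
  exact key (comul b)

theorem rho_add (ψ φ : B →ₗ[k] k) : rho (ψ + φ) = rho ψ + rho φ := by
  have : extend B (ψ + φ) = extend B ψ + extend B φ := by ext b; simp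
  rw [rho, this, mul_add]
  rfl

theorem rho_smul (c : k) (ψ : B →ₗ[k] k) : rho (c • ψ) = c • rho ψ := by
  have : extend B (c • ψ) = c • extend B ψ := by
    ext b
    change algebraMap k B (c • ψ b) = c • algebraMap k B (ψ b)
    rw [smul_eq_mul, map_mul, Algebra.smul_def]
  rw [rho, this, mul_smul_comm]
  rfl

theorem rho_counit (b : B) : rho (counit : B →ₗ[k] k) b = b := by
  have : extend B (counit : B →ₗ[k] k) = 1 := rfl
  rw [rho, this, mul_one]
  rfl

/-- Tested against functionals, `rho` is right multiplication in the dual algebra and, by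
`functional_lam`, `lam` is left multiplication. That the two commute is then associativity. -/
theorem functional_rho (ψ φ : B →ₗ[k] k) (b : B) : φ (rho ψ b) = (toConv φ * toConv ψ) b := by
  have key : ∀ t : B ⊗[k] B, φ (LinearMap.mul' k B (TensorProduct.map LinearMap.id
      (Algebra.linearMap k B ∘ₗ ψ) t)) = LinearMap.mul' k k (TensorProduct.map φ ψ t) := by
    intro t
    induction t with
    | zero => simp
    | add x y hx hy => simp only [map_add, hx, hy]
    | tmul x y =>
      simp only [TensorProduct.map_tmul, LinearMap.mul'_apply, LinearMap.id_apply,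
        LinearMap.comp_apply, Algebra.linearMap_apply, mul_comm x, ← Algebra.smul_def, map_smul,
        smul_eq_mul, mul_comm (φ x)]
  exact key (comul b)

theorem functional_lam (ψ φ : B →ₗ[k] k) (b : B) : φ (lam ψ b) = (toConv ψ * toConv φ) b := by
  have key : ∀ t : B ⊗[k] B, φ (LinearMap.mul' k B (TensorProduct.map
      (Algebra.linearMap k B ∘ₗ ψ) LinearMap.id t)) =
        LinearMap.mul' k k (TensorProduct.map ψ φ t) := by
    intro t
    induction t with
    | zero => simp
    | add x y hx hy => simp only [map_add, hx, hy]
    | tmul x y =>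
      simp only [TensorProduct.map_tmul, LinearMap.mul'_apply, LinearMap.id_apply,
        LinearMap.comp_apply, Algebra.linearMap_apply, ← Algebra.smul_def, map_smul,
        smul_eq_mul]
  exact key (comul b)

theorem eq_of_forall_functional {V : Type*} [AddCommGroup V] [Module k V] {v w : V}
    (h : ∀ φ : V →ₗ[k] k, φ v = φ w) : v = w := by
  rw [← sub_eq_zero, ← Module.forall_dual_apply_eq_zero_iff k]
  intro φ
  rw [map_sub, h, sub_self]

theorem tensor_eq_zero_of_forall_functional {t : B ⊗[k] B}
    (h : ∀ ψ : B →ₗ[k] k, LinearMap.mul' k B (TensorProduct.map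
      (Algebra.linearMap k B ∘ₗ ψ) LinearMap.id t) = 0) : t = 0 := by
  classical
  let b := Module.Basis.ofVectorSpace k B
  refine (TensorProduct.equivFinsuppOfBasisLeft (N := B) b).injective ?_
  rw [map_zero]
  ext i
  rw [Finsupp.zero_apply, ← h (b.coord i)]
  clear h
  induction t with
  | zero => simp
  | add x y hx hy => simp only [map_add, Finsupp.add_apply, hx, hy]
  | tmul x y => simp [Algebra.smul_def]

theorem LeftInvariant.lam_comp {T : B →ₗ[k] B} (hT : LeftInvariant T) (ψ : B →ₗ[k] k) (b : B) :
    lam ψ (T b) = T (lam ψ b) := by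
  have key : ∀ t : B ⊗[k] B, LinearMap.mul' k B (TensorProduct.map
      (Algebra.linearMap k B ∘ₗ ψ) LinearMap.id (T.lTensor B t)) =
      T (LinearMap.mul' k B (TensorProduct.map (Algebra.linearMap k B ∘ₗ ψ) LinearMap.id t)) := by
    intro t
    induction t with
    | zero => simp
    | add x y hx hy => simp only [map_add, hx, hy]
    | tmul x y => simp [← Algebra.smul_def]
  rw [← show _ = T (lam ψ b) from key (comul b), ← hT b]
  rfl

/-- The functionals on the first factor separate the elements of the tensor square. Left invariance
thus becomes a commutation with every `lam ψ`, which is easy to check for operators defined by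
eigenspaces or by descent. -/
theorem leftInvariant_of_forall_lam {T : B →ₗ[k] B}
    (h : ∀ (ψ : B →ₗ[k] k) (b : B), lam ψ (T b) = T (lam ψ b)) : LeftInvariant T := by
  intro b
  rw [← sub_eq_zero]
  refine tensor_eq_zero_of_forall_functional fun ψ => ?_
  have key : ∀ t : B ⊗[k] B, LinearMap.mul' k B (TensorProduct.map
      (Algebra.linearMap k B ∘ₗ ψ) LinearMap.id (T.lTensor B t)) =
      T (LinearMap.mul' k B (TensorProduct.map (Algebra.linearMap k B ∘ₗ ψ) LinearMap.id t)) := by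
    intro t
    induction t with
    | zero => simp
    | add x y hx hy => simp only [map_add, hx, hy]
    | tmul x y => simp [← Algebra.smul_def]
  rw [map_sub, map_sub, key, sub_eq_zero]
  exact h ψ b

theorem leftInvariant_rho (ψ : B →ₗ[k] k) : LeftInvariant (rho ψ) := by
  refine leftInvariant_of_forall_lam fun φ b => eq_of_forall_functional (k := k) fun χ => ?_
  have h1 : χ (lam φ (rho ψ b)) = (toConv φ * toConv χ).ofConv (rho ψ b) := functional_lam _ _ _
  have h2 : χ (rho ψ (lam φ b)) = (toConv χ * toConv ψ).ofConv (lam φ b) := functional_rho _ _ _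
  rw [h1, h2, functional_rho, functional_lam, toConv_ofConv, toConv_ofConv, mul_assoc]

theorem rho_rho (ψ φ : B →ₗ[k] k) (b : B) :
    rho ψ (rho φ b) = rho (toConv ψ * toConv φ).ofConv b := by
  have h := (leftInvariant_rho φ).convMul_comp (convId k B) (extend B ψ)
  have h2 : toConv ((extend B ψ).ofConv ∘ₗ rho φ) = extend B (toConv ψ * toConv φ).ofConv := by
    ext b
    simp [functional_rho]
  rw [h2] at h
  exact DFunLike.congr_fun (congrArg ofConv h) b

theorem counit_rho (ψ : B →ₗ[k] k) (b : B) : counit (R := k) (rho ψ b) = ψ b := by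
  have : toConv (counit : B →ₗ[k] k) = 1 := rfl
  rw [functional_rho, this, one_mul]

theorem lie_ext {X Y : lieAlgebra k B} (h : ∀ b, counit (R := k) (X.1 b) = counit (R := k) (Y.1 b)) :
    X = Y := by
  ext b
  rw [lie_eq_rho, lie_eq_rho]
  congr 2
  exact LinearMap.ext h

/-- Point derivations of `k[G]` at the identity element. -/
def IsPointDerivation (δ : B →ₗ[k] R) : Prop :=
  ∀ a b : B, δ (a * b) = counit (R := k) a • δ b + counit (R := k) b • δ a

theorem IsPointDerivation.comp {R' : Type*} [CommRing R'] [Algebra k R'] {δ : B →ₗ[k] R}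
    (hδ : IsPointDerivation δ) (f : R →ₗ[k] R') : IsPointDerivation (f ∘ₗ δ) := by
  intro a b
  simp [hδ a b]

/-- The left invariant derivation attached to a point derivation at the identity. -/
def lieOfFunctional (δ : B →ₗ[k] k) (hδ : IsPointDerivation δ) : lieAlgebra k B where
  val := Derivation.mk' (rho δ) (fun a b => by
    have key : ∀ s t : B ⊗[k] B,
        LinearMap.mul' k B (TensorProduct.map LinearMap.id (extend B δ).ofConv (s * t)) =
        LinearMap.mul' k B (TensorProduct.map LinearMap.id (extend B counit).ofConv s) *
          LinearMap.mul' k B (TensorProduct.map LinearMap.id (extend B δ).ofConv t) +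
        LinearMap.mul' k B (TensorProduct.map LinearMap.id (extend B counit).ofConv t) *
          LinearMap.mul' k B (TensorProduct.map LinearMap.id (extend B δ).ofConv s) := by
      intro s t
      induction s with
      | zero => simp
      | add x y hx hy => simp only [add_mul, map_add, mul_add, hx, hy]; ring
      | tmul x y =>
        induction t with
        | zero => simp
        | add x y hx hy => simp only [add_mul, map_add, mul_add, hx, hy]; ring
        | tmul z w => simp [hδ y w]; ring
    have h := key (comul a) (comul b)
    rw [← Bialgebra.comul_mul] at h
    refine h.trans ?_
    have hc : ∀ c : B, LinearMap.mul' k B (TensorProduct.map LinearMap.id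
        (extend B (counit : B →ₗ[k] k)).ofConv (comul c)) = c := rho_counit
    rw [hc, hc]
    rfl)
  property := leftInvariant_rho δ

theorem counit_lieOfFunctional (δ : B →ₗ[k] k) (hδ : IsPointDerivation δ) (b : B) :
    counit (R := k) ((lieOfFunctional δ hδ).1 b) = δ b := counit_rho δ b

/-- A derivation along an algebra homomorphism `u` is the convolution of `u` with a point
derivation. -/
theorem exists_isPointDerivation (u : B →ₐ[k] R) (D : Derivation k R R) :
    ∃ δ : B →ₗ[k] R, IsPointDerivation δ ∧
      toConv ((D : R →ₗ[k] R) ∘ₗ u.toLinearMap) = toConv u.toLinearMap * toConv δ ∧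
      toConv δ = toConv (u.toLinearMap ∘ₗ HopfAlgebra.antipode k) *
        toConv ((D : R →ₗ[k] R) ∘ₗ u.toLinearMap) := by
  -- `v` is the convolution inverse of `u`, so the product `v * d` is the logarithmic derivative of
  -- the point `u` along `D`.
  let v : WithConv (B →ₗ[k] R) := toConv (u.toLinearMap ∘ₗ HopfAlgebra.antipode k)
  let d : WithConv (B →ₗ[k] R) := toConv ((D : R →ₗ[k] R) ∘ₗ u.toLinearMap)
  have hone : toConv (u.toLinearMap ∘ₗ (1 : WithConv (B →ₗ[k] B)).ofConv) = 1 := by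
    ext b
    simp
  have h1 : v * toConv u.toLinearMap = 1 := by
    rw [← hone, ← convAntipode_mul_convId, algHom_comp_mul]
    rfl
  have h2 : toConv u.toLinearMap * v = 1 := by
    rw [← hone, ← convId_mul_convAntipode, algHom_comp_mul]
    rfl
  refine ⟨(v * d).ofConv, fun a b => ?_, ?_, rfl⟩
  · have key : ∀ s t : B ⊗[k] B,
        LinearMap.mul' k R (TensorProduct.map v.ofConv d.ofConv (s * t)) =
        LinearMap.mul' k R (TensorProduct.map v.ofConv u.toLinearMap s) *
          LinearMap.mul' k R (TensorProduct.map v.ofConv d.ofConv t) +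
        LinearMap.mul' k R (TensorProduct.map v.ofConv u.toLinearMap t) *
          LinearMap.mul' k R (TensorProduct.map v.ofConv d.ofConv s) := by
      intro s t
      induction s with
      | zero => simp
      | add x y hx hy => simp only [add_mul, map_add, mul_add, hx, hy]; ring
      | tmul x y =>
        induction t with
        | zero => simp
        | add x y hx hy => simp only [add_mul, map_add, mul_add, hx, hy]; ring
        | tmul z w => simp [v, d, HopfAlgebra.antipode_mul_distrib]; ring
    have h := key (comul a) (comul b)
    rw [← Bialgebra.comul_mul] at h
    refine h.trans ?_
    have hc : ∀ c : B, LinearMap.mul' k R (TensorProduct.map v.ofConv u.toLinearMap (comul c)) =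
        algebraMap k R (counit c) := fun c => DFunLike.congr_fun (congrArg ofConv h1) c
    rw [hc, hc, ← Algebra.smul_def, ← Algebra.smul_def]
    rfl
  · rw [toConv_ofConv, ← mul_assoc, h2, one_mul]

/-- Point derivations of an algebra of finite type take values in a finite dimensional space. -/
theorem IsPointDerivation.exists_decomposition [Algebra.FiniteType k B] {δ : B →ₗ[k] R}
    (hδ : IsPointDerivation δ) : ∃ (n : ℕ) (c : Fin n → R) (l : Fin n → R →ₗ[k] k),
      ∀ b, δ b = ∑ j, l j (δ b) • c j := by
  obtain ⟨s, hs⟩ := Algebra.FiniteType.out (R := k) (A := B)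
  let W : Submodule k R := Submodule.span k (δ '' s)
  have hW : FiniteDimensional k W := FiniteDimensional.span_of_finite k (s.finite_toSet.image δ)
  have hδ1 : δ 1 = 0 := by
    have := hδ 1 1
    simpa using this
  -- The Leibniz rule at the identity has coefficients in `k`, so the values on algebra generators
  -- already span all values.
  have hmem : ∀ b, δ b ∈ W := by
    intro b
    have hb : b ∈ Algebra.adjoin k (s : Set B) := by rw [hs]; trivial
    induction hb using Algebra.adjoin_induction with
    | mem a ha => exact Submodule.subset_span ⟨a, ha, rfl⟩
    | algebraMap r =>
      rw [Algebra.algebraMap_eq_smul_one, map_smul, hδ1, smul_zero]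
      exact W.zero_mem
    | add a b _ _ ha hb => rw [map_add]; exact W.add_mem ha hb
    | mul a b _ _ ha hb => rw [hδ]; exact W.add_mem (W.smul_mem _ hb) (W.smul_mem _ ha)
  let c := Module.finBasis k W
  choose l hl using fun j => LinearMap.exists_extend (c.coord j)
  refine ⟨_, fun j => (c j : R), l, fun b => ?_⟩
  have h := congrArg (Subtype.val) (c.sum_repr ⟨δ b, hmem b⟩)
  rw [Submodule.coe_sum] at h
  refine h.symm.trans (Finset.sum_congr rfl fun j _ => ?_)
  have := DFunLike.congr_fun (hl j) ⟨δ b, hmem b⟩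
  simp only [LinearMap.comp_apply, Submodule.subtype_apply, Module.Basis.coord_apply] at this
  rw [this]
  rfl

/-- Every finite set of regular functions lies in a finite dimensional subcomodule. -/
theorem exists_subcomodule (s : Finset B) : ∃ V : Submodule k B, FiniteDimensional k V ∧
    (s : Set B) ⊆ V ∧ ∀ (ψ : B →ₗ[k] k), ∀ v ∈ V, rho ψ v ∈ V := by
  classical
  induction s using Finset.induction_on with
  | empty => exact ⟨⊥, inferInstance, by simp, by simp⟩
  | insert b s _ ih =>
    obtain ⟨V, hV, hsV, hst⟩ := ih
    let W : Submodule k B := LinearMap.range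
      ({ toFun := fun ψ => rho ψ b
         map_add' := fun ψ φ => by rw [rho_add]; rfl
         map_smul' := fun c ψ => by rw [rho_smul]; rfl } : (B →ₗ[k] k) →ₗ[k] B)
    have hWst : ∀ (ψ : B →ₗ[k] k), ∀ v ∈ W, rho ψ v ∈ W := by
      rintro ψ _ ⟨φ, rfl⟩
      exact ⟨_, (rho_rho ψ φ b).symm⟩
    have hW : FiniteDimensional k W := by
      let r := ℛ k b
      -- All translates of `b` lie in the span of the left factors of one fixed expression for its
      -- comultiplication.
      have hle : W ≤ Submodule.span k (r.left '' r.index) := by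
        rintro _ ⟨ψ, rfl⟩
        change (convId k B * extend B ψ) b ∈ _
        rw [r.convMul_apply]
        refine Submodule.sum_mem _ fun i hi => ?_
        rw [extend_apply, mul_comm, ← Algebra.smul_def]
        exact Submodule.smul_mem _ _ (Submodule.subset_span ⟨i, hi, rfl⟩)
      have : FiniteDimensional k (Submodule.span k (r.left '' r.index)) :=
        FiniteDimensional.span_of_finite k (r.index.finite_toSet.image _)
      exact Submodule.finiteDimensional_of_le hle
    refine ⟨V ⊔ W, inferInstance, ?_, ?_⟩
    · rw [Finset.coe_insert, Set.insert_subset_iff]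
      exact ⟨Submodule.mem_sup_right ⟨counit, rho_counit b⟩,
        hsV.trans (SetLike.coe_subset_coe.mpr le_sup_left)⟩
    · intro ψ v hv
      obtain ⟨x, hx, y, hy, rfl⟩ := Submodule.mem_sup.mp hv
      rw [map_add]
      exact Submodule.add_mem_sup (hst ψ x hx) (hWst ψ y hy)

end Convolution

end

end AlgebraicGroup

namespace AlgebraicGroup

noncomputable section

/-! ### Adjoint orbits at a generic point -/

section Orbit

open WithConv Coalgebra

/-- Hilbert's Nullstellensatz for algebras of finite type. -/
theorem exists_algHom_of_notMem_radical {k B : Type*} [Field k] [IsAlgClosed k] [CommRing B]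
    [Algebra k B] [Algebra.FiniteType k B] {I : Ideal B} {b : B} (hb : b ∉ I.radical) :
    ∃ φ : B →ₐ[k] k, (∀ a ∈ I, φ a = 0) ∧ φ b ≠ 0 := by
  have : IsJacobsonRing B := isJacobsonRing_of_finiteType (A := k)
  have h : I.radical.jacobson = I.radical := IsJacobsonRing.out inferInstance I.radical_isRadical
  rw [← h, Ideal.jacobson, Ideal.mem_sInf] at hb
  push Not at hb
  obtain ⟨M, ⟨hIM, hM⟩, hbM⟩ := hb
  let _ : Field (B ⧸ M) := Ideal.Quotient.field M
  have : Module.Finite k (B ⧸ M) := finite_of_finite_type_of_isJacobsonRing k (B ⧸ M)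
  let e : k ≃ₐ[k] B ⧸ M := AlgEquiv.ofBijective (Algebra.ofId k (B ⧸ M))
    IsAlgClosed.algebraMap_bijective_of_isIntegral
  refine ⟨e.symm.toAlgHom.comp (Ideal.Quotient.mkₐ k M), fun a ha => ?_, fun h0 => hbM ?_⟩
  · have : Ideal.Quotient.mkₐ k M a = 0 :=
      Ideal.Quotient.eq_zero_iff_mem.mpr (hIM (Ideal.le_radical ha))
    rw [AlgHom.comp_apply, this, map_zero]
  · exact Ideal.Quotient.eq_zero_iff_mem.mp ((map_eq_zero_iff _ e.symm.injective).mp h0)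

variable {k B : Type*} [Field k] [CommRing B] [HopfAlgebra k B]

theorem lie_eq_of_adjoin_eq_top {s : Set B} (hs : Algebra.adjoin k s = ⊤) {X Y : lieAlgebra k B}
    (h : ∀ a ∈ s, counit (R := k) (X.1 a) = counit (R := k) (Y.1 a)) : X = Y := by
  refine lie_ext fun b => ?_
  have hb : b ∈ Algebra.adjoin k s := by rw [hs]; trivial
  induction hb using Algebra.adjoin_induction with
  | mem a ha => exact h a ha
  | algebraMap r => simp
  | add a b _ _ ha hb => simp only [map_add, ha, hb]
  | mul a b _ _ ha hb => simp [ha, hb]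

theorem finiteDimensional_lieAlgebra [Algebra.FiniteType k B] :
    FiniteDimensional k (lieAlgebra k B) := by
  obtain ⟨s, hs⟩ := Algebra.FiniteType.out (R := k) (A := B)
  let f : lieAlgebra k B →ₗ[k] (s → k) :=
    { toFun := fun X a => counit (R := k) (X.1 (a : B))
      map_add' := fun X Y => by ext a; simp
      map_smul' := fun c X => by ext a; simp }
  exact FiniteDimensional.of_injective f fun X Y h =>
    lie_eq_of_adjoin_eq_top hs fun a ha => congrFun h ⟨a, ha⟩

/-- Functionals on the Lie algebra are given by evaluating at the identity on some regular
function. -/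
theorem exists_eq_counit_apply [Algebra.FiniteType k B] (φ : Module.Dual k (lieAlgebra k B)) :
    ∃ b : B, ∀ Z : lieAlgebra k B, φ Z = counit (R := k) (Z.1 b) := by
  have := finiteDimensional_lieAlgebra (k := k) (B := B)
  let f : B →ₗ[k] Module.Dual k (lieAlgebra k B) := LinearMap.mk₂ k
    (fun b Z => counit (R := k) (Z.1 b)) (by simp) (by simp) (by simp) (by simp)
  -- A left invariant derivation is determined by its values at the identity, so the pairing is
  -- nondegenerate on the Lie algebra side; finite dimension there gives surjectivity.
  have hf : Function.Surjective f := by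
    rw [← LinearMap.flip_injective_iff₂]
    exact fun X Y h => lie_ext fun b => DFunLike.congr_fun h b
  obtain ⟨b, hb⟩ := hf φ
  exact ⟨b, fun Z => by rw [← hb]; rfl⟩

/-- The functional on `k[G]` attached to an element of the Lie algebra. -/
def functional (X : lieAlgebra k B) : B →ₗ[k] k := counit ∘ₗ (X.1 : B →ₗ[k] B)

theorem functional_apply (X : lieAlgebra k B) (b : B) :
    functional X b = counit (R := k) (X.1 b) := rfl

theorem toConv_lie (X : lieAlgebra k B) :
    toConv (X.1 : B →ₗ[k] B) = convId k B * extend B (functional X) :=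
  (leftInvariant_lie X).eq_convId_mul

theorem functional_lie (X Y : lieAlgebra k B) :
    toConv (functional ⁅X, Y⁆) = toConv (functional X) * toConv (functional Y) -
      toConv (functional Y) * toConv (functional X) := by
  have h : ∀ X Y : lieAlgebra k B, ∀ b, counit (R := k) (X.1 (Y.1 b)) =
      (toConv (functional X) * toConv (functional Y)) b := fun X Y b => by
    rw [lie_eq_rho Y]
    exact functional_rho (functional Y) (functional X) b
  ext b
  change counit (R := k) (X.1 (Y.1 b) - Y.1 (X.1 b)) = _
  rw [map_sub, h, h]
  rfl

/-- The regular functions `g ↦ (Ad(g) X)(b)(1)`. -/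
def adFunction (X : lieAlgebra k B) : WithConv (B →ₗ[k] B) :=
  convId k B * extend B (functional X) * convAntipode k B

/-- Evaluation at `g` is an algebra map that sends `convId` and `convAntipode` to `g` and `g⁻¹`, so
both sides are the convolution product g * X * g⁻¹. -/
theorem apply_adFunction (X : lieAlgebra k B) (g : Points k B) (b : B) :
    g.ofConv (adFunction X b) = counit (R := k) ((Ad g X).1 b) := by
  have h1 : counit (R := k) ((Ad g X).1 b) = g.ofConv (X.1 (rightTranslation g⁻¹ b)) := by
    change counit (R := k) (rightTranslation g (X.1 (rightTranslation g⁻¹ b))) = _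
    rw [rightTranslation_eq_rho, counit_rho]
    rfl
  have h2 : toConv ((X.1 : B →ₗ[k] B) ∘ₗ (rightTranslation g⁻¹).toLinearMap) =
      convId k B * (extend B (functional X) * extend B (g⁻¹).ofConv.toLinearMap) := by
    have h := (leftInvariant_rightTranslation g⁻¹).convMul_comp (convId k B)
      (extend B (functional X))
    rw [← toConv_lie, ofConv_toConv] at h
    rw [h]
    congr 1
    refine Eq.trans ?_ (extend_mul (toConv (functional X)) (toConv (g⁻¹).ofConv.toLinearMap))
    ext c
    change algebraMap k B (functional X (rightTranslation g⁻¹ c)) = _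
    rw [rightTranslation_eq_rho, functional_rho]
    rfl
  have h3 : X.1 (rightTranslation g⁻¹ b) =
      (convId k B * (extend B (functional X) * extend B (g⁻¹).ofConv.toLinearMap)) b :=
    DFunLike.congr_fun (congrArg ofConv h2) b
  rw [h1, h3]
  have h4 := algHom_comp_mul g.ofConv (convId k B * extend B (functional X)) (convAntipode k B)
  have h5 := algHom_comp_mul g.ofConv (convId k B)
    (extend B (functional X) * extend B (g⁻¹).ofConv.toLinearMap)
  rw [algHom_comp_mul g.ofConv (convId k B), algHom_comp_extend] at h4
  rw [algHom_comp_mul g.ofConv (extend B (functional X)), algHom_comp_extend,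
    algHom_comp_extend] at h5
  refine (DFunLike.congr_fun (congrArg ofConv h4) b).trans ?_
  rw [mul_assoc]
  exact (DFunLike.congr_fun (congrArg ofConv h5) b).symm

theorem differential_apply (θ : B ≃ₐc[k] B) (X : lieAlgebra k B) (b : B) :
    (differential θ X).1 b = θ.symm (X.1 (θ b)) := rfl

theorem mem_eigenPlus_iff {θ : B ≃ₐc[k] B} {X : lieAlgebra k B} :
    X ∈ eigenPlus θ ↔ ∀ b, X.1 (θ b) = θ (X.1 b) := by
  rw [eigenPlus, Module.End.mem_eigenspace_iff, one_smul, Subtype.ext_iff, Derivation.ext_iff]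
  refine forall_congr' fun b => ?_
  rw [differential_apply, ← (EquivLike.injective θ).eq_iff, BialgEquiv.apply_symm_apply]

theorem mem_eigenMinus_iff {θ : B ≃ₐc[k] B} {X : lieAlgebra k B} :
    X ∈ eigenMinus θ ↔ ∀ b, X.1 (θ b) = -θ (X.1 b) := by
  rw [eigenMinus, Module.End.mem_eigenspace_iff, neg_smul, one_smul, Subtype.ext_iff,
    Derivation.ext_iff]
  refine forall_congr' fun b => ?_
  rw [differential_apply, ← (EquivLike.injective θ).eq_iff, BialgEquiv.apply_symm_apply, ← map_neg]
  rfl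

theorem counit_bialgEquiv (θ : B ≃ₐc[k] B) (b : B) :
    counit (R := k) (θ b) = counit (R := k) b := by simp

theorem lieOfFunctional_mem_eigenPlus {θ : B ≃ₐc[k] B} {δ : B →ₗ[k] k} (hδ : IsPointDerivation δ)
    (h : ∀ b, δ (θ b) = δ b) : lieOfFunctional δ hδ ∈ eigenPlus θ := by
  rw [eigenPlus, Module.End.mem_eigenspace_iff, one_smul]
  refine lie_ext fun b => ?_
  rw [differential_apply, counit_bialgEquiv, counit_lieOfFunctional, counit_lieOfFunctional, h]

/-- The ideal of the scheme of fixed points of `θ`. -/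
def fixedIdeal (θ : B ≃ₐc[k] B) : Ideal B := Ideal.span (Set.range fun b => θ b - b)

/-- `Z` commutes with `θ`, hence carries the generator attached to b to the one attached to Z(b). As
a vector field, `Z` is tangent to the fixed-point scheme. -/
theorem lie_mem_fixedIdeal {θ : B ≃ₐc[k] B} {Z : lieAlgebra k B} (hZ : Z ∈ eigenPlus θ) {a : B}
    (ha : a ∈ fixedIdeal θ) : Z.1 a ∈ fixedIdeal θ := by
  rw [mem_eigenPlus_iff] at hZ
  induction ha using Submodule.span_induction with
  | mem a ha =>
    obtain ⟨b, rfl⟩ := ha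
    refine Ideal.subset_span ⟨Z.1 b, ?_⟩
    simp only [map_sub, hZ]
  | zero => rw [map_zero]; exact Ideal.zero_mem _
  | add a b _ _ ha hb => rw [map_add]; exact Ideal.add_mem _ ha hb
  | smul c a ha ih =>
    rw [smul_eq_mul, Derivation.leibniz]
    exact Ideal.add_mem _ (Ideal.mul_mem_left _ _ ih) (Ideal.mul_mem_right _ _ ha)

theorem mem_radical_fixedIdeal_iff [IsAlgClosed k] [Algebra.FiniteType k B] {θ : B ≃ₐc[k] B}
    {b : B} : b ∈ (fixedIdeal θ).radical ↔ ∀ g ∈ fixedPoints θ, g.ofConv b = 0 := by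
  constructor
  · intro hb g hg
    have hle : fixedIdeal θ ≤ RingHom.ker g.ofConv := by
      refine Ideal.span_le.mpr ?_
      rintro _ ⟨a, rfl⟩
      change g.ofConv (θ a - a) = 0
      rw [map_sub, hg a, sub_self]
    have hp : (RingHom.ker g.ofConv).IsPrime := RingHom.ker_isPrime _
    exact (hp.radical_le_iff.mpr hle) hb
  · intro h
    by_contra hb
    obtain ⟨φ, hφ, hφb⟩ := exists_algHom_of_notMem_radical (k := k) hb
    refine hφb (h (toConv φ) fun a => ?_)
    have := hφ (θ a - a) (Ideal.subset_span ⟨a, rfl⟩)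
    rwa [map_sub, sub_eq_zero] at this

section GenericPoint

variable {L : Type*} [Field L] [Algebra k L]

theorem algHom_mul_antipode (u : B →ₐ[k] L) :
    toConv u.toLinearMap * toConv (u.toLinearMap ∘ₗ HopfAlgebra.antipode k) = 1 := by
  have hone : toConv (u.toLinearMap ∘ₗ (1 : WithConv (B →ₗ[k] B)).ofConv) = 1 := by
    ext b
    simp
  rw [← hone, ← convId_mul_convAntipode, algHom_comp_mul]
  rfl

theorem antipode_mul_algHom (u : B →ₐ[k] L) :
    toConv (u.toLinearMap ∘ₗ HopfAlgebra.antipode k) * toConv u.toLinearMap = 1 := by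
  have hone : toConv (u.toLinearMap ∘ₗ (1 : WithConv (B →ₗ[k] B)).ofConv) = 1 := by
    ext b
    simp
  rw [← hone, ← convAntipode_mul_convId, algHom_comp_mul]
  rfl

theorem algHom_comp_adFunction (X : lieAlgebra k B) (u : B →ₐ[k] L) :
    toConv (u.toLinearMap ∘ₗ (adFunction X).ofConv) = toConv u.toLinearMap *
      extend L (functional X) * toConv (u.toLinearMap ∘ₗ HopfAlgebra.antipode k) := by
  rw [adFunction, algHom_comp_mul, algHom_comp_mul, algHom_comp_extend]
  rfl

/-- The derivative of the functions `adFunction X` at a generic point. -/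
theorem derivation_comp_adFunction (X : lieAlgebra k B) (u : B →ₐ[k] L) (D : Derivation k L L)
    (δ : WithConv (B →ₗ[k] L))
    (hδ : toConv ((D : L →ₗ[k] L) ∘ₗ u.toLinearMap) = toConv u.toLinearMap * δ) :
    toConv ((D : L →ₗ[k] L) ∘ₗ u.toLinearMap ∘ₗ (adFunction X).ofConv) =
      toConv u.toLinearMap * (δ * extend L (functional X) - extend L (functional X) * δ) *
        toConv (u.toLinearMap ∘ₗ HopfAlgebra.antipode k) := by
  have h1 := algHom_comp_adFunction X u
  have huv := algHom_mul_antipode u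
  have hvu := antipode_mul_algHom u
  set v : WithConv (B →ₗ[k] L) := toConv (u.toLinearMap ∘ₗ HopfAlgebra.antipode k)
  set w : WithConv (B →ₗ[k] L) := toConv u.toLinearMap with hw
  set f : WithConv (B →ₗ[k] L) := extend L (functional X) with hf
  have hDw : toConv ((D : L →ₗ[k] L) ∘ₗ w.ofConv) = w * δ := hδ
  -- Differentiate `w * v = 1` and multiply by `v` on the left.
  have hDv : toConv ((D : L →ₗ[k] L) ∘ₗ v.ofConv) = -(δ * v) := by
    have h2 := derivation_comp_convMul D w v
    have h3 : toConv ((D : L →ₗ[k] L) ∘ₗ (1 : WithConv (B →ₗ[k] L)).ofConv) = 0 :=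
      derivation_comp_extend D counit
    rw [huv, h3, hDw] at h2
    have h4 := congrArg (v * ·) h2
    simp only [mul_zero, mul_add, ← mul_assoc, hvu, one_mul] at h4
    exact eq_neg_of_add_eq_zero_right h4.symm
  have h5 : toConv ((D : L →ₗ[k] L) ∘ₗ u.toLinearMap ∘ₗ (adFunction X).ofConv) =
      toConv ((D : L →ₗ[k] L) ∘ₗ (w * f * v).ofConv) := by
    rw [← h1]
  rw [h5, derivation_comp_convMul, derivation_comp_convMul, hDw, hDv, derivation_comp_extend]
  noncomm_ring

/-- Functionals on `k[G]` that are linearly independent over `k` stay so over `L`. -/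
theorem linearIndependent_extend {ι : Type*} {f : ι → B →ₗ[k] k} (hf : LinearIndependent k f) :
    LinearIndependent L fun i => extend L (f i) := by
  rw [linearIndependent_iff'] at hf ⊢
  intro s c hc i hi
  -- Applying a `k`-linear form on `L` to the relation gives a relation over `k`, where independence
  -- is known.
  refine (Module.forall_dual_apply_eq_zero_iff k _).mp fun φ => ?_
  refine hf s (fun i => φ (c i)) ?_ i hi
  ext b
  have h : ∑ i ∈ s, c i * algebraMap k L (f i b) = 0 := by
    have := DFunLike.congr_fun (congrArg ofConv hc) b
    simpa [LinearMap.sum_apply] using this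
  have h2 := congrArg φ h
  simp only [map_sum, map_zero] at h2
  simp only [LinearMap.sum_apply, LinearMap.smul_apply, LinearMap.zero_apply]
  refine Eq.trans (Finset.sum_congr rfl fun i _ => ?_) h2
  rw [mul_comm, ← Algebra.smul_def, map_smul, smul_eq_mul, smul_eq_mul, mul_comm]

theorem extend_smul (r : k) (φ : B →ₗ[k] k) : extend L (r • φ) = r • extend L φ := by
  ext b
  change algebraMap k L (r • φ b) = r • algebraMap k L (φ b)
  rw [smul_eq_mul, map_mul, Algebra.smul_def]

theorem extend_functional_lie (X Y : lieAlgebra k B) : extend L (functional ⁅X, Y⁆) =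
    extend L (functional X) * extend L (functional Y) -
      extend L (functional Y) * extend L (functional X) := by
  have h1 := extend_mul (R := L) (toConv (functional X)) (toConv (functional Y))
  have h2 := extend_mul (R := L) (toConv (functional Y)) (toConv (functional X))
  simp only at h1 h2
  rw [← h1, ← h2]
  have h3 : functional ⁅X, Y⁆ = (toConv (functional X) * toConv (functional Y)).ofConv -
      (toConv (functional Y) * toConv (functional X)).ofConv :=
    congrArg ofConv (functional_lie X Y)
  rw [h3]
  ext b
  exact map_sub (algebraMap k L) _ _

/-- The dimension of an orbit, computed at a generic point of the group of fixed points. -/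
theorem finrank_derivation_adFunction [Algebra.FiniteType k B] {θ : B ≃ₐc[k] B}
    (X : lieAlgebra k B) (u : B →ₐ[k] L) (hu : ∀ b, u (θ b) = u b)
    (hD : ∀ Z ∈ eigenPlus θ, ∃ D : Derivation k L L, ∀ b, D (u b) = u (Z.1 b))
    (M : Submodule L (B → L)) (hM : ∀ m, m ∈ M ↔ ∃ D : Derivation k L L,
      ∀ b, D (u (adFunction X b)) = m b) :
    Module.finrank L M = Module.finrank k ((eigenPlus θ).map (LieAlgebra.ad k (lieAlgebra k B) X :
      lieAlgebra k B →ₗ[k] lieAlgebra k B)) := by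
  have := finiteDimensional_lieAlgebra (k := k) (B := B)
  set N := (eigenPlus θ).map (LieAlgebra.ad k (lieAlgebra k B) X :
      lieAlgebra k B →ₗ[k] lieAlgebra k B) with hN
  let w : WithConv (B →ₗ[k] L) := toConv u.toLinearMap
  let v : WithConv (B →ₗ[k] L) := toConv (u.toLinearMap ∘ₗ HopfAlgebra.antipode k)
  have huv : w * v = 1 := algHom_mul_antipode u
  have hvu : v * w = 1 := antipode_mul_algHom u
  -- Conjugation by the generic point `u`. It is `L`-linear and injective, and it will identify `M`
  -- with the scalar extension to `L` of `N`, the bracket of `X` with g(1).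
  let conj : WithConv (B →ₗ[k] L) →ₗ[L] WithConv (B →ₗ[k] L) :=
    LinearMap.mulLeft L w ∘ₗ LinearMap.mulRight L v
  have hconj : Function.Injective conj := by
    intro x y h
    have h' : w * (x * v) = w * (y * v) := h
    have h2 : ∀ z, v * (w * (z * v)) * w = z := fun z => by
      rw [← mul_assoc v w, hvu, one_mul, mul_assoc, hvu, mul_one]
    rw [← h2 x, h', h2]
  let toFun : WithConv (B →ₗ[k] L) →ₗ[L] (B → L) :=
    { toFun := fun x b => x b, map_add' := fun _ _ => rfl, map_smul' := fun _ _ => rfl }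
  have htoFun : Function.Injective toFun := fun x y h =>
    ofConv_injective (LinearMap.ext fun b => congrFun h b)
  let fn : lieAlgebra k B →ₗ[k] (B →ₗ[k] k) :=
    { toFun := functional
      map_add' := fun X Y => by ext b; simp [functional_apply]
      map_smul' := fun c X => by ext b; simp [functional_apply] }
  have hfn : Function.Injective fn := fun X Y h => lie_ext fun b => DFunLike.congr_fun h b
  let ext : (B →ₗ[k] k) →ₗ[k] WithConv (B →ₗ[k] L) :=
    { toFun := extend L
      map_add' := fun φ ψ => by ext b; simp
      map_smul' := fun r φ => extend_smul r φ }
  have : IsScalarTower k L (WithConv (B →ₗ[k] L)) :=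
    ⟨fun a b x => by ext c; exact smul_assoc a b (x c)⟩
  let T : lieAlgebra k B →ₗ[k] (B → L) :=
    toFun.restrictScalars k ∘ₗ conj.restrictScalars k ∘ₗ ext ∘ₗ fn
  have hT : ∀ Z b, T Z b = (w * extend L (functional Z) * v) b := fun Z b => by
    rw [mul_assoc]; rfl
  let c := Module.finBasis k N
  have hli : LinearIndependent L fun i => T (c i : lieAlgebra k B) := by
    have h1 : LinearIndependent k fun i => fn (c i : lieAlgebra k B) :=
      (c.linearIndependent.map' N.subtype N.ker_subtype).map' fn (LinearMap.ker_eq_bot.mpr hfn)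
    have h2 := linearIndependent_extend (L := L) h1
    exact (h2.map' conj (LinearMap.ker_eq_bot.mpr hconj)).map' toFun
      (LinearMap.ker_eq_bot.mpr htoFun)
  have hTspan : ∀ Z ∈ N, T Z ∈ Submodule.span L (Set.range fun i => T (c i : lieAlgebra k B)) := by
    intro Z hZ
    have h : Z = ∑ i, c.repr ⟨Z, hZ⟩ i • (c i : lieAlgebra k B) := by
      have := congrArg Subtype.val (c.sum_repr ⟨Z, hZ⟩)
      rw [Submodule.coe_sum] at this
      exact this.symm
    rw [h, map_sum]
    refine Submodule.sum_mem _ fun i _ => ?_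
    rw [map_smul]
    exact Submodule.smul_of_tower_mem _ _ (Submodule.subset_span ⟨i, rfl⟩)
  -- Elements of g(1) act as derivations at the generic point; differentiating along them realises
  -- every bracket.
  have hTM : ∀ Z ∈ N, T Z ∈ M := by
    rintro _ ⟨Z, hZ, rfl⟩
    obtain ⟨D, hDZ⟩ := hD Z hZ
    change T ⁅X, Z⁆ ∈ M
    rw [← lie_skew, map_neg]
    refine M.neg_mem ((hM _).mpr ⟨D, fun b => ?_⟩)
    have h1 : toConv ((D : L →ₗ[k] L) ∘ₗ u.toLinearMap) = w * extend L (functional Z) := by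
      have h2 := algHom_comp_mul u (convId k B) (extend B (functional Z))
      rw [algHom_comp_extend, ← toConv_lie] at h2
      refine Eq.trans ?_ h2
      ext b
      exact hDZ b
    have h3 := derivation_comp_adFunction X u D _ h1
    rw [hT, extend_functional_lie]
    exact DFunLike.congr_fun (congrArg ofConv h3) b
  have hspan : Submodule.span L (Set.range fun i => T (c i : lieAlgebra k B)) = M := by
    refine le_antisymm (Submodule.span_le.mpr ?_) fun m hm => ?_
    · rintro _ ⟨i, rfl⟩
      exact hTM _ (c i).2
    · obtain ⟨D, hDm⟩ := (hM m).mp hm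
      obtain ⟨δ, hδ, hDδ, -⟩ := exists_isPointDerivation u D
      -- Since `u` is fixed by `θ`, so is its logarithmic derivative `δ`. Expanding `δ` along
      -- finitely many `k`-valued point derivations then writes it as an `L`-combination of elements
      -- of g(1).
      have hθ : ∀ b, δ (θ b) = δ b := by
        let θl : B →ₗc[k] B := (θ : B →ₗc[k] B)
        have h1 := LinearMap.convMul_comp_coalgHom_distrib w (toConv δ) θl
        rw [← hDδ] at h1
        have h2 : w.ofConv ∘ₗ θl.toLinearMap = w.ofConv := LinearMap.ext hu
        have h3 : ((D : L →ₗ[k] L) ∘ₗ u.toLinearMap) ∘ₗ θl.toLinearMap =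
            (D : L →ₗ[k] L) ∘ₗ u.toLinearMap := LinearMap.ext fun b => congrArg D (hu b)
        rw [ofConv_toConv, h3, h2, toConv_ofConv, ← toConv_injective.eq_iff, hDδ,
          toConv_ofConv] at h1
        have h4 : v * (w * toConv δ) = v * (w * toConv (δ ∘ₗ θl.toLinearMap)) :=
          congrArg (v * ·) h1
        rw [← mul_assoc, ← mul_assoc, hvu, one_mul, one_mul] at h4
        exact fun b => (DFunLike.congr_fun (congrArg ofConv h4) b).symm
      obtain ⟨n, r, l, hl⟩ := hδ.exists_decomposition
      let Z : Fin n → lieAlgebra k B := fun j => lieOfFunctional (l j ∘ₗ δ) (hδ.comp (l j))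
      have hZ : ∀ j, Z j ∈ eigenPlus θ := fun j =>
        lieOfFunctional_mem_eigenPlus _ fun b => congrArg (l j) (hθ b)
      have hfZ : ∀ j, functional (Z j) = l j ∘ₗ δ := fun j => LinearMap.ext fun b =>
        counit_lieOfFunctional _ _ b
      have hsum : toConv δ = ∑ j, r j • extend L (functional (Z j)) := by
        ext b
        rw [ofConv_sum, LinearMap.sum_apply]
        refine (hl b).trans (Finset.sum_congr rfl fun j _ => ?_)
        rw [hfZ, Algebra.smul_def, mul_comm]
        rfl
      have h3 := derivation_comp_adFunction X u D _ hDδ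
      have h4 : m = ∑ j, r j • T ⁅Z j, X⁆ := by
        funext b
        rw [← hDm b, Finset.sum_apply]
        refine (DFunLike.congr_fun (congrArg ofConv h3) b).trans ?_
        have h5 : toConv δ * extend L (functional X) - extend L (functional X) * toConv δ =
            ∑ j, r j • extend L (functional ⁅Z j, X⁆) := by
          rw [hsum, Finset.sum_mul, Finset.mul_sum, ← Finset.sum_sub_distrib]
          refine Finset.sum_congr rfl fun j _ => ?_
          rw [extend_functional_lie, smul_sub, smul_mul_assoc, mul_smul_comm]
        rw [h5, Finset.mul_sum, Finset.sum_mul, ofConv_sum, LinearMap.sum_apply]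
        refine Finset.sum_congr rfl fun j _ => ?_
        rw [mul_smul_comm, smul_mul_assoc, Pi.smul_apply, hT]
        rfl
      rw [h4]
      refine Submodule.sum_mem _ fun j _ => Submodule.smul_mem _ _ (hTspan _ ?_)
      rw [← lie_skew]
      exact N.neg_mem ⟨Z j, hZ j, rfl⟩
  rw [← hspan, finrank_span_eq_card hli, Fintype.card_fin]

end GenericPoint

end Orbit

end

end AlgebraicGroup

namespace AlgebraicGroup

noncomputable section

/-! ### The dimension of an orbit -/

section OrbitDimension

open WithConv Coalgebra

variable {k B : Type*} [Field k] [CommRing B] [HopfAlgebra k B]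

theorem adjoin_range_linearMap_fg {V A : Type*} [AddCommGroup V] [Module k V]
    [FiniteDimensional k V] [CommRing A] [Algebra k A] (f : V →ₗ[k] A) :
    (Algebra.adjoin k (Set.range f)).FG := by
  obtain ⟨t, ht⟩ := (inferInstance : FiniteDimensional k (LinearMap.range f)).fg_top
  obtain ⟨t, ht⟩ : (LinearMap.range f).FG := Submodule.fg_top _ |>.mp ⟨t, ht⟩
  refine ⟨t, ?_⟩
  rw [← Algebra.adjoin_span, ht, LinearMap.coe_range]

/-- Derivations preserving an ideal descend to the quotient. -/
theorem exists_derivation_quotient {A : Type*} [CommRing A] [Algebra k A] (D : Derivation k A A)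
    {I : Ideal A} (hI : ∀ a ∈ I, D a ∈ I) : ∃ D' : Derivation k (A ⧸ I) (A ⧸ I),
      ∀ a, D' (Ideal.Quotient.mkₐ k I a) = Ideal.Quotient.mkₐ k I (D a) := by
  have hd : ∀ x, Ideal.Quotient.mkₐ k I x = 0 → Ideal.Quotient.mkₐ k I (D x) = 0 := fun x hx =>
    Ideal.Quotient.eq_zero_iff_mem.mpr (hI x (Ideal.Quotient.eq_zero_iff_mem.mp hx))
  exact ⟨Derivation.liftOfSurjective (Ideal.Quotient.mkₐ_surjective k I) hd,
    fun a => Derivation.liftOfSurjective_apply (Ideal.Quotient.mkₐ_surjective k I) hd a⟩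

theorem ringKrullDim_map_of_injective {A A' : Type*} [CommRing A] [Algebra k A] [CommRing A']
    [Algebra k A'] (S : Subalgebra k A) {f : A →ₐ[k] A'} (hf : Function.Injective f) :
    ringKrullDim (S.map f) = ringKrullDim S :=
  (ringKrullDim_eq_of_ringEquiv (S.equivMapOfInjective f hf).toRingEquiv).symm

/-- The dimension of the orbit of `X` under the group of fixed points of `θ` is the dimension of
`[g(1), X]`. -/
theorem zariskiDim_orbit [IsAlgClosed k] [CharZero k] [Algebra.FiniteType k B]
    (θ : B ≃ₐc[k] B) (X : lieAlgebra k B) :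
    zariskiDim (k := k) (orbit θ X) =
      Module.finrank k ((eigenPlus θ).map (LieAlgebra.ad k (lieAlgebra k B) X :
        lieAlgebra k B →ₗ[k] lieAlgebra k B)) := by
  have := finiteDimensional_lieAlgebra (k := k) (B := B)
  set J := (fixedIdeal θ).radical with hJ
  let ev : B →ₐ[k] (fixedPoints θ → k) := AlgHom.pi fun g => g.1.ofConv
  have hev : ∀ b, ev b = 0 ↔ b ∈ J := fun b => by
    rw [hJ, mem_radical_fixedIdeal_iff, funext_iff]
    exact Subtype.forall
  let j : (B ⧸ J) →ₐ[k] (fixedPoints θ → k) := Ideal.Quotient.liftₐ J ev fun a ha => (hev a).mpr ha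
  have hj : Function.Injective j := by
    rw [injective_iff_map_eq_zero]
    intro q hq
    obtain ⟨b, rfl⟩ := Ideal.Quotient.mk_surjective q
    exact Ideal.Quotient.eq_zero_iff_mem.mpr ((hev b).mp hq)
  -- Pullback along the orbit map. It embeds the functions on the orbit in those on the fixed group,
  -- where the coordinate ring of the orbit closure becomes the subalgebra `S` generated by the
  -- `adFunction X b`.
  let π : (orbit θ X → k) →ₐ[k] (fixedPoints θ → k) :=
    AlgHom.pi fun g => Pi.evalAlgHom k _ ⟨Ad g.1 X, g.1, g.2, rfl⟩
  have hπ : Function.Injective π := by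
    intro f f' h
    funext ⟨_, g, hg, rfl⟩
    exact congrFun h ⟨g, hg⟩
  have : Nontrivial (B ⧸ J) := by
    refine ⟨0, 1, fun h => ?_⟩
    have h1 := congrArg j h
    rw [map_zero, map_one] at h1
    exact zero_ne_one (congrFun h1 1)
  let y : B → B ⧸ J := fun b => Ideal.Quotient.mkₐ k J (adFunction X b)
  let S := Algebra.adjoin k (Set.range y)
  let fn : Module.Dual k (lieAlgebra k B) →ₗ[k] (orbit θ X → k) :=
    { toFun := fun φ s => φ s, map_add' := fun _ _ => rfl, map_smul' := fun _ _ => rfl }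
  let R := Algebra.adjoin k (Set.range fn)
  have hSR : R.map π = S.map j := by
    rw [AlgHom.map_adjoin, AlgHom.map_adjoin]
    congr 1
    ext f
    constructor
    · rintro ⟨_, ⟨φ, rfl⟩, rfl⟩
      obtain ⟨b, hb⟩ := exists_eq_counit_apply φ
      refine ⟨_, ⟨b, rfl⟩, funext fun g => ?_⟩
      exact (apply_adFunction X g.1 b).trans (hb _).symm
    · rintro ⟨_, ⟨b, rfl⟩, rfl⟩
      let ap : lieAlgebra k B →ₗ[k] B :=
        { toFun := fun Z => Z.1 b, map_add' := fun _ _ => rfl, map_smul' := fun _ _ => rfl }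
      refine ⟨_, ⟨counit ∘ₗ ap, rfl⟩, funext fun g => ?_⟩
      exact (apply_adFunction X g.1 b).symm
  have hSfg : S.FG := by
    refine Subalgebra.fg_of_fg_map S j hj ?_
    rw [← hSR]
    exact (adjoin_range_linearMap_fg fn).map π
  have hdim : zariskiDim (k := k) (orbit θ X) = ringKrullDim S := by
    rw [← ringKrullDim_map_of_injective S hj, ← hSR, ringKrullDim_map_of_injective R hπ]
    rfl
  rw [hdim]
  refine ringKrullDim_subalgebra_eq S fun P hP => ?_
  have hPp : P.IsPrime := Ideal.IsMinimalPrime.isPrime hP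
  -- `P` corresponds to an irreducible component of the fixed group, and `u` below is its generic
  -- point.
  let L := FractionRing ((B ⧸ J) ⧸ P)
  let i : ((B ⧸ J) ⧸ P) →ₐ[k] L := IsScalarTower.toAlgHom k _ L
  have hi : Function.Injective i := IsFractionRing.injective ((B ⧸ J) ⧸ P) L
  let u : B →ₐ[k] L := (i.comp (Ideal.Quotient.mkₐ k P)).comp (Ideal.Quotient.mkₐ k J)
  rw [← ringKrullDim_map_of_injective _ hi, Subalgebra.map_map]
  have hL : S.map (i.comp (Ideal.Quotient.mkₐ k P)) =
      Algebra.adjoin k (Set.range fun b => u (adFunction X b)) := by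
    rw [AlgHom.map_adjoin, ← Set.range_comp]
    rfl
  have hLfg := hSfg.map (i.comp (Ideal.Quotient.mkₐ k P))
  rw [hL] at hLfg ⊢
  let dv : Derivation k L L →ₗ[L] (B → L) :=
    { toFun := fun D b => D (u (adFunction X b))
      map_add' := fun _ _ => rfl
      map_smul' := fun _ _ => rfl }
  let M : Submodule L (B → L) := LinearMap.range dv
  have hM : ∀ m, m ∈ M ↔ ∃ D : Derivation k L L, ∀ b, D (u (adFunction X b)) = m b := fun m => by
    refine exists_congr fun D => funext_iff
  rw [ringKrullDim_adjoin_range _ hLfg M hM]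
  refine congrArg _ (finrank_derivation_adFunction (θ := θ) X u (fun b => ?_)
    (fun Z hZ => ?_) M hM)
  · have : Ideal.Quotient.mkₐ k J (θ b) = Ideal.Quotient.mkₐ k J b :=
      Ideal.Quotient.eq.mpr (Ideal.le_radical (Ideal.subset_span ⟨b, rfl⟩))
    change (i.comp (Ideal.Quotient.mkₐ k P)) (Ideal.Quotient.mkₐ k J (θ b)) = _
    rw [this]
    rfl
  -- `Z` preserves the fixed ideal, hence its radical `J`; the induced derivation preserves the zero
  -- ideal, hence the minimal prime `P`; finally it extends to the fraction field.
  · obtain ⟨D₁, hD₁⟩ := exists_derivation_quotient Z.1 (I := J) fun a ha =>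
      derivation_mem_radical Z.1 (fun a => lie_mem_fixedIdeal hZ) ha
    obtain ⟨D₂, hD₂⟩ := exists_derivation_quotient D₁ (I := P) fun a ha =>
      derivation_mem_of_mem_minimalPrimes D₁ (J := ⊥) (fun a ha => by
        rw [Ideal.mem_bot] at ha ⊢
        rw [ha, map_zero]) hP ha
    have : Algebra.FormallyEtale ((B ⧸ J) ⧸ P) L := .of_isLocalization (nonZeroDivisors _)
    obtain ⟨D₃, hD₃⟩ := exists_derivation_extending k ((B ⧸ J) ⧸ P) L
      ((Algebra.linearMap ((B ⧸ J) ⧸ P) L).compDer D₂)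
    refine ⟨D₃, fun b => ?_⟩
    refine (hD₃ _).trans ?_
    change i (D₂ (Ideal.Quotient.mkₐ k P _)) = _
    rw [hD₂]
    change i (Ideal.Quotient.mkₐ k P (D₁ (Ideal.Quotient.mkₐ k J b))) = _
    rw [hD₁]
    rfl

end OrbitDimension

end

end AlgebraicGroup

namespace AlgebraicGroup

noncomputable section

/-! ### Replicas and Cartan's criterion -/

section Replica

open WithConv Coalgebra Module.End

variable {k B : Type*} [Field k] [CommRing B] [HopfAlgebra k B]

/-- An element of the Lie algebra as an endomorphism of `k[G]`. -/
abbrev lieEnd (X : lieAlgebra k B) : Module.End k B := ((X.1 : B →ₗ[k] B) : Module.End k B)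

theorem mem_maxGenEigenspace_of_sub_smul_mem {V : Type*} [AddCommGroup V] [Module k V]
    {T : Module.End k V} {μ : k} {v : V} (h : T v - μ • v ∈ T.maxGenEigenspace μ) :
    v ∈ T.maxGenEigenspace μ := by
  rw [mem_maxGenEigenspace] at h ⊢
  obtain ⟨n, hn⟩ := h
  refine ⟨n + 1, ?_⟩
  rw [pow_succ, Module.End.mul_apply]
  simpa using hn

/-- By the Leibniz rule, D - (μ + ν) sends ab to (D - μ)a · b + a · (D - ν)b. Induct on the sum of
the exponents that kill a and b. -/
theorem mul_mem_maxGenEigenspace (D : Derivation k B B) {μ ν : k} {a b : B}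
    (ha : a ∈ maxGenEigenspace (D : B →ₗ[k] B) μ)
    (hb : b ∈ maxGenEigenspace (D : B →ₗ[k] B) ν) :
    a * b ∈ maxGenEigenspace (D : B →ₗ[k] B) (μ + ν) := by
  set T : Module.End k B := ((D : B →ₗ[k] B) : Module.End k B) with hT
  have key : ∀ N m n : ℕ, m + n ≤ N → ∀ a b : B, ((T - μ • (1 : Module.End k B)) ^ m) a = 0 →
      ((T - ν • (1 : Module.End k B)) ^ n) b = 0 → a * b ∈ T.maxGenEigenspace (μ + ν) := by
    intro N
    induction N with
    | zero =>
      intro m n hmn a b ha hb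
      obtain rfl : m = 0 := by omega
      have : a = 0 := ha
      rw [this, zero_mul]
      exact Submodule.zero_mem _
    | succ N ih =>
      intro m n hmn a b ha hb
      rcases m with _ | m
      · have : a = 0 := ha
        rw [this, zero_mul]
        exact Submodule.zero_mem _
      rcases n with _ | n
      · have : b = 0 := hb
        rw [this, mul_zero]
        exact Submodule.zero_mem _
      refine mem_maxGenEigenspace_of_sub_smul_mem ?_
      have h1 : T (a * b) - (μ + ν) • (a * b) =
          ((T - μ • (1 : Module.End k B)) a) * b + a * ((T - ν • (1 : Module.End k B)) b) := by
        have h2 : T (a * b) = a * T b + b * T a := D.leibniz a b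
        simp only [h2, LinearMap.sub_apply, LinearMap.smul_apply, Module.End.one_apply]
        simp only [Algebra.smul_def, map_add]
        ring
      rw [h1]
      refine Submodule.add_mem _ (ih m (n + 1) (by omega) _ _ ?_ hb)
        (ih (m + 1) n (by omega) _ _ ha ?_)
      · rwa [← Module.End.mul_apply, ← pow_succ]
      · rwa [← Module.End.mul_apply, ← pow_succ]
  rw [mem_maxGenEigenspace] at ha hb
  obtain ⟨m, hm⟩ := ha
  obtain ⟨n, hn⟩ := hb
  exact key _ m n le_rfl a b hm hn

/-- Every function lies in a finite dimensional subcomodule, which is stable under `X` and splits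
into generalised eigenspaces. -/
theorem iSup_maxGenEigenspace_lieEnd [IsAlgClosed k] (X : lieAlgebra k B) :
    ⨆ μ, (lieEnd X).maxGenEigenspace μ = ⊤ := by
  rw [eq_top_iff]
  intro b _
  obtain ⟨V, hV, hbV, hst⟩ := exists_subcomodule (k := k) {b}
  have hX : ∀ v ∈ V, lieEnd X v ∈ V := fun v hv => by
    have := hst (functional X) v hv
    rwa [functional, ← lie_eq_rho] at this
  have h := iSup_maxGenEigenspace_eq_top ((lieEnd X).restrict hX)
  have h2 : (⟨b, hbV (by simp)⟩ : V) ∈ ⨆ μ, maxGenEigenspace ((lieEnd X).restrict hX) μ := by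
    rw [h]; trivial
  have h3 := Submodule.mem_map_of_mem (f := V.subtype) h2
  rw [Submodule.map_iSup] at h3
  refine SetLike.le_def.mp (iSup_mono fun μ => ?_) h3
  rintro _ ⟨v, hv, rfl⟩
  rw [SetLike.mem_coe, mem_maxGenEigenspace] at hv
  rw [mem_maxGenEigenspace]
  obtain ⟨n, hn⟩ := hv
  refine ⟨n, ?_⟩
  have key : ∀ (n : ℕ) (w : V), ((((lieEnd X).restrict hX - μ • 1) ^ n) w : B) =
      ((lieEnd X - μ • 1) ^ n) (w : B) := by
    intro n
    induction n with
    | zero => intro w; rfl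
    | succ n ih =>
      intro w
      rw [pow_succ, pow_succ, Module.End.mul_apply, Module.End.mul_apply, ih]
      rfl
  have h4 := key n v
  rw [hn] at h4
  exact h4.symm

/-- A linear endomorphism acting by prescribed scalars on the summands of a direct sum. -/
theorem exists_linearMap_of_isInternal {ι V : Type*} [DecidableEq ι] [AddCommGroup V] [Module k V]
    {G : ι → Submodule k V} (hG : DirectSum.IsInternal G) (c : ι → k) :
    ∃ S : V →ₗ[k] V, ∀ i, ∀ v ∈ G i, S v = c i • v := by
  let e := LinearEquiv.ofBijective (DirectSum.coeLinearMap G) hG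
  refine ⟨DirectSum.toModule k ι V (fun i => c i • (G i).subtype) ∘ₗ e.symm.toLinearMap,
    fun i v hv => ?_⟩
  have h : e.symm v = DirectSum.lof k ι (fun i => G i) i ⟨v, hv⟩ := by
    rw [LinearEquiv.symm_apply_eq]
    exact (DirectSum.coeLinearMap_lof G i ⟨v, hv⟩).symm
  rw [LinearMap.comp_apply, LinearEquiv.coe_coe, h, DirectSum.toModule_lof]
  rfl

/-- The replicas of (the semisimple part of) an element of the Lie algebra of an algebraic group
belong to the Lie algebra. -/
theorem exists_replica [IsAlgClosed k] (X : lieAlgebra k B) (φ : k →+ k) :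
    ∃ Y : lieAlgebra k B, ∀ μ, ∀ b ∈ (lieEnd X).maxGenEigenspace μ, Y.1 b = φ μ • b := by
  classical
  have htop := iSup_maxGenEigenspace_lieEnd X
  have hint : DirectSum.IsInternal fun μ => (lieEnd X).maxGenEigenspace μ :=
    DirectSum.isInternal_submodule_of_iSupIndep_of_iSup_eq_top
      (independent_maxGenEigenspace _) htop
  obtain ⟨S, hS⟩ := exists_linearMap_of_isInternal hint φ
  have hmem : ∀ b : B, b ∈ ⨆ μ, (lieEnd X).maxGenEigenspace μ := fun b => by rw [htop]; trivial
  -- The generalised eigenspaces multiply by adding eigenvalues, and `φ` is additive; this is the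
  -- Leibniz rule for `S`.
  have hder : ∀ a b, S (a * b) = a • S b + b • S a := by
    intro a b
    induction hmem a using Submodule.iSup_induction' with
    | zero => simp
    | add x y _ _ hx hy => simp only [add_mul, map_add, hx, hy, add_smul, smul_add]; abel
    | mem μ a ha =>
      induction hmem b using Submodule.iSup_induction' with
      | zero => simp
      | add x y _ _ hx hy => simp only [mul_add, map_add, hx, hy, add_smul, smul_add]; abel
      | mem ν b hb =>
        rw [hS _ _ (mul_mem_maxGenEigenspace X.1 ha hb), hS _ _ ha, hS _ _ hb, map_add]
        simp only [Algebra.smul_def, map_add, Algebra.algebraMap_self, RingHom.id_apply]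
        ring
  refine ⟨⟨Derivation.mk' S hder, ?_⟩, hS⟩
  -- Each `lam ψ` commutes with `X`, so it preserves the generalised eigenspaces of `X` and commutes
  -- with `S`.
  refine leftInvariant_of_forall_lam (T := S) fun ψ b => ?_
  induction hmem b using Submodule.iSup_induction' with
  | zero => simp
  | add x y _ _ hx hy => simp only [map_add, hx, hy]
  | mem μ b hb =>
    have hl : lam ψ b ∈ (lieEnd X).maxGenEigenspace μ := by
      have hc : Commute (lieEnd X) (lam ψ : Module.End k B) :=
        LinearMap.ext fun b => ((leftInvariant_lie X).lam_comp ψ b).symm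
      exact mapsTo_maxGenEigenspace_of_comm hc μ hb
    rw [hS _ _ hb, hS _ _ hl, map_smul]

/-- If the traces of the products of `T` with its replicas vanish, then `T` is nilpotent. -/
theorem isNilpotent_of_trace_replica [IsAlgClosed k] [CharZero k] {V : Type*} [AddCommGroup V]
    [Module k V] [FiniteDimensional k V] (T : Module.End k V)
    (h : ∀ φ : k →ₗ[ℚ] ℚ, ∃ Y : Module.End k V,
      (∀ μ, ∀ v ∈ T.maxGenEigenspace μ, Y v = (φ μ : k) • v) ∧ LinearMap.trace k V (T * Y) = 0) :
    IsNilpotent T := by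
  classical
  have hint : DirectSum.IsInternal fun μ => T.maxGenEigenspace μ :=
    DirectSum.isInternal_submodule_of_iSupIndep_of_iSup_eq_top
      (independent_maxGenEigenspace _) (iSup_maxGenEigenspace_eq_top T)
  have hfin : {μ | T.maxGenEigenspace μ ≠ ⊥}.Finite :=
    WellFoundedGT.finite_ne_bot_of_iSupIndep hint.submodule_iSupIndep
  have hzero : ∀ μ, T.maxGenEigenspace μ ≠ ⊥ → μ = 0 := by
    intro μ hμ
    refine (Module.forall_dual_apply_eq_zero_iff ℚ μ).mp fun φ => ?_
    obtain ⟨Y, hY, htr⟩ := h φ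
    have hT : ∀ μ, Set.MapsTo T (T.maxGenEigenspace μ) (T.maxGenEigenspace μ) :=
      mapsTo_maxGenEigenspace_of_comm (Commute.refl T)
    have hTY : ∀ μ, Set.MapsTo (T * Y) (T.maxGenEigenspace μ) (T.maxGenEigenspace μ) := by
      intro μ v hv
      rw [Module.End.mul_apply, hY μ v hv]
      exact hT μ (Submodule.smul_mem _ _ hv)
    rw [LinearMap.trace_eq_sum_trace_restrict' hint hfin hTY] at htr
    have htr2 : ∀ μ, LinearMap.trace k _ ((T * Y).restrict (hTY μ)) =
        (φ μ : k) * (μ * Module.finrank k (T.maxGenEigenspace μ)) := by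
      intro μ
      have h1 : (T * Y).restrict (hTY μ) = (φ μ : k) • T.restrict (hT μ) := by
        ext v
        change T (Y v) = (φ μ : k) • T v
        rw [hY μ v v.2, map_smul]
      have h2 : LinearMap.trace k _ (T.restrict (hT μ)) =
          μ * Module.finrank k (T.maxGenEigenspace μ) := by
        have h3 := LinearMap.trace_comp_eq_mul_of_commute_of_isNilpotent μ
          (f := LinearMap.id) (g := T.restrict (hT μ)) (Commute.one_left _)
          (isNilpotent_restrict_maxGenEigenspace_sub_algebraMap T μ)
        rwa [LinearMap.id_comp, LinearMap.trace_id] at h3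
      rw [h1, map_smul, h2, smul_eq_mul]
    rw [Finset.sum_congr rfl fun μ _ => htr2 μ] at htr
    -- Applying `φ` to the vanishing trace gives a sum of squares with nonnegative coefficients, so
    -- `φ` kills every eigenvalue. As `φ` is an arbitrary ℚ-linear form on `k`, every eigenvalue is
    -- zero.
    have htr3 : ∑ μ ∈ hfin.toFinset,
        (Module.finrank k (T.maxGenEigenspace μ) : ℚ) * (φ μ * φ μ) = 0 := by
      have h4 := congrArg φ htr
      rw [map_zero, map_sum] at h4
      rw [← h4]
      refine Finset.sum_congr rfl fun μ _ => ?_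
      have h5 : (φ μ : k) * (μ * Module.finrank k (T.maxGenEigenspace μ)) =
          ((φ μ) * (Module.finrank k (T.maxGenEigenspace μ) : ℚ)) • μ := by
        rw [Algebra.smul_def]
        simp
        ring
      rw [h5, map_smul, smul_eq_mul]
      ring
    rw [Finset.sum_eq_zero_iff_of_nonneg (fun μ _ => mul_nonneg (Nat.cast_nonneg _) (mul_self_nonneg _))] at htr3
    have h6 := htr3 μ (hfin.mem_toFinset.mpr hμ)
    have h7 : (Module.finrank k (T.maxGenEigenspace μ) : ℚ) ≠ 0 := by
      rw [Nat.cast_ne_zero, ← Nat.pos_iff_ne_zero, Module.finrank_pos_iff]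
      exact Submodule.nontrivial_iff_ne_bot.mpr hμ
    simpa [h7] using h6
  have htop : T.maxGenEigenspace 0 = ⊤ := by
    rw [← iSup_maxGenEigenspace_eq_top T]
    refine le_antisymm (le_iSup _ 0) (iSup_le fun μ => ?_)
    by_cases hμ : T.maxGenEigenspace μ = ⊥
    · rw [hμ]; exact bot_le
    · rw [hzero μ hμ]
  rw [Module.End.isNilpotent_iff_of_finite]
  intro v
  have hv : v ∈ T.maxGenEigenspace 0 := by rw [htop]; trivial
  rw [mem_maxGenEigenspace] at hv
  simpa using hv

end Replica

end

end AlgebraicGroup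

namespace AlgebraicGroup

noncomputable section

/-! ### One-parameter curves and connectedness of unipotent groups -/

section UnipotentCurve

open WithConv Coalgebra Polynomial

variable {k B : Type*} [Field k] [CommRing B] [HopfAlgebra k B]

theorem counit_rightTranslation (g : Points k B) (b : B) :
    counit (R := k) (rightTranslation g b) = g.ofConv b := by
  rw [rightTranslation_eq_rho, counit_rho]
  rfl

theorem rightTranslation_pow (g : Points k B) (n : ℕ) (b : B) :
    rightTranslation (g ^ n) b = ((rightTranslation g).toLinearMap ^ n : Module.End k B) b := by
  induction n generalizing b with
  | zero => rw [pow_zero, rightTranslation_one]; rfl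
  | succ n ih => rw [pow_succ, rightTranslation_mul, ih, pow_succ]; rfl

theorem polynomial_eq_of_forall_natCast [CharZero k] {p q : k[X]}
    (h : ∀ n : ℕ, p.eval (n : k) = q.eval (n : k)) : p = q :=
  Polynomial.eq_of_infinite_eval_eq p q
    ((Set.infinite_range_of_injective Nat.cast_injective).mono (by rintro _ ⟨n, rfl⟩; exact h n))

/-- The one-parameter group through a unipotent element, as a comorphism to `k[t]`. -/
theorem IsUnipotent.exists_curve [CharZero k] {g : Points k B} (hg : IsUnipotent g) :
    ∃ γ : B →ₐ[k] k[X], ∀ (n : ℕ) (b : B), (γ b).eval (n : k) = (g ^ n).ofConv b := by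
  have hp : ∀ b : B, ∃ p : k[X], ∀ n : ℕ, p.eval (n : k) = (g ^ n).ofConv b := by
    intro b
    obtain ⟨m, hm⟩ := hg b
    set T : Module.End k B := (rightTranslation g).toLinearMap - LinearMap.id with hT
    have hT1 : ((rightTranslation g).toLinearMap : Module.End k B) = T + 1 := by
      rw [hT]; exact (sub_add_cancel _ _).symm
    -- The binomial expansion of (1 + T)^n has only finitely many nonzero terms on `b`; the falling
    -- factorial divided by j! writes the binomial coefficient as a polynomial in n.
    refine ⟨∑ j ∈ Finset.range m,
      C (counit (R := k) ((T ^ j) b) * (j.factorial : k)⁻¹) * descPochhammer k j, fun n => ?_⟩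
    rw [← counit_rightTranslation, rightTranslation_pow, hT1,
      (Commute.one_right T).add_pow, Polynomial.eval_finsetSum, LinearMap.sum_apply, map_sum]
    have hterm : ∀ j, counit (R := k) ((T ^ j * 1 ^ (n - j) * (n.choose j : Module.End k B)) b) =
        (n.choose j : k) * counit (R := k) ((T ^ j) b) := by
      intro j
      rw [one_pow, mul_one, ← nsmul_eq_mul', LinearMap.smul_apply, map_nsmul, nsmul_eq_mul]
    have hterm2 : ∀ j, (C (counit (R := k) ((T ^ j) b) * (j.factorial : k)⁻¹) *
        descPochhammer k j).eval (n : k) = (n.choose j : k) * counit (R := k) ((T ^ j) b) := by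
      intro j
      have : (j.factorial : k) ≠ 0 := Nat.cast_ne_zero.mpr j.factorial_ne_zero
      rw [Polynomial.eval_mul, Polynomial.eval_C, descPochhammer_eval_eq_descFactorial,
        Nat.descFactorial_eq_factorial_mul_choose, Nat.cast_mul]
      field_simp
    rw [Finset.sum_congr rfl fun j _ => hterm j, Finset.sum_congr rfl fun j _ => hterm2 j]
    -- The polynomial stops at `m`, the binomial formula at `n + 1`; both sums equal the one up to
    -- the larger bound.
    have h1 : ∀ M, m ≤ M → ∑ j ∈ Finset.range M, (n.choose j : k) * counit (R := k) ((T ^ j) b) =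
        ∑ j ∈ Finset.range m, (n.choose j : k) * counit (R := k) ((T ^ j) b) := by
      intro M hM
      refine (Finset.sum_subset (Finset.range_mono hM) fun j _ hj => ?_).symm
      have hj : m ≤ j := by simpa using hj
      obtain ⟨i, rfl⟩ := Nat.exists_eq_add_of_le' hj
      rw [pow_add, Module.End.mul_apply, hm, map_zero, map_zero, mul_zero]
    have h2 : ∀ M, n + 1 ≤ M → ∑ j ∈ Finset.range M,
        (n.choose j : k) * counit (R := k) ((T ^ j) b) =
        ∑ j ∈ Finset.range (n + 1), (n.choose j : k) * counit (R := k) ((T ^ j) b) := by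
      intro M hM
      refine (Finset.sum_subset (Finset.range_mono hM) fun j _ hj => ?_).symm
      have hj : n < j := by simpa using hj
      rw [Nat.choose_eq_zero_of_lt hj, Nat.cast_zero, zero_mul]
    rw [← h1 _ (le_max_left m (n + 1)), h2 _ (le_max_right m (n + 1))]
  choose p hp using hp
  refine ⟨AlgHom.ofLinearMap
    { toFun := p
      map_add' := fun a b => polynomial_eq_of_forall_natCast fun n => by simp [hp]
      map_smul' := fun c b => polynomial_eq_of_forall_natCast fun n => by simp [hp] }
    (polynomial_eq_of_forall_natCast fun n => by simp [hp])
    (fun a b => polynomial_eq_of_forall_natCast fun n => by simp [hp]), fun n b => hp b n⟩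

/-- Two nonempty cofinite subsets of an infinite set meet. This topology plays the role of the
Zariski topology on the affine line. -/
theorem isPreconnected_cofiniteTopology {X : Type*} [Infinite X] :
    PreconnectedSpace (CofiniteTopology X) := by
  have : PreirreducibleSpace (CofiniteTopology X) := by
    refine ⟨fun u v hu hv ⟨x, _, hx⟩ ⟨y, _, hy⟩ => ?_⟩
    rw [CofiniteTopology.isOpen_iff] at hu hv
    have h := (hu ⟨x, hx⟩).union (hv ⟨y, hy⟩)
    have : Infinite (CofiniteTopology X) := Infinite.of_injective _ CofiniteTopology.of.injective
    obtain ⟨z, hz⟩ := h.exists_notMem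
    simp only [Set.mem_union, Set.mem_compl_iff, not_or, not_not] at hz
    exact ⟨z, trivial, hz⟩
  infer_instance

/-- The set of values of a polynomial curve is connected in the Zariski topology. -/
theorem isPreconnected_range_curve [Infinite k] (γ : B →ₐ[k] k[X]) :
    @IsPreconnected _ (zariskiTopology k B)
      (Set.range fun t : k => (toConv ((Polynomial.aeval t).comp γ) : Points k B)) := by
  let _ := zariskiTopology k B
  let f : CofiniteTopology k → Points k B := fun t =>
    toConv ((Polynomial.aeval (CofiniteTopology.of.symm t)).comp γ)
  have hf : Continuous f := by
    refine continuous_generateFrom_iff.mpr ?_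
    rintro _ ⟨b, rfl⟩
    rw [CofiniteTopology.isOpen_iff]
    rintro ⟨t, ht⟩
    have h0 : γ b ≠ 0 := by
      intro h
      refine ht ?_
      simp [f, h]
    have h1 := Polynomial.finite_setOfPred_isRoot h0
    refine (h1.image CofiniteTopology.of).subset ?_
    intro s hs
    refine ⟨CofiniteTopology.of.symm s, ?_, Equiv.apply_symm_apply _ _⟩
    have : ¬ (f s).ofConv b ≠ 0 := hs
    simpa [f, Polynomial.aeval_def, Polynomial.IsRoot] using this
  have := isPreconnected_cofiniteTopology (X := k)
  have h := isPreconnected_range hf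
  have h2 : Set.range (fun t : k => (toConv ((Polynomial.aeval t).comp γ) : Points k B)) =
      Set.range f := by
    refine le_antisymm ?_ ?_
    · rintro _ ⟨t, rfl⟩
      exact ⟨CofiniteTopology.of t, rfl⟩
    · rintro _ ⟨t, rfl⟩
      exact ⟨_, rfl⟩
  rwa [h2]

/-- A subgroup of unipotent elements, cut out by a set of equations, is connected. -/
theorem isConnected_of_isUnipotent [CharZero k] (N : Subgroup (Points k B)) (s : Set B)
    (hs : ∀ g : Points k B, g ∈ N ↔ ∀ b ∈ s, g.ofConv b = 0) (hN : ∀ g ∈ N, IsUnipotent g) :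
    @IsConnected _ (zariskiTopology k B) (N : Set (Points k B)) := by
  let _ := zariskiTopology k B
  refine ⟨⟨1, N.one_mem⟩, isPreconnected_of_forall 1 fun g hg => ?_⟩
  obtain ⟨γ, hγ⟩ := (hN g hg).exists_curve
  refine ⟨Set.range fun t : k => (toConv ((Polynomial.aeval t).comp γ) : Points k B), ?_, ⟨0, ?_⟩,
    ⟨1, ?_⟩, isPreconnected_range_curve γ⟩
  · rintro _ ⟨t, rfl⟩
    refine (hs _).mpr fun b hb => ?_
    -- Every power of `g` lies in `N`, so each equation of `N` vanishes along the curve at all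
    -- natural numbers, hence identically: the curve joining 1 to `g` stays in `N`.
    have h0 : γ b = 0 := polynomial_eq_of_forall_natCast fun n => by
      rw [hγ, Polynomial.eval_zero]
      exact (hs _).mp (N.pow_mem hg n) b hb
    simp [h0]
  · apply ofConv_injective
    ext b
    have := hγ 0 b
    rw [pow_zero, Nat.cast_zero] at this
    rw [← this]
    simp
  · apply ofConv_injective
    ext b
    have := hγ 1 b
    rw [pow_one, Nat.cast_one] at this
    rw [← this]
    simp

theorem isClosed_of_forall_mem_iff (N : Set (Points k B)) (s : Set B)
    (hs : ∀ g : Points k B, g ∈ N ↔ ∀ b ∈ s, g.ofConv b = 0) :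
    IsClosed[zariskiTopology k B] N := by
  let _ := zariskiTopology k B
  have h : N = ⋂ b ∈ s, {g : Points k B | g.ofConv b ≠ 0}ᶜ := by
    ext g
    simp [hs g]
  rw [h]
  refine isClosed_biInter fun b _ => (TopologicalSpace.isOpen_generateFrom_of_mem ?_).isClosed_compl
  exact ⟨b, rfl⟩

end UnipotentCurve

/-! ### Ad-stable nilpotent subalgebras of a reductive group vanish -/

section NilpotentSubalgebra

open WithConv Coalgebra

variable {k B : Type*} [Field k] [CommRing B] [HopfAlgebra k B]

/-- The ascending filtration of `k[G]` defined by a Lie subalgebra `n`: an element lies in the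
step `i + 1` if `n` maps it to the step `i`. -/
def fil (n : LieSubalgebra k (lieAlgebra k B)) : ℕ → Submodule k B
  | 0 => ⊥
  | i + 1 => ⨅ X : n, (fil n i).comap (lieEnd X.1)

variable {n : LieSubalgebra k (lieAlgebra k B)}

theorem mem_fil_succ {i : ℕ} {b : B} : b ∈ fil n (i + 1) ↔ ∀ X ∈ n, X.1 b ∈ fil n i := by
  simp [fil, Submodule.mem_iInf]

theorem fil_le_succ (i : ℕ) : fil n i ≤ fil n (i + 1) := by
  induction i with
  | zero => exact bot_le
  | succ i ih =>
    intro b hb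
    rw [mem_fil_succ] at hb ⊢
    exact fun X hX => ih (hb X hX)

/-- Engel's theorem on a finite dimensional subcomodule containing `b`: the ascending central series
reaches the whole module, and its steps lie in those of `fil n`. -/
theorem exists_mem_fil [Algebra.FiniteType k B] (hn : ∀ X ∈ n, IsNilpotentElement X) (b : B) :
    ∃ i, b ∈ fil n i := by
  obtain ⟨V, hV, hbV, hst⟩ := exists_subcomodule (k := k) {b}
  let W : LieSubmodule k n B :=
    { V with
      lie_mem := fun {X v} hv => by
        have h : X.1.1 v = rho (counit ∘ₗ (X.1.1 : B →ₗ[k] B)) v := lie_eq_rho X.1 v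
        have h2 := hst (counit ∘ₗ (X.1.1 : B →ₗ[k] B)) v hv
        rw [← h] at h2
        exact h2 }
  have hW : FiniteDimensional k W := hV
  have hfd : FiniteDimensional k (lieAlgebra k B) := finiteDimensional_lieAlgebra
  have hfd2 : FiniteDimensional k n := inferInstanceAs (FiniteDimensional k n.toSubmodule)
  have hnil : LieModule.IsNilpotent n W := by
    rw [LieModule.isNilpotent_iff_forall (R := k)]
    intro X
    rw [Module.End.isNilpotent_iff_of_finite]
    intro w
    obtain ⟨m, hm⟩ := hn X.1 X.2 (w : B)
    refine ⟨m, Subtype.ext ?_⟩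
    have key : ∀ (m : ℕ) (w : W), (((LieModule.toEnd k n W X) ^ m) w : B) =
        ((lieEnd X.1) ^ m) (w : B) := by
      intro m
      induction m with
      | zero => intro w; rfl
      | succ m ih => intro w; rw [pow_succ, pow_succ, Module.End.mul_apply, ih]; rfl
    exact (key m w).trans hm
  obtain ⟨i, hi⟩ := (LieModule.isNilpotent_iff_exists_ucs_eq_top k).mp hnil
  have key : ∀ (i : ℕ) (w : W), w ∈ LieSubmodule.ucs i (⊥ : LieSubmodule k n W) →
      (w : B) ∈ fil n i := by
    intro i
    induction i with
    | zero =>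
      intro w hw
      have : w = 0 := by simpa using hw
      rw [this]
      exact Submodule.zero_mem _
    | succ i ih =>
      intro w hw
      rw [LieSubmodule.ucs_succ, LieSubmodule.mem_normalizer] at hw
      rw [mem_fil_succ]
      exact fun X hX => ih _ (hw ⟨X, hX⟩)
  exact ⟨i, key i ⟨b, hbV (by simp)⟩ (by rw [hi]; trivial)⟩

theorem Ad_apply (g : Points k B) (X : lieAlgebra k B) (b : B) :
    (Ad g X).1 b = rightTranslation g (X.1 (rightTranslation g⁻¹ b)) := rfl

theorem rightTranslation_mem_fil (hAd : ∀ g, ∀ X ∈ n, Ad g X ∈ n) (g : Points k B) (i : ℕ)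
    {b : B} (hb : b ∈ fil n i) : rightTranslation g b ∈ fil n i := by
  induction i generalizing b with
  | zero =>
    have : b = 0 := hb
    rw [this, map_zero]
    exact Submodule.zero_mem _
  | succ i ih =>
    rw [mem_fil_succ] at hb ⊢
    intro X hX
    have h := ih (hb _ (hAd g⁻¹ X hX))
    rwa [Ad_apply, inv_inv, ← rightTranslation_mul, mul_inv_cancel, rightTranslation_one] at h

/-- The subgroup of `G(k)` acting trivially on the quotients of the filtration. -/
def filSubgroup (n : LieSubalgebra k (lieAlgebra k B)) (hAd : ∀ g, ∀ X ∈ n, Ad g X ∈ n) :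
    Subgroup (Points k B) where
  carrier := {g | ∀ i, ∀ b ∈ fil n (i + 1), rightTranslation g b - b ∈ fil n i}
  one_mem' i b _ := by
    rw [rightTranslation_one, sub_self]
    exact Submodule.zero_mem _
  mul_mem' {g h} hg hh i b hb := by
    have : rightTranslation (g * h) b - b =
        rightTranslation g (rightTranslation h b - b) + (rightTranslation g b - b) := by
      rw [rightTranslation_mul, map_sub]; abel
    rw [this]
    exact Submodule.add_mem _ (rightTranslation_mem_fil hAd g i (hh i b hb)) (hg i b hb)
  inv_mem' {g} hg i b hb := by
    have : rightTranslation g⁻¹ b - b = -rightTranslation g⁻¹ (rightTranslation g b - b) := by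
      rw [map_sub, ← rightTranslation_mul, inv_mul_cancel, rightTranslation_one, neg_sub]
    rw [this]
    exact Submodule.neg_mem _ (rightTranslation_mem_fil hAd g⁻¹ i (hg i b hb))

theorem mem_filSubgroup {hAd : ∀ g, ∀ X ∈ n, Ad g X ∈ n} {g : Points k B} :
    g ∈ filSubgroup n hAd ↔ ∀ i, ∀ b ∈ fil n (i + 1), rightTranslation g b - b ∈ fil n i := Iff.rfl

theorem filSubgroup_normal (hAd : ∀ g, ∀ X ∈ n, Ad g X ∈ n) : (filSubgroup n hAd).Normal := by
  refine ⟨fun x hx g i b hb => ?_⟩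
  have : rightTranslation (g * x * g⁻¹) b - b = rightTranslation g
      (rightTranslation x (rightTranslation g⁻¹ b) - rightTranslation g⁻¹ b) := by
    rw [map_sub, ← rightTranslation_mul g g⁻¹, mul_inv_cancel, rightTranslation_one,
      rightTranslation_mul, rightTranslation_mul]
  rw [this]
  exact rightTranslation_mem_fil hAd g i (hx i _ (rightTranslation_mem_fil hAd g⁻¹ _ hb))

/-- The equations of the subgroup acting trivially on the quotients of the filtration. -/
def filEquations (n : LieSubalgebra k (lieAlgebra k B)) : Set B :=
  {a | ∃ (i : ℕ) (b : B) (ψ : B →ₗ[k] k), b ∈ fil n (i + 1) ∧ (∀ c ∈ fil n i, ψ c = 0) ∧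
    a = lam ψ b - algebraMap k B (ψ b)}

theorem apply_lam (g : Points k B) (ψ : B →ₗ[k] k) (b : B) :
    g.ofConv (lam ψ b) = ψ (rightTranslation g b) := by
  rw [rightTranslation_eq_rho, functional_rho]
  exact functional_lam ψ g.ofConv.toLinearMap b

/-- The equation attached to `b` and `ψ` takes at `g` the value ψ(ρ_g b - b), and the forms
vanishing on `fil n i` detect membership in it. -/
theorem mem_filSubgroup_iff {hAd : ∀ g, ∀ X ∈ n, Ad g X ∈ n} (g : Points k B) :
    g ∈ filSubgroup n hAd ↔ ∀ a ∈ filEquations n, g.ofConv a = 0 := by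
  rw [mem_filSubgroup]
  constructor
  · rintro hg _ ⟨i, b, ψ, hb, hψ, rfl⟩
    rw [map_sub, apply_lam, AlgHom.commutes, Algebra.algebraMap_self, RingHom.id_apply, ← map_sub]
    exact hψ _ (hg i b hb)
  · intro h i b hb
    by_contra hmem
    obtain ⟨ψ, hψ1, hψ2⟩ := Submodule.exists_le_ker_of_notMem hmem
    refine hψ1 ?_
    have h2 := h _ ⟨i, b, ψ, hb, fun c hc => hψ2 hc, rfl⟩
    rwa [map_sub, apply_lam, AlgHom.commutes, Algebra.algebraMap_self, RingHom.id_apply,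
      ← map_sub] at h2

theorem isUnipotent_of_mem_filSubgroup [Algebra.FiniteType k B]
    (hn : ∀ X ∈ n, IsNilpotentElement X) {hAd : ∀ g, ∀ X ∈ n, Ad g X ∈ n} {g : Points k B}
    (hg : g ∈ filSubgroup n hAd) : IsUnipotent g := by
  intro b
  obtain ⟨i, hi⟩ := exists_mem_fil hn b
  refine ⟨i, ?_⟩
  induction i generalizing b with
  | zero => exact hi
  | succ i ih => rw [pow_succ, Module.End.mul_apply]; exact ih _ (hg i b hi)

/-- A reductive group has no nonzero Lie subalgebra stable under the adjoint action that
consists of nilpotent elements. -/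
theorem IsReductive.eq_bot_of_isNilpotentElement [IsAlgClosed k] [CharZero k]
    [Algebra.FiniteType k B] (hG : IsReductive k B) (n : LieSubalgebra k (lieAlgebra k B))
    (hAd : ∀ g, ∀ X ∈ n, Ad g X ∈ n) (hn : ∀ X ∈ n, IsNilpotentElement X) : n = ⊥ := by
  have hbot : filSubgroup n hAd = ⊥ :=
    hG.unipotentRadical_trivial _ (filSubgroup_normal hAd)
      (isClosed_of_forall_mem_iff _ _ mem_filSubgroup_iff)
      (isConnected_of_isUnipotent _ _ mem_filSubgroup_iff
        fun g hg => isUnipotent_of_mem_filSubgroup hn hg)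
      (fun g hg => isUnipotent_of_mem_filSubgroup hn hg)
  let I : Ideal B := Ideal.span (filEquations n)
  have hpt : ∀ φ : B →ₐ[k] k, (∀ a ∈ I, φ a = 0) → φ = Bialgebra.counitAlgHom k B := by
    intro φ hφ
    have h : toConv φ ∈ filSubgroup n hAd :=
      (mem_filSubgroup_iff _).mpr fun a ha => hφ a (Ideal.subset_span ha)
    rw [hbot, Subgroup.mem_bot] at h
    exact toConv_injective h
  have hI : I ≤ RingHom.ker (Bialgebra.counitAlgHom k B) := by
    refine Ideal.span_le.mpr fun a ha => ?_
    exact (mem_filSubgroup_iff (hAd := hAd) 1).mp (Subgroup.one_mem _) a ha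
  have hrad : I.radical ≤ RingHom.ker (Bialgebra.counitAlgHom k B) := by
    rintro a ⟨m, hm⟩
    have := hI hm
    rw [RingHom.mem_ker, map_pow] at this
    exact eq_zero_of_pow_eq_zero this
  -- The subgroup cut out by `I` is trivial, so by the Nullstellensatz the radical of `I` contains
  -- the augmentation ideal.
  have hmax : ∀ a, counit (R := k) a = 0 → a ∈ I.radical := by
    intro a ha
    by_contra hmem
    obtain ⟨φ, hφ1, hφ2⟩ := exists_algHom_of_notMem_radical (k := k) hmem
    rw [hpt φ hφ1] at hφ2
    exact hφ2 ha
  rw [eq_bot_iff]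
  intro X hX
  -- `X` commutes with `lam ψ` and lowers the filtration by one step, so it carries an equation to
  -- an equation one step lower, or to zero at the bottom.
  have hst : ∀ a ∈ I, X.1 a ∈ I := by
    intro a ha
    refine Submodule.span_induction ?_ (by simp) ?_ ?_ ha
    · rintro _ ⟨i, b, ψ, hb, hψ, rfl⟩
      have hXb := mem_fil_succ.mp hb X hX
      have h1 : X.1 (lam ψ b - algebraMap k B (ψ b)) = lam ψ (X.1 b) := by
        rw [map_sub, Derivation.map_algebraMap, sub_zero]
        exact ((leftInvariant_lie X).lam_comp ψ b).symm
      rw [h1]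
      cases i with
      | zero =>
        have : X.1 b = 0 := hXb
        rw [this, map_zero]
        exact I.zero_mem
      | succ i =>
        refine Ideal.subset_span ⟨i, X.1 b, ψ, hXb, fun c hc => hψ c (fil_le_succ i hc), ?_⟩
        rw [hψ _ hXb, map_zero, sub_zero]
    · intro x y _ _ hx hy
      rw [map_add]
      exact I.add_mem hx hy
    · intro c x hx hXx
      rw [smul_eq_mul, Derivation.leibniz]
      exact I.add_mem (I.mul_mem_left _ hXx) (I.mul_mem_right _ hx)
  have hX0 : X = 0 := by
    refine lie_ext fun b => ?_
    -- `X` preserves the radical of `I`, which is the augmentation ideal; therefore `X b` vanishes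
    -- at the identity for every `b`, and a left invariant derivation with this property is zero.
    have h1 := hrad (derivation_mem_radical X.1 hst (hmax (b - algebraMap k B (counit b))
      (by simp)))
    rw [map_sub, Derivation.map_algebraMap, sub_zero] at h1
    refine Eq.trans h1 ?_
    simp
  rw [hX0]
  exact LieSubalgebra.zero_mem _

end NilpotentSubalgebra

end

end AlgebraicGroup

namespace AlgebraicGroup

noncomputable section

/-! ### Traces and double commutators -/

section DoubleCommutator

theorem pow_succ_mul_sub_of_commute {A : Type*} [Ring A] {T S W : A} (hW : W = T * S - S * T)
    (hc : T * W = W * T) (m : ℕ) :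
    T ^ (m + 1) * S = S * T ^ (m + 1) + (m + 1) • (T ^ m * W) := by
  induction m with
  | zero => simp [hW]
  | succ m ih =>
    have hTS : T * S = S * T + W := by rw [hW]; abel
    have hc2 : T ^ (m + 1) * W = W * T ^ (m + 1) := (Commute.pow_left hc (m + 1)).eq
    rw [pow_succ' T (m + 1), mul_assoc, ih, mul_add, ← mul_assoc, hTS, add_mul, mul_smul_comm,
      ← mul_assoc T, ← pow_succ', ← hc2, succ_nsmul _ (m + 1), mul_assoc, ← pow_succ']
    abel

/-- If `T` is nilpotent and commutes with `W = [T, S]`, then `W` is nilpotent. -/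
theorem isNilpotent_of_commute_commutator {k A : Type*} [Field k] [CharZero k] [Ring A]
    [Algebra k A] {T S W : A} (hW : W = T * S - S * T) (hc : T * W = W * T) (hT : IsNilpotent T) :
    IsNilpotent W := by
  -- Since [T^(m+1), S] = (m+1) T^m W, sandwiching between two copies of W^N expresses T^m W^(2N+1)
  -- through T^(m+1) W^N. The power of `T` can thus be lowered to zero.
  have key : ∀ m N : ℕ, T ^ m * W ^ N = 0 → IsNilpotent W := by
    intro m
    induction m with
    | zero => intro N h; exact ⟨N, by simpa using h⟩
    | succ m ih =>
      intro N h
      refine ih (N + (N + 1)) ?_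
      have hcp : W ^ N * T ^ (m + 1) = T ^ (m + 1) * W ^ N := (Commute.pow_pow hc (m + 1) N).eq.symm
      have hcp2 : W ^ N * T ^ m = T ^ m * W ^ N := (Commute.pow_pow hc m N).eq.symm
      have h1 : (m + 1) • (T ^ m * W ^ (N + (N + 1))) =
          W ^ N * (T ^ (m + 1) * S) * W ^ N - W ^ N * (S * (T ^ (m + 1) * W ^ N)) := by
        rw [pow_succ_mul_sub_of_commute hW hc, mul_add, add_mul, mul_smul_comm, smul_mul_assoc,
          ← mul_assoc (W ^ N) (T ^ m) W, hcp2, pow_add, pow_succ']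
        simp only [mul_assoc]
        abel
      rw [h, ← mul_assoc (W ^ N), hcp, h, zero_mul, zero_mul, mul_zero, mul_zero, sub_zero,
        ← Nat.cast_smul_eq_nsmul k] at h1
      exact (smul_eq_zero.mp h1).resolve_left (Nat.cast_ne_zero.mpr m.succ_ne_zero)
  obtain ⟨m, hm⟩ := hT
  exact key m 0 (by rw [hm, zero_mul])

theorem trace_commutator_mul {k V : Type*} [Field k] [AddCommGroup V] [Module k V]
    (x y z : Module.End k V) : LinearMap.trace k V ((x * y - y * x) * z) =
      LinearMap.trace k V (x * (y * z - z * y)) := by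
  rw [sub_mul, mul_sub, map_sub, map_sub, mul_assoc, mul_assoc, LinearMap.trace_mul_comm k y,
    mul_assoc]

/-- If `T` is nilpotent and `[T, [T, S]] = 0` then the trace of `T * S` vanishes. -/
theorem trace_mul_eq_zero_of_commute_commutator {k V : Type*} [Field k] [CharZero k]
    [AddCommGroup V] [Module k V] [FiniteDimensional k V] {T S W : Module.End k V}
    (hW : W = T * S - S * T) (hc : T * W = W * T) (hT : IsNilpotent T) :
    LinearMap.trace k V (T * S) = 0 := by
  obtain ⟨N, hN⟩ := isNilpotent_of_commute_commutator (k := k) hW hc hT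
  -- On the quotient of ker T^(i+1) by ker T^i, embedded by T^i, the product `T * S` acts as `(i +
  -- 1) • W`. As `W` is nilpotent, `T * S` is nilpotent on each quotient, hence on `V`.
  have hstep : ∀ (i : ℕ) (v : V), (T ^ (i + 1)) v = 0 →
      (T ^ i) ((T * S) v) = (i + 1) • W ((T ^ i) v) := by
    intro i v hv
    have h := DFunLike.congr_fun (pow_succ_mul_sub_of_commute hW hc i) v
    rw [(Commute.pow_left hc i).eq] at h
    rw [Module.End.mul_apply, ← Module.End.mul_apply (T ^ i), ← pow_succ, ← Module.End.mul_apply,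
      h, LinearMap.add_apply, Module.End.mul_apply, hv, map_zero, zero_add]
    rfl
  have key : ∀ (i : ℕ) (v : V), (T ^ i) v = 0 → ∃ M, ((T * S) ^ M) v = 0 := by
    intro i
    induction i with
    | zero => intro v hv; exact ⟨0, hv⟩
    | succ i ih =>
      intro v hv
      have hp : ∀ p : ℕ, (T ^ (i + 1)) (((T * S) ^ p) v) = 0 ∧
          ∃ c : ℕ, (T ^ i) (((T * S) ^ p) v) = c • (W ^ p) ((T ^ i) v) := by
        intro p
        induction p with
        | zero => exact ⟨hv, 1, by simp⟩
        | succ p ihp =>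
          obtain ⟨h1, c, h2⟩ := ihp
          have h3 := hstep i _ h1
          rw [← Module.End.mul_apply (T * S), ← pow_succ'] at h3
          refine ⟨?_, (i + 1) * c, ?_⟩
          · have hcW : (W * T ^ (i + 1)) = T ^ (i + 1) * W := (Commute.pow_left hc (i + 1)).eq.symm
            rw [pow_succ', Module.End.mul_apply, h3, map_nsmul, ← Module.End.mul_apply,
              ← Module.End.mul_apply, mul_assoc, ← mul_assoc, hc, mul_assoc, ← pow_succ',
              Module.End.mul_apply, h1, map_zero, smul_zero]
          · rw [h3, h2, map_nsmul, pow_succ', Module.End.mul_apply, smul_smul]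
      obtain ⟨-, c, h⟩ := hp N
      rw [hN, LinearMap.zero_apply, smul_zero] at h
      obtain ⟨M, hM⟩ := ih _ h
      exact ⟨M + N, by rw [pow_add, Module.End.mul_apply, hM]⟩
  have hnil : IsNilpotent (T * S) := by
    rw [Module.End.isNilpotent_iff_of_finite]
    obtain ⟨m, hm⟩ := hT
    exact fun v => key m v (by rw [hm]; rfl)
  exact (LinearMap.isNilpotent_trace_of_isNilpotent hnil).eq_zero

end DoubleCommutator

/-! ### The invariant form of a reductive group -/

section TraceForm

open WithConv Coalgebra Module.End

variable {k B : Type*} [Field k] [CommRing B] [HopfAlgebra k B]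

theorem rho_bialgEquiv (θ : B ≃ₐc[k] B) (ψ : B →ₗ[k] k) (b : B) :
    rho ψ (θ b) = θ (rho (ψ ∘ₗ (θ : B →ₗ[k] B)) b) := by
  refine eq_of_forall_functional (k := k) fun χ => ?_
  rw [functional_rho]
  have h := LinearMap.convMul_comp_coalgHom_distrib (toConv χ) (toConv ψ)
    ((θ : B →ₐc[k] B) : B →ₗc[k] B)
  have h2 := functional_rho (ψ ∘ₗ (θ : B →ₗ[k] B)) (χ ∘ₗ (θ : B →ₗ[k] B)) b
  refine Eq.trans (DFunLike.congr_fun h b) h2.symm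

/-- A finite dimensional subcomodule of `k[G]`, stable under `θ`, that generates `k[G]`. -/
theorem exists_generating_subcomodule [Algebra.FiniteType k B] (θ : B ≃ₐc[k] B)
    (hθ : ∀ a, θ (θ a) = a) : ∃ V : Submodule k B, FiniteDimensional k V ∧
      Algebra.adjoin k (V : Set B) = ⊤ ∧ (∀ (ψ : B →ₗ[k] k), ∀ v ∈ V, rho ψ v ∈ V) ∧
      ∀ v ∈ V, θ v ∈ V := by
  obtain ⟨s, hs⟩ := Algebra.FiniteType.out (R := k) (A := B)
  obtain ⟨V, hV, hsV, hst⟩ := exists_subcomodule (k := k) s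
  refine ⟨V ⊔ V.map (θ : B →ₗ[k] B), inferInstance, ?_, ?_, ?_⟩
  · rw [eq_top_iff, ← hs]
    exact Algebra.adjoin_mono (hsV.trans (SetLike.coe_subset_coe.mpr le_sup_left))
  · intro ψ v hv
    obtain ⟨x, hx, _, ⟨y, hy, rfl⟩, rfl⟩ := Submodule.mem_sup.mp hv
    rw [map_add]
    refine Submodule.add_mem_sup (hst ψ x hx) ?_
    exact ⟨_, hst _ y hy, (rho_bialgEquiv θ ψ y).symm⟩
  · intro v hv
    obtain ⟨x, hx, _, ⟨y, hy, rfl⟩, rfl⟩ := Submodule.mem_sup.mp hv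
    rw [map_add, add_comm]
    refine Submodule.add_mem_sup ?_ ⟨x, hx, rfl⟩
    have : θ (θ y) = y := hθ y
    change θ (θ y) ∈ V
    rwa [this]

theorem lieEnd_mem {V : Submodule k B} (hV : ∀ (ψ : B →ₗ[k] k), ∀ v ∈ V, rho ψ v ∈ V)
    (X : lieAlgebra k B) : ∀ v ∈ V, lieEnd X v ∈ V := by
  intro v hv
  have h : lieEnd X v = rho (counit ∘ₗ (X.1 : B →ₗ[k] B)) v := lie_eq_rho X v
  rw [h]
  exact hV _ v hv

/-- The action of the Lie algebra on a subcomodule of `k[G]`. -/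
def subcomoduleAction (V : Submodule k B) (hV : ∀ (ψ : B →ₗ[k] k), ∀ v ∈ V, rho ψ v ∈ V) :
    lieAlgebra k B →ₗ[k] Module.End k V where
  toFun X := (lieEnd X).restrict (lieEnd_mem hV X)
  map_add' _ _ := rfl
  map_smul' _ _ := rfl

variable {V : Submodule k B} {hV : ∀ (ψ : B →ₗ[k] k), ∀ v ∈ V, rho ψ v ∈ V}

theorem subcomoduleAction_lie (X Y : lieAlgebra k B) : subcomoduleAction V hV ⁅X, Y⁆ =
    subcomoduleAction V hV X * subcomoduleAction V hV Y -
      subcomoduleAction V hV Y * subcomoduleAction V hV X := by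
  ext v
  change (⁅X.1, Y.1⁆ : Derivation k B B) (v : B) = X.1 (Y.1 v) - Y.1 (X.1 v)
  rw [Derivation.commutator_apply]

theorem subcomoduleAction_pow (X : lieAlgebra k B) (m : ℕ) (v : V) :
    (((subcomoduleAction V hV X) ^ m) v : B) = ((lieEnd X) ^ m) (v : B) := by
  induction m generalizing v with
  | zero => rfl
  | succ m ih => rw [pow_succ, pow_succ, Module.End.mul_apply, ih]; rfl

theorem IsNilpotentElement.isNilpotent_subcomoduleAction [FiniteDimensional k V]
    {X : lieAlgebra k B} (hX : IsNilpotentElement X) : IsNilpotent (subcomoduleAction V hV X) := by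
  rw [Module.End.isNilpotent_iff_of_finite]
  intro v
  obtain ⟨m, hm⟩ := hX v
  exact ⟨m, Subtype.ext ((subcomoduleAction_pow X m v).trans hm)⟩

/-- The generalised 0-eigenspace of a derivation is a subalgebra, and here it contains the
generating subspace `V`. -/
theorem isNilpotentElement_of_isNilpotent_subcomoduleAction
    (hgen : Algebra.adjoin k (V : Set B) = ⊤) {X : lieAlgebra k B}
    (hX : IsNilpotent (subcomoduleAction V hV X)) : IsNilpotentElement X := by
  have key : ∀ b : B, b ∈ (lieEnd X).maxGenEigenspace 0 := by
    intro b
    have hb : b ∈ Algebra.adjoin k (V : Set B) := by rw [hgen]; trivial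
    induction hb using Algebra.adjoin_induction with
    | mem a ha =>
      obtain ⟨m, hm⟩ := hX
      rw [mem_maxGenEigenspace]
      refine ⟨m, ?_⟩
      have h := subcomoduleAction_pow (hV := hV) X m ⟨a, ha⟩
      rw [hm] at h
      rw [zero_smul, sub_zero]
      exact h.symm
    | algebraMap r =>
      rw [mem_maxGenEigenspace]
      refine ⟨1, ?_⟩
      rw [zero_smul, sub_zero, pow_one]
      exact X.1.map_algebraMap r
    | add a b _ _ ha hb => exact Submodule.add_mem _ ha hb
    | mul a b _ _ ha hb =>
      have := mul_mem_maxGenEigenspace X.1 ha hb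
      rwa [add_zero] at this
  intro b
  have h := key b
  rw [mem_maxGenEigenspace] at h
  simpa only [zero_smul, sub_zero] using h

/-- The trace form of the action of the Lie algebra on a subcomodule of `k[G]`. -/
def traceForm (V : Submodule k B) (hV : ∀ (ψ : B →ₗ[k] k), ∀ v ∈ V, rho ψ v ∈ V) :
    LinearMap.BilinForm k (lieAlgebra k B) :=
  ((LinearMap.mul k (Module.End k V)).compl₁₂ (subcomoduleAction V hV)
    (subcomoduleAction V hV)).compr₂ (LinearMap.trace k V)

theorem traceForm_apply (X Y : lieAlgebra k B) : traceForm V hV X Y =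
    LinearMap.trace k V (subcomoduleAction V hV X * subcomoduleAction V hV Y) := rfl

theorem traceForm_comm (X Y : lieAlgebra k B) : traceForm V hV X Y = traceForm V hV Y X :=
  LinearMap.trace_mul_comm k _ _

theorem traceForm_lie (X Y Z : lieAlgebra k B) :
    traceForm V hV ⁅X, Y⁆ Z = traceForm V hV X ⁅Y, Z⁆ := by
  rw [traceForm_apply, traceForm_apply, subcomoduleAction_lie, subcomoduleAction_lie]
  exact trace_commutator_mul _ _ _

theorem traceForm_conj {P Q : Module.End k B} (hP : ∀ v ∈ V, P v ∈ V) (hQ : ∀ v ∈ V, Q v ∈ V)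
    (hQP : ∀ b, Q (P b) = b) {X Y X' Y' : lieAlgebra k B} (hX : ∀ b, X'.1 b = P (X.1 (Q b)))
    (hY : ∀ b, Y'.1 b = P (Y.1 (Q b))) : traceForm V hV X' Y' = traceForm V hV X Y := by
  have h1 : subcomoduleAction V hV X' * subcomoduleAction V hV Y' = P.restrict hP *
      (subcomoduleAction V hV X * subcomoduleAction V hV Y * Q.restrict hQ) := by
    ext v
    change X'.1 (Y'.1 v) = P (X.1 (Y.1 (Q v)))
    rw [hX, hY, hQP]
  have h2 : Q.restrict hQ * P.restrict hP = 1 := by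
    ext v
    exact hQP v
  rw [traceForm_apply, h1, LinearMap.trace_mul_comm, mul_assoc, h2, mul_one, traceForm_apply]

theorem rightTranslation_mem (hV : ∀ (ψ : B →ₗ[k] k), ∀ v ∈ V, rho ψ v ∈ V) (g : Points k B) :
    ∀ v ∈ V, (rightTranslation g).toLinearMap v ∈ V := by
  intro v hv
  rw [AlgHom.toLinearMap_apply, rightTranslation_eq_rho]
  exact hV _ v hv

theorem traceForm_Ad (g : Points k B) (X Y : lieAlgebra k B) :
    traceForm V hV (Ad g X) (Ad g Y) = traceForm V hV X Y := by
  refine traceForm_conj (rightTranslation_mem hV g) (rightTranslation_mem hV g⁻¹) (fun b => ?_)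
    (fun b => Ad_apply g X b) (fun b => Ad_apply g Y b)
  change rightTranslation g⁻¹ (rightTranslation g b) = b
  rw [← rightTranslation_mul, inv_mul_cancel, rightTranslation_one]

theorem Ad_Ad_inv (g : Points k B) (X : lieAlgebra k B) : Ad g (Ad g⁻¹ X) = X := by
  ext b
  rw [Ad_apply, Ad_apply, inv_inv, ← rightTranslation_mul, ← rightTranslation_mul, mul_inv_cancel,
    rightTranslation_one, rightTranslation_one]

/-- The replicas of `X` belong to the Lie algebra, so `X` is orthogonal to them and
`isNilpotent_of_trace_replica` applies to its action on `V`. -/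
theorem isNilpotentElement_of_traceForm [IsAlgClosed k] [CharZero k] [FiniteDimensional k V]
    (hgen : Algebra.adjoin k (V : Set B) = ⊤) {X : lieAlgebra k B}
    (hX : ∀ Y, traceForm V hV X Y = 0) : IsNilpotentElement X := by
  refine isNilpotentElement_of_isNilpotent_subcomoduleAction (hV := hV) hgen
    (isNilpotent_of_trace_replica _ fun φ => ?_)
  obtain ⟨Y, hY⟩ := exists_replica X
    (((Rat.castHom k : ℚ →+* k) : ℚ →+ k).comp (φ : k →+ ℚ))
  refine ⟨subcomoduleAction V hV Y, fun μ v hv => Subtype.ext ?_, hX Y⟩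
  have h : (v : B) ∈ (lieEnd X).maxGenEigenspace μ := by
    have hv' : v ∈ genEigenspace ((lieEnd X).restrict (lieEnd_mem hV X)) μ ⊤ := hv
    rwa [genEigenspace_restrict] at hv'
  exact hY μ v h

/-- The trace form of a generating subcomodule is nondegenerate if the group is reductive. -/
theorem IsReductive.eq_zero_of_traceForm [IsAlgClosed k] [CharZero k] [Algebra.FiniteType k B]
    [FiniteDimensional k V] (hG : IsReductive k B) (hgen : Algebra.adjoin k (V : Set B) = ⊤)
    {X : lieAlgebra k B} (hX : ∀ Y, traceForm V hV X Y = 0) : X = 0 := by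
  -- The radical of the form: Ad-stable by invariance of the form, and made of nilpotent elements.
  let n : LieSubalgebra k (lieAlgebra k B) :=
    { carrier := {X | ∀ Y, traceForm V hV X Y = 0}
      add_mem' := fun {X X'} hX hX' Y => by rw [map_add, LinearMap.add_apply, hX, hX', add_zero]
      zero_mem' := fun Y => by rw [map_zero, LinearMap.zero_apply]
      smul_mem' := fun c X hX Y => by rw [map_smul, LinearMap.smul_apply, hX, smul_zero]
      lie_mem' := fun {X X'} hX _ Y => by rw [traceForm_lie]; exact hX _ }
  have hn : n = ⊥ := by
    refine hG.eq_bot_of_isNilpotentElement n (fun g X hX Y => ?_)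
      (fun X hX => isNilpotentElement_of_traceForm hgen hX)
    rw [← Ad_Ad_inv g Y, traceForm_Ad]
    exact hX _
  have : X ∈ n := hX
  rwa [hn, LieSubalgebra.mem_bot] at this

/-- The Lie algebra of a reductive group with an involution has a nondegenerate invariant
symmetric bilinear form, for which a nilpotent element `X` is orthogonal to the kernel of
`(ad X) ^ 2`. -/
theorem IsReductive.exists_bilinForm [IsAlgClosed k] [CharZero k] [Algebra.FiniteType k B]
    (hG : IsReductive k B) (θ : B ≃ₐc[k] B) (hθ : ∀ a, θ (θ a) = a) :
    ∃ β : LinearMap.BilinForm k (lieAlgebra k B), (∀ X, (∀ Y, β X Y = 0) → X = 0) ∧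
      (∀ X Y, β X Y = β Y X) ∧ (∀ X Y Z, β ⁅X, Y⁆ Z = β X ⁅Y, Z⁆) ∧
      (∀ X Y, β (differential θ X) (differential θ Y) = β X Y) ∧
      ∀ X Z, IsNilpotentElement X → ⁅X, ⁅X, Z⁆⁆ = 0 → β X Z = 0 := by
  obtain ⟨V, hVfd, hgen, hV, hVθ⟩ := exists_generating_subcomodule θ hθ
  have hsymm : ∀ b, θ.symm b = θ b := fun b => by
    rw [← hθ (θ.symm b), BialgEquiv.apply_symm_apply]
  refine ⟨traceForm V hV, fun X hX => hG.eq_zero_of_traceForm hgen hX, traceForm_comm,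
    traceForm_lie, fun X Y => ?_, fun X Z hX hZ => ?_⟩
  · refine traceForm_conj (P := (θ : B →ₗ[k] B)) (Q := (θ : B →ₗ[k] B)) hVθ hVθ hθ
      (fun b => ?_) (fun b => ?_)
    · rw [differential_apply, hsymm]; rfl
    · rw [differential_apply, hsymm]; rfl
  · refine trace_mul_eq_zero_of_commute_commutator (W := subcomoduleAction V hV ⁅X, Z⁆)
      (subcomoduleAction_lie X Z) ?_ hX.isNilpotent_subcomoduleAction
    rw [← sub_eq_zero, ← subcomoduleAction_lie, hZ, map_zero]

end TraceForm

end

end AlgebraicGroup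

namespace AlgebraicGroup

noncomputable section

/-! ### Jacobson–Morozov with an involution, and ranks of ad -/

section Morozov

variable {k L : Type*} [Field k] [LieRing L] [LieAlgebra k L]

/-- If `β` is a nondegenerate invariant form and `e` is orthogonal to the kernel of `(ad e) ^ 2`,
then `e` belongs to the image of `(ad e) ^ 2`. -/
theorem exists_eq_lie_lie [FiniteDimensional k L] (β : LinearMap.BilinForm k L) (hnd : ∀ x, (∀ y, β x y = 0) → x = 0)
    (hsymm : ∀ x y, β x y = β y x) (hinv : ∀ x y z, β ⁅x, y⁆ z = β x ⁅y, z⁆) (e : L)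
    (he : ∀ z, ⁅e, ⁅e, z⁆⁆ = 0 → β e z = 0) : ∃ z, e = ⁅e, ⁅e, z⁆⁆ := by
  by_contra hcon
  have hmem : e ∉ LinearMap.range (LieAlgebra.ad k L e * LieAlgebra.ad k L e) := by
    rintro ⟨z, hz⟩
    exact hcon ⟨z, hz.symm⟩
  obtain ⟨φ, hφ1, hφ2⟩ := Submodule.exists_le_ker_of_notMem hmem
  have hinj : Function.Injective β := by
    rw [← LinearMap.ker_eq_bot, LinearMap.ker_eq_bot']
    exact fun x hx => hnd x fun y => by rw [hx]; rfl
  -- Represent as β(z, ·) a form that kills the image of (ad e)^2 but not `e`. By invariance z lies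
  -- in the kernel of (ad e)^2, so the hypothesis gives β(e, z) = 0, a contradiction.
  obtain ⟨z, rfl⟩ := (LinearMap.injective_iff_surjective_of_finrank_eq_finrank
    (Subspace.dual_finrank_eq (K := k) (V := L)).symm).mp hinj φ
  refine hφ1 ?_
  rw [hsymm]
  refine he z (hnd _ fun y => ?_)
  have h1 : β z ⁅e, ⁅e, y⁆⁆ = 0 := hφ2 ⟨y, rfl⟩
  rw [← lie_skew, map_neg, LinearMap.neg_apply, hinv, ← lie_skew, map_neg, LinearMap.neg_apply,
    hinv, h1, neg_zero, neg_zero]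

theorem ad_lie (x y : L) : LieAlgebra.ad k L ⁅x, y⁆ =
    LieAlgebra.ad k L x * LieAlgebra.ad k L y - LieAlgebra.ad k L y * LieAlgebra.ad k L x := by
  ext z
  exact lie_lie x y z

theorem finrank_range_ad_equiv (φ : L ≃ₗ⁅k⁆ L) (x : L) :
    Module.finrank k (LinearMap.range (LieAlgebra.ad k L (φ x))) =
      Module.finrank k (LinearMap.range (LieAlgebra.ad k L x)) := by
  have h : LieAlgebra.ad k L (φ x) ∘ₗ φ.toLinearEquiv.toLinearMap =
      φ.toLinearEquiv.toLinearMap ∘ₗ LieAlgebra.ad k L x := by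
    ext y
    exact (LieHom.map_lie (φ : L →ₗ⁅k⁆ L) x y).symm
  rw [← LinearMap.range_comp_of_range_eq_top (LieAlgebra.ad k L (φ x))
    (LinearEquiv.range φ.toLinearEquiv), h, LinearMap.range_comp]
  exact LinearEquiv.finrank_map_eq φ.toLinearEquiv _

/-- Endomorphisms which are adjoint up to sign for a nondegenerate form have the same rank. -/
theorem finrank_range_eq_of_adjoint {V : Type*} [AddCommGroup V] [Module k V]
    [FiniteDimensional k V] (β : LinearMap.BilinForm k V) (hnd : ∀ x, (∀ y, β x y = 0) → x = 0)
    {T T' : Module.End k V} (hT : ∀ x y, β (T x) y = -β x (T' y)) :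
    Module.finrank k (LinearMap.range T) = Module.finrank k (LinearMap.range T') := by
  have hinj : Function.Injective β := by
    rw [← LinearMap.ker_eq_bot, LinearMap.ker_eq_bot']
    exact fun x hx => hnd x fun y => by rw [hx]; rfl
  have hsurj : Function.Surjective β := (LinearMap.injective_iff_surjective_of_finrank_eq_finrank
    (Subspace.dual_finrank_eq (K := k) (V := V)).symm).mp hinj
  have h : LinearMap.dualMap T' ∘ₗ β = -(β ∘ₗ T) := by
    ext x y
    have := hT x y
    simp [this]
  rw [← LinearMap.finrank_range_dualMap_eq_finrank_range T',
    ← LinearMap.range_comp_of_range_eq_top _ (LinearMap.range_eq_top.mpr hsurj), h,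
    LinearMap.range_neg, LinearMap.range_comp]
  exact (LinearEquiv.finrank_map_eq (LinearEquiv.ofBijective β ⟨hinj, hsurj⟩) _).symm

variable [CharZero k]

/-- The exponential of a nilpotent inner derivation is an automorphism; on vectors killed by (ad
x)^3 its series stops after three terms. -/
theorem exists_exp_ad {x : L} (hx : IsNilpotent (LieAlgebra.ad k L x)) :
    ∃ φ : L ≃ₗ⁅k⁆ L, ∀ y, ⁅x, ⁅x, ⁅x, y⁆⁆⁆ = 0 →
      φ y = y + ⁅x, y⁆ + (2 : k)⁻¹ • ⁅x, ⁅x, y⁆⁆ := by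
  let _ : Module ℚ L := Module.compHom L (algebraMap ℚ k)
  let _ : LieAlgebra ℚ L := { lie_smul := fun t x y => lie_smul (algebraMap ℚ k t) x y }
  have hq : ∀ (q : ℚ) (x : L), q • x = (q : k) • x := fun q x => rfl
  have had : (LieDerivation.ad k L x).toLinearMap = LieAlgebra.ad k L x := by
    ext y
    simp
  refine ⟨LieDerivation.exp (LieDerivation.ad k L x) (by rwa [had]), fun y hy => ?_⟩
  rw [LieDerivation.exp_map_apply, had]
  have h3 : ((LieAlgebra.ad k L x) ^ 3) • y = 0 := hy
  refine (IsNilpotent.exp_smul_eq_sum h3 hx).trans ?_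
  simp [Finset.sum_range_succ, hq, pow_succ]

/-- An endomorphism `E` of a finite dimensional space with `[H, E] = c E`, `c ≠ 0`, is
nilpotent. -/
theorem isNilpotent_of_commutator_eq_smul {V : Type*} [AddCommGroup V] [Module k V]
    [FiniteDimensional k V] {H E : Module.End k V} {c : k} (hc : c ≠ 0)
    (h : H * E - E * H = c • E) : IsNilpotent E := by
  -- The powers of `E` are eigenvectors of the commutator with `H`, with distinct eigenvalues nc.
  -- Only finitely many eigenvalues occur, so some power vanishes.
  have hpow : ∀ n : ℕ, H * E ^ n - E ^ n * H = ((n : k) * c) • E ^ n := by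
    intro n
    induction n with
    | zero => simp
    | succ n ih =>
      have h1 : H * E ^ (n + 1) - E ^ (n + 1) * H =
          (H * E ^ n - E ^ n * H) * E + E ^ n * (H * E - E * H) := by
        rw [pow_succ]; noncomm_ring
      rw [h1, ih, h, mul_smul_comm, smul_mul_assoc, ← pow_succ, ← add_smul, Nat.cast_succ]
      congr 1
      ring
  by_contra hE
  let D : Module.End k (Module.End k V) := LinearMap.mulLeft k H - LinearMap.mulRight k H
  have hev : ∀ n : ℕ, D.HasEigenvalue ((n : k) * c) := by
    intro n
    refine Module.End.hasEigenvalue_of_hasEigenvector (x := E ^ n) ⟨?_, fun h0 => hE ⟨n, h0⟩⟩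
    rw [Module.End.mem_eigenspace_iff]
    exact hpow n
  refine Set.infinite_of_injective_forall_mem (f := fun n : ℕ => (n : k) * c) ?_ hev
    (Module.End.finite_hasEigenvalue D)
  intro m n hmn
  exact Nat.cast_injective (R := k) (mul_right_cancel₀ hc hmn)

variable [FiniteDimensional k L]

theorem isNilpotent_ad_of_lie_eq_smul {h e : L} {c : k} (hc : c ≠ 0) (he : ⁅h, e⁆ = c • e) :
    IsNilpotent (LieAlgebra.ad k L e) := by
  refine isNilpotent_of_commutator_eq_smul (H := LieAlgebra.ad k L h) hc ?_
  rw [← ad_lie, he, map_smul]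

/-- On the kernel of `ad e` the eigenvalue `-2` of `ad h` does not occur. -/
theorem eq_zero_of_lie_eq_zero {h e f x : L} (hhe : ⁅h, e⁆ = (2 : k) • e) (hef : ⁅e, f⁆ = h)
    (hex : ⁅e, x⁆ = 0) (hhx : ⁅h, x⁆ = -((2 : k) • x)) : x = 0 := by
  set E : Module.End k L := LieAlgebra.ad k L e with hE
  set H : Module.End k L := LieAlgebra.ad k L h with hH
  set F : Module.End k L := LieAlgebra.ad k L f with hF
  have hHE : H * E = E * H + (2 : k) • E := by
    have h1 := ad_lie (k := k) h e
    rw [hhe, map_smul] at h1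
    rw [hE, h1, hH]
    abel
  have hEF : E * F = F * E + H := by
    have h1 := ad_lie (k := k) e f
    rw [hef] at h1
    rw [hH, h1, hE, hF]
    abel
  have hHEi : ∀ i : ℕ, E ^ i * H = H * E ^ i - ((2 : k) * i) • E ^ i := by
    intro i
    induction i with
    | zero => simp
    | succ i ih =>
      rw [pow_succ', mul_assoc, ih, mul_sub, mul_smul_comm, ← mul_assoc E H,
        eq_sub_of_add_eq hHE.symm, sub_mul, smul_mul_assoc, ← pow_succ', mul_assoc, ← pow_succ',
        sub_sub, ← add_smul, Nat.cast_succ]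
      congr 2
      ring
  have hEiF : ∀ i : ℕ, E ^ (i + 1) * F = F * E ^ (i + 1) +
      ((i : k) + 1) • (H * E ^ i - (i : k) • E ^ i) := by
    intro i
    induction i with
    | zero => simp [hEF]
    | succ i ih =>
      have h2 : E * (H * E ^ i - (i : k) • E ^ i) = H * E ^ (i + 1) - ((i : k) + 2) • E ^ (i + 1) := by
        rw [mul_sub, mul_smul_comm, ← mul_assoc, eq_sub_of_add_eq hHE.symm, sub_mul,
          smul_mul_assoc, mul_assoc, ← pow_succ', sub_sub, ← add_smul, add_comm (2 : k)]
      rw [pow_succ', mul_assoc, ih, mul_add, ← mul_assoc, hEF, add_mul, mul_assoc, ← pow_succ',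
        mul_smul_comm, h2, Nat.cast_succ, add_assoc]
      congr 1
      module
  obtain ⟨N, hN⟩ : IsNilpotent E := isNilpotent_ad_of_lie_eq_smul two_ne_zero hhe
  -- If x = E^i y, then `hEiF` gives E^(i+1) F y = -(i+1)(i+2) x, with nonzero coefficient. So `x`
  -- lies in the image of every power of the nilpotent `E`.
  have key : ∀ i : ℕ, ∃ y, (E ^ i) y = x := by
    intro i
    induction i with
    | zero => exact ⟨x, rfl⟩
    | succ i ih =>
      obtain ⟨y, hy⟩ := ih
      have h1 := DFunLike.congr_fun (hEiF i) y
      have hEx : E x = 0 := hex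
      have hHx : H x = -((2 : k) • x) := hhx
      rw [LinearMap.add_apply, LinearMap.smul_apply, LinearMap.sub_apply, LinearMap.smul_apply,
        Module.End.mul_apply, Module.End.mul_apply, Module.End.mul_apply, pow_succ',
        Module.End.mul_apply E (E ^ i) y, hy, hEx, map_zero, zero_add, hHx] at h1
      have h3 : (-(((i : k) + 1) * (i + 2))) • x = (E ^ (i + 1)) (F y) := by
        rw [pow_succ', h1]
        module
      have h4 : (-(((i : k) + 1) * (i + 2))) ≠ 0 := by
        rw [neg_ne_zero]
        exact mul_ne_zero (by exact_mod_cast i.succ_ne_zero) (by exact_mod_cast (by omega : i + 2 ≠ 0))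
      refine ⟨(-(((i : k) + 1) * (i + 2)))⁻¹ • F y, ?_⟩
      rw [map_smul, ← h3, smul_smul, inv_mul_cancel₀ h4, one_smul]
  obtain ⟨y, hy⟩ := key N
  rw [← hy, hN, LinearMap.zero_apply]

/-- A graded version of the theorem of Jacobson and Morozov: if `e` is in the image of `(ad e) ^ 2`
and in the `(-1)`-eigenspace of an involution `σ`, there is an `sl₂`-triple adapted to `σ`. -/
theorem exists_isSl2Triple {σ : L →ₗ[k] L} (hσ : ∀ x, σ (σ x) = x)
    (hσl : ∀ x y, σ ⁅x, y⁆ = ⁅σ x, σ y⁆) {e : L} (he0 : e ≠ 0) (hσe : σ e = -e)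
    (hz : ∃ z, e = ⁅e, ⁅e, z⁆⁆) :
    ∃ f h, IsSl2Triple h e f ∧ σ f = -f ∧ σ h = h := by
  obtain ⟨z, hz⟩ := hz
  -- This is -2 times the (-1)-component of `z`, normalised so that [e,[e,f']] = -2e, that is [h,e]
  -- = 2e.
  let f' : L := σ z - z
  let h : L := ⁅e, f'⁆
  have hσf' : σ f' = -f' := by rw [map_sub, hσ, neg_sub]
  have hσh : σ h = h := by rw [hσl, hσe, hσf', lie_neg, neg_lie, neg_neg]
  have hσz : ⁅e, ⁅e, σ z⁆⁆ = -e := by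
    have := congrArg σ hz
    rw [hσl, hσl, hσe, neg_lie, neg_lie, lie_neg, neg_neg] at this
    exact this.symm
  have hhe : ⁅h, e⁆ = (2 : k) • e := by
    rw [← lie_skew, show ⁅e, h⁆ = ⁅e, ⁅e, σ z - z⁆⁆ from rfl, lie_sub, lie_sub, hσz, ← hz, two_smul]
    abel
  have heh : ⁅e, h⁆ = -((2 : k) • e) := by rw [← lie_skew, hhe]
  -- The room for correcting `f'`: subtracting an element of `S` changes neither [e, f'] nor the
  -- σ-eigenvalue. The failure `T f'` of [h, f'] = -2f' lies in `S`, where `T` is bijective, so a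
  -- unique correction works.
  let S : Submodule k L :=
    { carrier := {x | ⁅e, x⁆ = 0 ∧ σ x = -x}
      add_mem' := fun {x y} hx hy => ⟨by rw [lie_add, hx.1, hy.1, add_zero],
        by rw [map_add, hx.2, hy.2, neg_add]⟩
      zero_mem' := ⟨lie_zero e, by rw [map_zero, neg_zero]⟩
      smul_mem' := fun c x hx => ⟨by rw [lie_smul, hx.1, smul_zero],
        by rw [map_smul, hx.2, smul_neg]⟩ }
  let T : Module.End k L := LieAlgebra.ad k L h + (2 : k) • 1
  have hTapp : ∀ x, T x = ⁅h, x⁆ + (2 : k) • x := fun x => rfl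
  have hTS : ∀ x ∈ S, T x ∈ S := by
    rintro x ⟨hx1, hx2⟩
    constructor
    · rw [hTapp, lie_add, leibniz_lie, heh, neg_lie, smul_lie, lie_smul, hx1, lie_zero, smul_zero,
        neg_zero, add_zero, add_zero]
    · rw [hTapp, map_add, hσl, hσh, map_smul, hx2, lie_neg, smul_neg, neg_add]
  have hinj : Function.Injective (T.restrict hTS) := by
    rw [← LinearMap.ker_eq_bot, LinearMap.ker_eq_bot']
    rintro ⟨x, hx⟩ hTx
    have h1 : T x = 0 := congrArg Subtype.val hTx
    rw [hTapp, add_eq_zero_iff_eq_neg] at h1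
    exact Subtype.ext (eq_zero_of_lie_eq_zero (k := k) hhe rfl hx.1 h1)
  have hu : T f' ∈ S := by
    constructor
    · have h2 : ⁅e, f'⁆ = h := rfl
      rw [hTapp, lie_add, leibniz_lie, heh, neg_lie, smul_lie, lie_smul, h2, lie_self, add_zero,
        neg_add_cancel]
    · rw [hTapp, map_add, hσl, hσh, map_smul, hσf', lie_neg, smul_neg, neg_add]
  obtain ⟨⟨c, hc⟩, hTc⟩ := LinearMap.injective_iff_surjective.mp hinj ⟨T f', hu⟩
  have hTc' : T c = T f' := congrArg Subtype.val hTc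
  refine ⟨f' - c, h, ⟨?_, ?_, ?_, ?_⟩, ?_, hσh⟩
  · intro h0
    rw [h0, zero_lie] at hhe
    exact he0 ((smul_eq_zero.mp hhe.symm).resolve_left two_ne_zero)
  · rw [lie_sub, hc.1, sub_zero]
  · rw [hhe, ofNat_smul_eq_nsmul]
  · have h3 : T (f' - c) = 0 := by rw [map_sub, hTc', sub_self]
    rw [hTapp, add_eq_zero_iff_eq_neg, ofNat_smul_eq_nsmul] at h3
    exact h3
  · rw [map_sub, hσf', hc.2]
    abel

/-- For an `sl₂`-triple, `ad e` and `ad f` have the same rank. -/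
theorem finrank_range_ad_eq {h e f : L} (hef : ⁅e, f⁆ = h) (hhe : ⁅h, e⁆ = (2 : k) • e)
    (hhf : ⁅h, f⁆ = -((2 : k) • f)) :
    Module.finrank k (LinearMap.range (LieAlgebra.ad k L e)) =
      Module.finrank k (LinearMap.range (LieAlgebra.ad k L f)) := by
  have hE : IsNilpotent (LieAlgebra.ad k L e) := isNilpotent_ad_of_lie_eq_smul two_ne_zero hhe
  have hF : IsNilpotent (LieAlgebra.ad k L (-f)) :=
    isNilpotent_ad_of_lie_eq_smul (neg_ne_zero.mpr two_ne_zero) (by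
      rw [lie_neg, hhf, neg_smul, smul_neg])
  obtain ⟨φ, hφ⟩ := exists_exp_ad hE
  obtain ⟨ψ, hψ⟩ := exists_exp_ad hF
  have heh : ⁅e, h⁆ = -((2 : k) • e) := by rw [← lie_skew, hhe]
  have hfe : ⁅f, e⁆ = -h := by rw [← lie_skew, hef]
  have hfh : ⁅f, h⁆ = (2 : k) • f := by rw [← lie_skew, hhf, neg_neg]
  -- The exponential of ad(-f) followed by that of ad(e) acts as a Weyl reflection on the triple and
  -- sends `e` to `-f`.
  have h1 : ψ e = e + h - f := by
    rw [hψ e (by simp [hfe, hfh])]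
    simp only [neg_lie, hfe, hfh, neg_neg, smul_neg, smul_smul]
    norm_num
    abel
  have h2 : φ (ψ e) = -f := by
    rw [h1, hφ _ (by simp [hef, heh])]
    simp only [lie_add, lie_sub, lie_self, hef, heh, lie_neg, lie_smul, lie_zero, smul_zero, neg_zero]
    module
  have h3 := finrank_range_ad_equiv (k := k) φ (ψ e)
  rw [h2, finrank_range_ad_equiv, map_neg, LinearMap.range_neg] at h3
  exact h3.symm

/-- For `x` in the `(-1)`-eigenspace of an involution `σ`, preserving a nondegenerate invariant
form, `ad x` has the same rank on both eigenspaces of `σ`. -/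
theorem two_mul_finrank_map_ad (β : LinearMap.BilinForm k L)
    (hnd : ∀ x, (∀ y, β x y = 0) → x = 0) (hinv : ∀ x y z, β ⁅x, y⁆ z = β x ⁅y, z⁆)
    {σ : Module.End k L} (hσ : ∀ x, σ (σ x) = x) (hσl : ∀ x y, σ ⁅x, y⁆ = ⁅σ x, σ y⁆)
    (hσβ : ∀ x y, β (σ x) (σ y) = β x y) {x : L} (hx : σ x = -x) :
    2 * Module.finrank k ((σ.eigenspace 1).map (LieAlgebra.ad k L x)) =
      Module.finrank k (LinearMap.range (LieAlgebra.ad k L x)) := by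
  let p : Module.End k L := (2 : k)⁻¹ • (1 + σ)
  let q : Module.End k L := (2 : k)⁻¹ • (1 - σ)
  have hpapp : ∀ y, p y = (2 : k)⁻¹ • (y + σ y) := fun y => rfl
  have hqapp : ∀ y, q y = (2 : k)⁻¹ • (y - σ y) := fun y => rfl
  have hpq : ∀ y, p y + q y = y := by
    intro y
    rw [hpapp, hqapp, ← smul_add, add_add_sub_cancel, ← two_smul k y, smul_smul,
      inv_mul_cancel₀ two_ne_zero, one_smul]
  have hσp : ∀ y, σ (p y) = p y := fun y => by rw [hpapp, map_smul, map_add, hσ, add_comm]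
  have hσq : ∀ y, σ (q y) = -q y := fun y => by
    rw [hqapp, map_smul, map_sub, hσ, ← smul_neg, neg_sub]
  have hσx : ∀ y, σ ⁅x, y⁆ = -⁅x, σ y⁆ := fun y => by rw [hσl, hx, neg_lie]
  let T : Module.End k L := LieAlgebra.ad k L x * p
  let T' : Module.End k L := LieAlgebra.ad k L x * q
  have hTapp : ∀ y, T y = ⁅x, p y⁆ := fun y => rfl
  have hT'app : ∀ y, T' y = ⁅x, q y⁆ := fun y => rfl
  -- Adjunction exchanges the projections `p` and `q` because `ad x` is skew for β and anticommutes
  -- with `σ`. The ranges of `T` and `T'` have equal dimension, lie in opposite eigenspaces, and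
  -- span the range of `ad x`.
  have hadj : ∀ y z, β (T y) z = -β y (T' z) := by
    intro y z
    have h1 : ∀ y z, β ⁅x, y⁆ z = -β y ⁅x, z⁆ := fun y z => by
      rw [← lie_skew, map_neg, LinearMap.neg_apply, hinv]
    have h2 : ∀ y z, β (σ y) z = β y (σ z) := fun y z => by rw [← hσβ (σ y) z, hσ]
    rw [hTapp, hT'app, h1, hpapp, hqapp, map_smul, LinearMap.smul_apply, map_add,
      LinearMap.add_apply, h2, hσx, lie_smul, lie_sub, map_smul, map_sub, map_neg]
    rw [sub_eq_add_neg]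
  have hmap : (σ.eigenspace 1).map (LieAlgebra.ad k L x) = LinearMap.range T := by
    refine le_antisymm ?_ ?_
    · rintro _ ⟨y, hy, rfl⟩
      have hy : σ y = y := by
        have := Module.End.mem_eigenspace_iff.mp hy
        rwa [one_smul] at this
      refine ⟨y, ?_⟩
      have : q y = 0 := by rw [hqapp, hy, sub_self, smul_zero]
      have h2 := hpq y
      rw [this, add_zero] at h2
      rw [hTapp, h2]
      rfl
    · rintro _ ⟨y, rfl⟩
      exact ⟨p y, Module.End.mem_eigenspace_iff.mpr (by rw [hσp, one_smul]), rfl⟩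
  have hsup : LinearMap.range T ⊔ LinearMap.range T' = LinearMap.range (LieAlgebra.ad k L x) := by
    refine le_antisymm (sup_le ?_ ?_) ?_
    · rintro _ ⟨y, rfl⟩
      exact ⟨p y, rfl⟩
    · rintro _ ⟨y, rfl⟩
      exact ⟨q y, rfl⟩
    · rintro _ ⟨y, rfl⟩
      refine Submodule.mem_sup.mpr ⟨T y, ⟨y, rfl⟩, T' y, ⟨y, rfl⟩, ?_⟩
      rw [hTapp, hT'app, ← lie_add, hpq]
      rfl
  have hinf : LinearMap.range T ⊓ LinearMap.range T' = ⊥ := by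
    rw [eq_bot_iff]
    rintro z ⟨⟨y, rfl⟩, ⟨y', hy'⟩⟩
    have h1 : σ (T y) = -T y := by rw [hTapp, hσx, hσp]
    have h2 : σ (T y) = T y := by rw [← hy', hT'app, hσx, hσq, lie_neg, neg_neg]
    rw [h1] at h2
    have h3 : (2 : k) • T y = 0 := by
      rw [two_smul]
      nth_rewrite 1 [← h2]
      exact neg_add_cancel _
    exact (smul_eq_zero.mp h3).resolve_left two_ne_zero
  have hrank := Submodule.finrank_sup_add_finrank_inf_eq (LinearMap.range T) (LinearMap.range T')
  rw [hsup, hinf, finrank_bot, add_zero, ← finrank_range_eq_of_adjoint β hnd hadj] at hrank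
  rw [hrank, hmap, two_mul]

end Morozov

end

end AlgebraicGroup

namespace AlgebraicGroup

noncomputable section

/-! ### Equality of the two orbit dimensions -/

section Involution

variable {k B : Type*} [Field k] [CommRing B] [HopfAlgebra k B]

theorem differential_differential {θ : B ≃ₐc[k] B} (hθ : ∀ a, θ (θ a) = a) (X : lieAlgebra k B) :
    differential θ (differential θ X) = X := by
  ext b
  rw [differential_apply, differential_apply, hθ, ← (EquivLike.injective θ).eq_iff,
    BialgEquiv.apply_symm_apply, ← (EquivLike.injective θ).eq_iff, BialgEquiv.apply_symm_apply, hθ]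

theorem differential_lie (θ : B ≃ₐc[k] B) (X Y : lieAlgebra k B) :
    differential θ ⁅X, Y⁆ = ⁅differential θ X, differential θ Y⁆ := by
  ext b
  change θ.symm ((⁅X.1, Y.1⁆ : Derivation k B B) (θ b)) =
    (⁅(differential θ X).1, (differential θ Y).1⁆ : Derivation k B B) b
  rw [Derivation.commutator_apply, Derivation.commutator_apply]
  simp only [differential_apply, BialgEquiv.apply_symm_apply, map_sub]

theorem mem_eigenMinus_iff_differential {θ : B ≃ₐc[k] B} {X : lieAlgebra k B} :
    X ∈ eigenMinus θ ↔ differential θ X = -X := by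
  rw [eigenMinus, Module.End.mem_eigenspace_iff, neg_smul, one_smul]

theorem mem_eigenPlus_iff_differential {θ : B ≃ₐc[k] B} {X : lieAlgebra k B} :
    X ∈ eigenPlus θ ↔ differential θ X = X := by
  rw [eigenPlus, Module.End.mem_eigenspace_iff, one_smul]

/-- The orbits of the nilpotent elements of an `sl₂`-triple adapted to `θ` have the same
dimension. -/
theorem IsReductive.zariskiDim_orbit_eq [IsAlgClosed k] [CharZero k] [Algebra.FiniteType k B]
    (hG : IsReductive k B) (θ : B ≃ₐc[k] B) (hθ : ∀ a, θ (θ a) = a) {h e f : lieAlgebra k B}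
    (hef : ⁅e, f⁆ = h) (hhe : ⁅h, e⁆ = (2 : k) • e) (hhf : ⁅h, f⁆ = -((2 : k) • f))
    (he : e ∈ eigenMinus θ) (hf : f ∈ eigenMinus θ) :
    zariskiDim (k := k) (orbit θ e) = zariskiDim (k := k) (orbit θ f) := by
  have hfd : FiniteDimensional k (lieAlgebra k B) := finiteDimensional_lieAlgebra
  obtain ⟨β, hnd, -, hinv, hβθ, -⟩ := hG.exists_bilinForm θ hθ
  have hrank : ∀ X ∈ eigenMinus θ,
      2 * Module.finrank k ((eigenPlus θ).map (LieAlgebra.ad k (lieAlgebra k B) X)) =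
      Module.finrank k (LinearMap.range (LieAlgebra.ad k (lieAlgebra k B) X)) :=
    fun X hX => two_mul_finrank_map_ad β hnd hinv (differential_differential hθ)
      (differential_lie θ) hβθ (mem_eigenMinus_iff_differential.mp hX)
  have hr := finrank_range_ad_eq hef hhe hhf
  rw [← hrank e he, ← hrank f hf] at hr
  rw [zariskiDim_orbit, zariskiDim_orbit, Nat.eq_of_mul_eq_mul_left two_pos hr]

end Involution

/-! ### Base change and descent -/

section BaseChange

open WithConv Coalgebra

variable {F A K : Type*} [Field F] [CommRing A] [HopfAlgebra F A] [Field K] [Algebra F K]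

theorem lieBaseChange_tmul (X : lieAlgebra F A) (r : K) (a : A) :
    (lieBaseChange K X).1 (r ⊗ₜ a) = r ⊗ₜ X.1 a := LinearMap.baseChange_tmul _ _ _

theorem autBaseChange_tmul (θ : A ≃ₐc[F] A) (r : K) (a : A) :
    autBaseChange K θ (r ⊗ₜ a) = r ⊗ₜ θ a := rfl

theorem lieAlgebra_baseChange_ext {X Y : lieAlgebra K (K ⊗[F] A)}
    (h : ∀ a : A, X.1 (1 ⊗ₜ a) = Y.1 (1 ⊗ₜ a)) : X = Y := by
  ext t
  induction t with
  | zero => simp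
  | add x y hx hy => rw [map_add, map_add, hx, hy]
  | tmul r a =>
    have : r ⊗ₜ[F] a = r • (1 ⊗ₜ[F] a) := by rw [TensorProduct.smul_tmul', smul_eq_mul, mul_one]
    rw [this, Derivation.map_smul, Derivation.map_smul, h]

theorem lieBaseChange_lie (X Y : lieAlgebra F A) :
    lieBaseChange K ⁅X, Y⁆ = ⁅lieBaseChange K X, lieBaseChange K Y⁆ := by
  refine lieAlgebra_baseChange_ext fun a => ?_
  rw [lieBaseChange_tmul]
  change 1 ⊗ₜ ((⁅X.1, Y.1⁆ : Derivation F A A) a) =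
    (⁅(lieBaseChange K X).1, (lieBaseChange K Y).1⁆ : Derivation K _ _) (1 ⊗ₜ a)
  rw [Derivation.commutator_apply, Derivation.commutator_apply]
  simp only [lieBaseChange_tmul, TensorProduct.tmul_sub]

theorem lieBaseChange_add (X Y : lieAlgebra F A) :
    lieBaseChange K (X + Y) = lieBaseChange K X + lieBaseChange K Y := by
  refine lieAlgebra_baseChange_ext fun a => ?_
  rw [lieBaseChange_tmul]
  change 1 ⊗ₜ (X.1 a + Y.1 a) = (lieBaseChange K X).1 (1 ⊗ₜ a) + (lieBaseChange K Y).1 (1 ⊗ₜ a)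
  rw [lieBaseChange_tmul, lieBaseChange_tmul, TensorProduct.tmul_add]

theorem lieBaseChange_neg (X : lieAlgebra F A) :
    lieBaseChange K (-X) = -lieBaseChange K X := by
  refine lieAlgebra_baseChange_ext fun a => ?_
  rw [lieBaseChange_tmul]
  change 1 ⊗ₜ (-X.1 a) = -(lieBaseChange K X).1 (1 ⊗ₜ a)
  rw [lieBaseChange_tmul, TensorProduct.tmul_neg]

theorem lieBaseChange_mem_eigenMinus {θ : A ≃ₐc[F] A} {X : lieAlgebra F A}
    (hX : X ∈ eigenMinus θ) : lieBaseChange K X ∈ eigenMinus (autBaseChange K θ) := by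
  rw [mem_eigenMinus_iff] at hX ⊢
  intro t
  induction t with
  | zero => simp
  | add x y hx hy => simp only [map_add, hx, hy, neg_add]
  | tmul r a =>
    rw [autBaseChange_tmul, lieBaseChange_tmul, hX, lieBaseChange_tmul, autBaseChange_tmul,
      TensorProduct.tmul_neg]

theorem autBaseChange_autBaseChange {θ : A ≃ₐc[F] A} (hθ : ∀ a, θ (θ a) = a) (t : K ⊗[F] A) :
    autBaseChange K θ (autBaseChange K θ t) = t := by
  induction t with
  | zero => simp
  | add x y hx hy => rw [map_add, map_add, hx, hy]
  | tmul r a => rw [autBaseChange_tmul, autBaseChange_tmul, hθ]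

theorem IsNilpotentElement.lieBaseChange {X : lieAlgebra F A} (hX : IsNilpotentElement X) :
    IsNilpotentElement (lieBaseChange K X) := by
  have key : ∀ t, t ∈ (lieEnd (AlgebraicGroup.lieBaseChange K X)).maxGenEigenspace 0 := by
    intro t
    induction t with
    | zero => exact Submodule.zero_mem _
    | add x y hx hy => exact Submodule.add_mem _ hx hy
    | tmul r a =>
      obtain ⟨n, hn⟩ := hX a
      have hpow : ∀ (n : ℕ) (a : A), ((lieEnd (AlgebraicGroup.lieBaseChange K X)) ^ n) (r ⊗ₜ a) =
          r ⊗ₜ ((lieEnd X) ^ n) a := by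
        intro n
        induction n with
        | zero => intro a; rfl
        | succ n ih =>
          intro a
          rw [pow_succ, pow_succ, Module.End.mul_apply, Module.End.mul_apply, ← ih]
          exact congrArg _ (lieBaseChange_tmul X r a)
      rw [Module.End.mem_maxGenEigenspace]
      refine ⟨n, ?_⟩
      rw [zero_smul, sub_zero, hpow]
      exact (congrArg _ hn).trans (TensorProduct.tmul_zero _ _)
  intro t
  have h := key t
  rw [Module.End.mem_maxGenEigenspace] at h
  simpa only [zero_smul, sub_zero] using h

variable (K) in
/-- The base change to `K` of a functional on `F[G]`. -/
def extendFunctional (ψ : A →ₗ[F] F) : K ⊗[F] A →ₗ[K] K :=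
  (Algebra.TensorProduct.rid F K K).toLinearMap ∘ₗ ψ.baseChange K

theorem extendFunctional_tmul (ψ : A →ₗ[F] F) (r : K) (a : A) :
    extendFunctional K ψ (r ⊗ₜ a) = ψ a • r := by
  simp [extendFunctional]

theorem lam_baseChange (ψ : A →ₗ[F] F) (r : K) (a : A) :
    lam (extendFunctional K ψ) (r ⊗ₜ a) = r ⊗ₜ lam ψ a := by
  have key : ∀ t : A ⊗[F] A, LinearMap.mul' K (K ⊗[F] A) (TensorProduct.map
      (Algebra.linearMap K (K ⊗[F] A) ∘ₗ extendFunctional K ψ) LinearMap.id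
        (TensorProduct.AlgebraTensorModule.tensorTensorTensorComm F K F K K K A A
          (comul (R := K) r ⊗ₜ[F] t))) =
      r ⊗ₜ LinearMap.mul' F A (TensorProduct.map (Algebra.linearMap F A ∘ₗ ψ) LinearMap.id t) := by
    intro t
    induction t with
    | zero => simp
    | add x y hx hy => simp only [map_add, TensorProduct.tmul_add, hx, hy]
    | tmul x y =>
      simp [CommSemiring.comul_apply, extendFunctional_tmul, ← Algebra.smul_def]
  exact key (comul a)

/-- An `F`-linear retraction `K → F` induces a retraction of Lie algebras, compatible with the
brackets with elements defined over `F`. -/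
theorem exists_lieRetraction (l : K →ₗ[F] F) (hl : l 1 = 1) :
    ∃ π : lieAlgebra K (K ⊗[F] A) → lieAlgebra F A, (∀ X, π (lieBaseChange K X) = X) ∧
      ∀ (X : lieAlgebra F A) Z, π ⁅lieBaseChange K X, Z⁆ = ⁅X, π Z⁆ := by
  -- `l` applied to the coefficients. This map is `A`-linear and commutes with the operators `lam`
  -- of functionals over `F`, so composing a left invariant derivation with it and restricting to
  -- `A` gives one over `F`.
  let Λ : K ⊗[F] A →ₗ[F] A := (TensorProduct.lid F A).toLinearMap ∘ₗ l.rTensor A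
  have hΛ : ∀ (r : K) (a : A), Λ (r ⊗ₜ a) = l r • a := fun r a => by simp [Λ]
  have hΛmul : ∀ (a : A) (t : K ⊗[F] A), Λ ((1 ⊗ₜ a) * t) = a * Λ t := by
    intro a t
    induction t with
    | zero => simp
    | add x y hx hy => simp only [mul_add, map_add, hx, hy]
    | tmul r b => simp [hΛ]
  have hΛlie : ∀ (X : lieAlgebra F A) (t : K ⊗[F] A), Λ ((lieBaseChange K X).1 t) = X.1 (Λ t) := by
    intro X t
    induction t with
    | zero => simp
    | add x y hx hy => simp only [map_add, hx, hy]
    | tmul r b => simp [hΛ, lieBaseChange_tmul]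
  let π₀ (Z : lieAlgebra K (K ⊗[F] A)) : A →ₗ[F] A :=
    Λ ∘ₗ (Z.1 : K ⊗[F] A →ₗ[K] K ⊗[F] A).restrictScalars F ∘ₗ TensorProduct.mk F K A 1
  have hπ₀ : ∀ Z a, π₀ Z a = Λ (Z.1 (1 ⊗ₜ a)) := fun Z a => rfl
  let π (Z : lieAlgebra K (K ⊗[F] A)) : lieAlgebra F A :=
    { val := Derivation.mk' (π₀ Z) (fun a b => by
        have : (1 : K) ⊗ₜ[F] (a * b) = (1 ⊗ₜ a) * (1 ⊗ₜ b) := by simp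
        rw [hπ₀, this, Derivation.leibniz, smul_eq_mul, smul_eq_mul, map_add, hΛmul, hΛmul]
        rfl)
      property := by
        refine leftInvariant_of_forall_lam (T := π₀ Z) fun ψ a => ?_
        have hΛlam : ∀ t, Λ (lam (extendFunctional K ψ) t) = lam ψ (Λ t) := by
          intro t
          induction t with
          | zero => simp
          | add x y hx hy => simp only [map_add, hx, hy]
          | tmul r b => rw [lam_baseChange, hΛ, hΛ, map_smul]
        rw [hπ₀, hπ₀, ← lam_baseChange, ← hΛlam]
        exact congrArg Λ ((leftInvariant_lie Z).lam_comp _ _) }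
  have hπ : ∀ Z a, (π Z).1 a = Λ (Z.1 (1 ⊗ₜ a)) := fun Z a => rfl
  refine ⟨π, fun X => ?_, fun X Z => ?_⟩
  · ext a
    rw [hπ, lieBaseChange_tmul, hΛ, hl, one_smul]
  · ext a
    rw [hπ]
    change Λ ((⁅(lieBaseChange K X).1, Z.1⁆ : Derivation K _ _) (1 ⊗ₜ a)) =
      (⁅X.1, (π Z).1⁆ : Derivation F A A) a
    rw [Derivation.commutator_apply, Derivation.commutator_apply, map_sub, hΛlie, hπ, hπ,
      lieBaseChange_tmul]

/-- The form, and so a solution, exists over `K`. The equation is linear in `z` with coefficients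
from `F`, so the retraction of Lie algebras carries that solution to one over `F`. No involution
matters here, and the form is taken for the identity. -/
theorem exists_eq_lie_lie_of_isNilpotentElement [CharZero F] [IsAlgClosure F K]
    [Algebra.FiniteType F A] (hG : IsReductive K (K ⊗[F] A)) {e : lieAlgebra F A}
    (hnil : IsNilpotentElement e) : ∃ z, e = ⁅e, ⁅e, z⁆⁆ := by
  have hcK : CharZero K := charZero_of_injective_algebraMap (algebraMap F K).injective
  have hK : IsAlgClosed K := IsAlgClosure.isAlgClosed F
  have hfd : FiniteDimensional K (lieAlgebra K (K ⊗[F] A)) := finiteDimensional_lieAlgebra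
  obtain ⟨β, hnd, hsymm, hinv, -, hβ⟩ :=
    hG.exists_bilinForm (BialgEquiv.refl K (K ⊗[F] A)) fun _ => rfl
  obtain ⟨l, hl⟩ := (Algebra.linearMap F K).exists_leftInverse_of_injective
    (LinearMap.ker_eq_bot.mpr (algebraMap F K).injective)
  obtain ⟨π, hπ, hπl⟩ := exists_lieRetraction (A := A) l
    (by simpa using DFunLike.congr_fun hl 1)
  obtain ⟨Z, hZ⟩ := exists_eq_lie_lie β hnd hsymm hinv (lieBaseChange K e)
    fun z hz => hβ _ z hnil.lieBaseChange hz
  refine ⟨π Z, ?_⟩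
  rw [← hπl, ← hπl, ← hZ, hπ]

end BaseChange

end

end AlgebraicGroup

theorem lemma2p4 {F K A : Type*} [Field F] [CharZero F]
    [Field K] [Algebra F K] [IsAlgClosure F K]
    [CommRing A] [HopfAlgebra F A] [Algebra.FiniteType F A]
    (hG : AlgebraicGroup.IsReductive K (K ⊗[F] A))
    (θ : A ≃ₐc[F] A) (hθ : ∀ a : A, θ (θ a) = a)
    (e : AlgebraicGroup.lieAlgebra F A) (he0 : e ≠ 0)
    (hrr : e ∈ AlgebraicGroup.relativelyRegularPoints K θ)
    (hnil : AlgebraicGroup.IsNilpotentElement e) :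
    ∃ f h : AlgebraicGroup.lieAlgebra F A, IsSl2Triple h e f ∧
      f ∈ AlgebraicGroup.relativelyRegularPoints K θ ∧
      h ∈ AlgebraicGroup.eigenPlus θ := by
  have hcK : CharZero K := charZero_of_injective_algebraMap (algebraMap F K).injective
  have hK : IsAlgClosed K := IsAlgClosure.isAlgClosed F
  have hfd : FiniteDimensional F (AlgebraicGroup.lieAlgebra F A) :=
    AlgebraicGroup.finiteDimensional_lieAlgebra
  obtain ⟨f, h, ht, hf, hh⟩ := AlgebraicGroup.exists_isSl2Triple
    (AlgebraicGroup.differential_differential hθ) (AlgebraicGroup.differential_lie θ) he0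
    (AlgebraicGroup.mem_eigenMinus_iff_differential.mp hrr.1)
    (AlgebraicGroup.exists_eq_lie_lie_of_isNilpotentElement hG hnil)
  rw [← AlgebraicGroup.mem_eigenMinus_iff_differential] at hf
  have hfK := AlgebraicGroup.lieBaseChange_mem_eigenMinus (K := K) hf
  -- The orbit of `e` dominates all others, so it suffices that the orbit of `f` has the same
  -- dimension; this is checked on the base change of the triple to `K`.
  refine ⟨f, h, ht, ⟨hf, hfK, fun Y hY => (hrr.2.2 Y hY).trans (le_of_eq ?_)⟩,
    AlgebraicGroup.mem_eigenPlus_iff_differential.mpr hh⟩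
  refine hG.zariskiDim_orbit_eq (AlgebraicGroup.autBaseChange K θ)
    (AlgebraicGroup.autBaseChange_autBaseChange hθ) (h := AlgebraicGroup.lieBaseChange K h)
    ?_ ?_ ?_ hrr.2.1 hfK
  · rw [← AlgebraicGroup.lieBaseChange_lie, ht.lie_e_f]
  · rw [← AlgebraicGroup.lieBaseChange_lie, ht.lie_h_e_nsmul, two_nsmul,
      AlgebraicGroup.lieBaseChange_add, two_smul]
  · rw [← AlgebraicGroup.lieBaseChange_lie, ht.lie_h_f_nsmul, two_nsmul,
      AlgebraicGroup.lieBaseChange_neg, AlgebraicGroup.lieBaseChange_add, two_smul]
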